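/- **Setting.** Let $Q\succ0$ ($n\times n$) and $R\succ0$ ($m\times m$). For $\theta\in\mathbb R^{(n+m)\times n}$, $\theta^\top=[A\ B]$, let $P(\theta)$ be the positive definite solution (if it exists) of $P=Q+A^\top PA+A^\top PBK$, $K=K(\theta)=-(R+B^\top PB)^{-1}B^\top PA$, and let $J(\theta)=\mathrm{Tr}\,P(\theta)$. The true parameter $\theta_*$ (with $\theta_*^\top=[A_*\ B_*]$) is random with an arbitrary law. For constants $M_P$ and $\rho<1$ let $\mathcal Q=\{\theta: P(\theta)\text{ exists},\ \mathrm{Tr}\,P(\theta)\le M_P,\ \|A_*+B_*K(\theta)\|_2\le\rho\}$, and assume that, almost surely, $\theta_*$ lies in $\mathcal Q$ together with its Frobenius ball of a fixed radius $r>0$. *Offline data.* A trajectory $y_s=(\xi_s,v_s)$, $1\le s\le S$, of the system $\xi_{s+1}=\theta_*^{\mathrm{sim}\top}y_s+w_s^{\mathrm{sim}}$ is given. It is adapted to a filtration $(\mathcal G_s)$ with $\mathbb E[w^{\mathrm{sim}}_s|\mathcal G_s]=0$ and $\mathbb E[w_s^{\mathrm{sim}}w_s^{\mathrm{sim}\top}|\mathcal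 G_s]=I$. Put $U_S=\sum_{s=1}^Sy_sy_s^\top$. Let $\hat\theta_S$ (an estimate) and $\alpha_S(\delta_1)\ge0$ (a confidence radius) be $\mathcal G_S$-measurable, such that with probability at least $1-\delta_1$ both $\|U_S^{1/2}(\hat\theta_S-\theta_*^{\mathrm{sim}})\|_F\le\alpha_S(\delta_1)$ and, if $S\ge200(n+m)\log(12/\delta_1)$, $\lambda_{\min}(U_S)\ge S/40$. Assume that the radius is polylogarithmic: with probability at least $1-\delta_1$, $\alpha_S(\delta_1)\le c_\alpha\log(S/\delta_1)^{k_\alpha}$. *Online algorithm (TSOD-LQR with $M_\delta=0$).* Start at $x_1=0$. At time $t=1,\dots,T$ let $V_t=U_S+\sum_{k<t}z_kz_k^\top$, $\hat\theta_t=V_t^{-1}\bigl(U_S\hat\theta_S+\sum_{k<t}z_kx_{k+1}^\top\bigr)$ and $\beta_t=n\sqrt{2\log\bigl(\det(V_t)^{1/2}/(\det(U_S)^{1/2}\delta_2)\bigr)}+\alpha_S(\delta_1)$. Draw $\tilde\theta_t$ as $\hat\theta_t+\beta_tV_t^{-1/2}\eta$, where $\eta$ has i.i.d. standard normal entries, redrawing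 $\eta$ independently until the result lies in $\mathcal Q$. Apply $u_t=K(\tilde\theta_t)x_t$, put $z_t=(x_t,u_t)$, pay $c_t=x_t^\top Qx_t+u_t^\top Ru_t$, and move to $x_{t+1}=\theta_*^\top z_t+w_t$. Here the $w_t\sim\mathcal N(0,I)$ and all the $\eta$'s are independent of each other and jointly independent of $(\mathcal G_S,\theta_*)$. The Bayes regret given the offline data is $\mathcal R_T=\mathbb E\bigl[\sum_{t=1}^T(c_t-J(\theta_*))\,\big|\,\mathcal G_S\bigr]$. **Corollary.** There are constants $C,k$, depending only on $n,m,Q,R,M_P,\rho,r,c_\alpha,k_\alpha$, such that the following holds for all $\delta\in(0,1)$ and $T\ge1$. Let $\delta_1=\delta/(16S)$, $\delta_2=\delta/(16T)$, let $\theta_*=\theta_*^{\mathrm{sim}}$ almost surely, and let $S\ge\max\{T,\,200(n+m)\log(12/\delta_1)\}$. Then there is an event $G\in\mathcal G_S$ of probability at least $1-\delta$ on which $\sum_{t=1}^T(c_t-J(\theta_*))$ is integrable and $$\mathcal R_T\le C\,\log(S/\delta)^k\sqrt{T/S}\quad\text{almost surely},$$ that is, $\mathcal R_T=\tilde{\mathcal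 O}(\sqrt{T/S})$. In particular, since $S\ge T$, also $\mathcal R_T\le C\log(S/\delta)^k$ almost surely on $G$. -/

import Mathlib

open MeasureTheory ProbabilityTheory
open scoped Matrix MatrixOrder

universe u

noncomputable section

/-- The parameter `θ` of a linear system, `θᵀ = [A B]`, with `n` states and `m` inputs. -/
abbrev Param (n m : ℕ) := Matrix (Fin n ⊕ Fin m) (Fin n) ℝ

namespace Param

variable {n m : ℕ}

/-- The state matrix `A`. -/
def A (θ : Param n m) : Matrix (Fin n) (Fin n) ℝ := (Matrix.toRows₁ θ)ᵀ

/-- The input matrix `B`. -/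
def B (θ : Param n m) : Matrix (Fin n) (Fin m) ℝ := (Matrix.toRows₂ θ)ᵀ

end Param

/-- Frobenius norm. -/
def frob {ι κ : Type*} [Fintype ι] [Fintype κ] (M : Matrix ι κ ℝ) : ℝ :=
  Real.sqrt (∑ i, ∑ j, M i j ^ 2)

/-- Spectral norm (operator norm for the Euclidean norm) of a square matrix. -/
def specNorm {n : ℕ} (M : Matrix (Fin n) (Fin n) ℝ) : ℝ :=
  ‖Matrix.toEuclideanCLM (n := Fin n) (𝕜 := ℝ) M‖

/-- Smallest eigenvalue of a symmetric matrix. -/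
def lamMin {ι : Type*} [Fintype ι] [DecidableEq ι] (M : Matrix ι ι ℝ) : ℝ := sInf (spectrum ℝ M)

/-- Largest eigenvalue of a symmetric matrix. -/
def lamMax {ι : Type*} [Fintype ι] [DecidableEq ι] (M : Matrix ι ι ℝ) : ℝ := sSup (spectrum ℝ M)

/-! ### The linear quadratic regulator -/

section LQR

variable {n m : ℕ} (Qc : Matrix (Fin n) (Fin n) ℝ) (Rc : Matrix (Fin m) (Fin m) ℝ)

/-- The gain `-(R + BᵀPB)⁻¹ BᵀPA`. -/
def gainOf (θ : Param n m) (P : Matrix (Fin n) (Fin n) ℝ) : Matrix (Fin m) (Fin n) ℝ :=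
  -((Rc + θ.Bᵀ * P * θ.B)⁻¹ * θ.Bᵀ * P * θ.A)

/-- `P` is a positive definite solution of the discrete algebraic Riccati equation of `θ`. -/
def IsRiccatiSolution (θ : Param n m) (P : Matrix (Fin n) (Fin n) ℝ) : Prop :=
  P.PosDef ∧ P = Qc + θ.Aᵀ * P * θ.A + θ.Aᵀ * P * θ.B * gainOf Rc θ P

open Classical in
/-- `P(θ)`: the positive definite solution of the Riccati equation. For positive definite `Q`, `R`
it is unique, and it exists iff `θ` is stabilizable. The value `0` is used if there is none. -/
def riccati (θ : Param n m) : Matrix (Fin n) (Fin n) ℝ :=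
  if h : ∃ P, IsRiccatiSolution Qc Rc θ P then h.choose else 0

/-- The optimal gain `K(θ)`. -/
def optGain (θ : Param n m) : Matrix (Fin m) (Fin n) ℝ := gainOf Rc θ (riccati Qc Rc θ)

/-- The optimal average cost `J(θ) = Tr P(θ)`. -/
def optCost (θ : Param n m) : ℝ := (riccati Qc Rc θ).trace

/-- The stage cost `xᵀQx + uᵀRu`. -/
def stageCost (x : Fin n → ℝ) (u : Fin m → ℝ) : ℝ := x ⬝ᵥ (Qc *ᵥ x) + u ⬝ᵥ (Rc *ᵥ u)

/-- The admissible set `𝒬` belonging to the true parameter `θstar`: the parameters `θ` for which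
`P(θ)` exists, `Tr P(θ) ≤ M_P`, and `‖A_* + B_* K(θ)‖₂ ≤ ρ`. -/
def admissible (MP ρ : ℝ) (θstar : Param n m) : Set (Param n m) :=
  {θ | (∃ P, IsRiccatiSolution Qc Rc θ P) ∧ (riccati Qc Rc θ).trace ≤ MP ∧
    specNorm (θstar.A + θstar.B * optGain Qc Rc θ) ≤ ρ}

end LQR

/-! ### The algorithm TSOD-LQR -/

section Algorithm

variable {n m : ℕ}

/-- The confidence width `β_t(δ₂)`, for `V = V_t`, `U = U_S` and `α = α_S(δ₁)`. -/
def betaWidth (U V : Matrix (Fin n ⊕ Fin m) (Fin n ⊕ Fin m) ℝ) (α δ₂ Mδ : ℝ) : ℝ :=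
  n * Real.sqrt (2 * Real.log (Real.sqrt V.det / (Real.sqrt U.det * δ₂))) + α
    + Real.sqrt (lamMax U) * Mδ

/-- Rejection sampling: the first of the candidates that lies in `Q`. -/
def rejectionSample (Q : Set (Param n m)) (cand : ℕ → Param n m) : Param n m :=
  cand (sInf {j | cand j ∈ Q})

/-- What the algorithm keeps at time `t`: the state `x_t`, the precision matrix
`V_t = U_S + ∑_{k<t} z_k z_kᵀ`, and `b_t = U_S θ̂_S + ∑_{k<t} z_k x_{k+1}ᵀ`. -/
structure OnlineState (n m : ℕ) where
  x : Fin n → ℝ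
  V : Matrix (Fin n ⊕ Fin m) (Fin n ⊕ Fin m) ℝ
  b : Param n m

/-- The inputs of a run of the algorithm on the system `θstar`: costs, the constants of the
admissible set, the offline data `U = U_S`, `θhat = θ̂_S`, `α = α_S(δ₁)`, the constants `δ₂`, `M_δ`,
and realizations of the noise. `w k` is the system noise in the `k`-th step (counted from `0`), and
`η k j` is the standard Gaussian matrix of the `j`-th proposal in the `k`-th step. -/
structure RunInput (n m : ℕ) where
  Qc : Matrix (Fin n) (Fin n) ℝ
  Rc : Matrix (Fin m) (Fin m) ℝ
  MP : ℝ
  ρ : ℝ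
  θstar : Param n m
  U : Matrix (Fin n ⊕ Fin m) (Fin n ⊕ Fin m) ℝ
  θhat : Param n m
  α : ℝ
  δ₂ : ℝ
  Mδ : ℝ
  w : ℕ → Fin n → ℝ
  η : ℕ → ℕ → Param n m

namespace RunInput

variable (I : RunInput n m)

/-- The regularized least squares estimate `θ̂_t = V_t⁻¹ b_t`. -/
def estimate (s : OnlineState n m) : Param n m := s.V⁻¹ * s.b

/-- The proposals `θ̂_t + β_t(δ₂) V_t^{-1/2} η`. -/
def candidate (k : ℕ) (s : OnlineState n m) (j : ℕ) : Param n m :=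
  estimate s + betaWidth I.U s.V I.α I.δ₂ I.Mδ • ((CFC.sqrt s.V)⁻¹ * I.η k j)

/-- The sampled parameter `θ̃_t`. -/
def sample (k : ℕ) (s : OnlineState n m) : Param n m :=
  rejectionSample (admissible I.Qc I.Rc I.MP I.ρ I.θstar) (I.candidate k s)

/-- The control `u_t = K(θ̃_t) x_t`. -/
def control (k : ℕ) (s : OnlineState n m) : Fin m → ℝ :=
  optGain I.Qc I.Rc (I.sample k s) *ᵥ s.x

/-- One step: apply the control, move to `x_{t+1} = θ_*ᵀ z_t + w_t`, and update `V` and `b`. -/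
def step (k : ℕ) (s : OnlineState n m) : OnlineState n m :=
  let z : Fin n ⊕ Fin m → ℝ := Sum.elim s.x (I.control k s)
  let x' : Fin n → ℝ := I.θstarᵀ *ᵥ z + I.w k
  { x := x'
    V := s.V + Matrix.vecMulVec z z
    b := s.b + Matrix.vecMulVec z x' }

/-- The state after `k` completed steps, i.e. at time `t = k + 1`; the run starts at `x_1 = 0`. -/
def state : ℕ → OnlineState n m
  | 0 => { x := 0, V := I.U, b := I.U * I.θhat }
  | k + 1 => I.step k (state k)

/-- `∑_{t=1}^T (c_t - J(θ_*))` along the run. -/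
def excessCost (T : ℕ) : ℝ :=
  ∑ k ∈ Finset.range T,
    (stageCost I.Qc I.Rc (I.state k).x (I.control k (I.state k)) - optCost I.Qc I.Rc I.θstar)

end RunInput

end Algorithm

/-! ### The random experiment -/

/-- The random variables: the true parameter `θstar`, the parameter `θsim` of the offline system,
the offline trajectory `(ξ_s, v_s)` with noise `wsim` and filtration `𝓖`, the offline estimate
`θhat = θ̂_S`, the offline confidence radius `α = α_S(δ₁)`, the online noise `w`, and the
Gaussian matrices `η` used by the sampling steps. -/
structure Experiment (n m : ℕ) (Ω : Type*) [mΩ : MeasurableSpace Ω] where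
  θstar : Ω → Param n m
  θsim : Ω → Param n m
  ξ : ℕ → Ω → Fin n → ℝ
  v : ℕ → Ω → Fin m → ℝ
  wsim : ℕ → Ω → Fin n → ℝ
  𝓖 : Filtration ℕ mΩ
  θhat : Ω → Param n m
  α : Ω → ℝ
  w : ℕ → Ω → Fin n → ℝ
  η : ℕ → ℕ → Ω → Param n m

namespace Experiment

variable {n m : ℕ} {Ω : Type*} [mΩ : MeasurableSpace Ω] (X : Experiment n m Ω)

/-- The offline state-action pair `y_s`. -/
def y (s : ℕ) (ω : Ω) : Fin n ⊕ Fin m → ℝ := Sum.elim (X.ξ s ω) (X.v s ω)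

/-- The offline precision matrix `U_s = ∑_{k=1}^s y_k y_kᵀ`. -/
def U (s : ℕ) (ω : Ω) : Matrix (Fin n ⊕ Fin m) (Fin n ⊕ Fin m) ℝ :=
  ∑ k ∈ Finset.Icc 1 s, Matrix.vecMulVec (X.y k ω) (X.y k ω)

/-- All scalar entries of the online noise and of the Gaussian matrices, as one family. -/
def gaussians : (ℕ × Fin n) ⊕ (ℕ × ℕ × (Fin n ⊕ Fin m) × Fin n) → Ω → ℝ
  | .inl (k, i) => fun ω => X.w k ω i
  | .inr (k, j, a, i) => fun ω => X.η k j ω a i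

/-- The σ-algebra generated by the true parameter. -/
abbrev sigmaθ : MeasurableSpace Ω :=
  ⨆ a, ⨆ i, MeasurableSpace.comap (fun ω => X.θstar ω a i) inferInstance

/-- The offline part of the model, for a trajectory of length `S`. -/
structure OfflineModel (S : ℕ) (P : Measure Ω) : Prop where
  ξ_meas : ∀ s ∈ Finset.Icc 1 S, ∀ i, Measurable[X.𝓖 s] fun ω => X.ξ s ω i
  v_meas : ∀ s ∈ Finset.Icc 1 S, ∀ i, Measurable[X.𝓖 s] fun ω => X.v s ω i
  dynamics : ∀ s, 1 ≤ s → s < S → ∀ᵐ ω ∂P, X.ξ (s + 1) ω = (X.θsim ω)ᵀ *ᵥ X.y s ω + X.wsim s ω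
  noise_sq : ∀ s, 1 ≤ s → s < S → ∀ i, MemLp (fun ω => X.wsim s ω i) 2 P
  noise_mean : ∀ s, 1 ≤ s → s < S → ∀ i, P[fun ω => X.wsim s ω i | X.𝓖 s] =ᵐ[P] 0
  noise_cov : ∀ s, 1 ≤ s → s < S → ∀ i j,
    P[fun ω => X.wsim s ω i * X.wsim s ω j | X.𝓖 s]
      =ᵐ[P] fun _ => (1 : Matrix (Fin n) (Fin n) ℝ) i j
  θhat_meas : ∀ a i, Measurable[X.𝓖 S] fun ω => X.θhat ω a i
  α_meas : Measurable[X.𝓖 S] X.α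
  α_nonneg : ∀ ω, 0 ≤ X.α ω

/-- The guarantee of the offline algorithm: with probability at least `1 - δ₁`, the estimate has
error at most `α_S(δ₁)` in the `U_S`-norm, and, if the trajectory is long enough, the smallest
eigenvalue of `U_S` is at least `S / 40`. -/
def OfflineGuarantee (S : ℕ) (δ₁ : ℝ) (P : Measure Ω) : Prop :=
  1 - δ₁ ≤ P.real {ω | frob (CFC.sqrt (X.U S ω) * (X.θhat ω - X.θsim ω)) ≤ X.α ω ∧
    (200 * ((n : ℝ) + m) * Real.log (12 / δ₁) ≤ S → (S : ℝ) / 40 ≤ lamMin (X.U S ω))}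

/-- The online part of the model: the entries of the noise and of the Gaussian matrices are i.i.d.
standard normal, and jointly independent of the offline information and the true parameter. -/
structure OnlineModel (S : ℕ) (P : Measure Ω) : Prop where
  θstar_meas : ∀ a i, Measurable fun ω => X.θstar ω a i
  gauss_meas : ∀ c, Measurable (X.gaussians c)
  gauss_law : ∀ c, P.map (X.gaussians c) = gaussianReal 0 1
  gauss_indep : iIndepFun X.gaussians P
  indep : Indep (⨆ c, MeasurableSpace.comap (X.gaussians c) inferInstance)
    (X.𝓖 S ⊔ X.sigmaθ) P

/-- The run of the algorithm in the outcome `ω`. -/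
def run (Qc : Matrix (Fin n) (Fin n) ℝ) (Rc : Matrix (Fin m) (Fin m) ℝ) (MP ρ : ℝ) (S : ℕ)
    (δ₂ Mδ : ℝ) (ω : Ω) : RunInput n m where
  Qc := Qc
  Rc := Rc
  MP := MP
  ρ := ρ
  θstar := X.θstar ω
  U := X.U S ω
  θhat := X.θhat ω
  α := X.α ω
  δ₂ := δ₂
  Mδ := Mδ
  w := fun k => X.w k ω
  η := fun k j => X.η k j ω

/-- The Bayes regret given the offline data, on a set `G` of offline outcomes: the conditional
expectation of `∑_{t=1}^T (c_t - J(θ_*))` given the offline information. (For `G ∈ 𝓖 S` the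
indicator only localizes the conditional expectation to `G`.) -/
def regretOn (Qc : Matrix (Fin n) (Fin n) ℝ) (Rc : Matrix (Fin m) (Fin m) ℝ) (MP ρ : ℝ) (S T : ℕ)
    (δ₂ Mδ : ℝ) (P : Measure Ω) (G : Set Ω) : Ω → ℝ :=
  P[G.indicator fun ω => (X.run Qc Rc MP ρ S δ₂ Mδ ω).excessCost T | X.𝓖 S]

end Experiment

end

/-! The bound actually proved is `T / S` times a power of `log (S / δ)`. Since `T ≤ S`, both claimed
bounds follow from it.

Regret and gap. Completing the square in the Riccati equation of `θ_*` (`IsRiccatiSolution.bellman`)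
shows that the expected excess cost of a step is the expected suboptimality of the gain used
(`gainGap`, `RunInput.gap`) plus a telescoping difference of `xᵀ P(θ_*) x`; the noise contributes
`Tr P(θ_*) = J(θ_*)`. As the run starts at `0` and `P(θ_*)` is positive, the regret is at most the
sum of the expected gaps (`integral_excessCost_le`).

The gap is quadratic in the parameter error. Each gain satisfies a stationarity condition, and the
Riccati solution is Lipschitz on the admissible set because the true closed loop contracts by `ρ`.
Hence the gap at `x` is at most `C₂ ‖θ̃ - θ_*‖² |x|²`, and also at most `C₁ |x|²`
(`exists_gain_bounds`).

The error has mean square of order `1 / S`. As `θ_*` has an admissible ball of radius `r` around it,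
an accepted proposal is, up to a constant and a truncation, as accurate as a single one
(`lintegral_min_rejectionSample_le`). The error of a proposal has three sources, all damped by `V_t
≥ U_S ≥ c I` with `c = S / 40`: the offline error, of order `1 / c` times its square in the
`U_S`-norm; the online noise, of order `c⁻² ‖∑ z wᵀ‖²`, whose second moment grows only linearly in
time and is thus `O(1 / c)` as long as `T ≤ S`; and the Gaussian perturbation, of order `β_t² / c`,
where `β_t` is controlled by the growth of the determinant. All are weighted by `|x_t|²`, which is
not independent of them; the moment recursions of the contracting state handle this
(`integral_frob_noiseCorr_sq_mul_le`). The result is `integral_gap_le_of_le`.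

Conditioning. Online noise and offline data are independent, so all of this is done for frozen
offline data (`OnlineSetting`) and integrated afterwards. The good event `G` requires `U_S ≥ (S /
40) I`, a small radius, and conditional probability at most `1 / S` that the offline confidence set
misses `θ_*`. A miss costs at most a constant per step (`integral_excessCost_le_mul`) and
contributes again only `O(T / S)`. -/

/-! ### Quadratic forms and Euclidean norms of coordinate vectors -/

section LinearAlgebra

variable {ι κ : Type*} [Fintype ι] [Fintype κ]

/-- The Euclidean norm of a coordinate vector. -/
noncomputable def euc (x : ι → ℝ) : ℝ := ‖(WithLp.toLp 2 x : EuclideanSpace ℝ ι)‖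

lemma euc_nonneg (x : ι → ℝ) : 0 ≤ euc x := norm_nonneg _

lemma euc_sq (x : ι → ℝ) : euc x ^ 2 = x ⬝ᵥ x := by
  rw [euc, EuclideanSpace.real_norm_sq_eq]
  simp [dotProduct, pow_two]

lemma euc_sq_sum (x : ι → ℝ) : euc x ^ 2 = ∑ i, x i ^ 2 := by
  rw [euc, EuclideanSpace.real_norm_sq_eq]

@[simp] lemma euc_zero : euc (0 : ι → ℝ) = 0 := by simp [euc]

lemma euc_smul (c : ℝ) (x : ι → ℝ) : euc (c • x) = |c| * euc x := by
  simpa [euc] using norm_smul c (WithLp.toLp 2 x : EuclideanSpace ℝ ι)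

lemma euc_add_le (x y : ι → ℝ) : euc (x + y) ≤ euc x + euc y := by
  simpa [euc] using norm_add_le (WithLp.toLp 2 x : EuclideanSpace ℝ ι) (WithLp.toLp 2 y)

lemma euc_sub_le (x y : ι → ℝ) : euc (x - y) ≤ euc x + euc y := by
  simpa [euc] using norm_sub_le (WithLp.toLp 2 x : EuclideanSpace ℝ ι) (WithLp.toLp 2 y)

lemma euc_eq_zero {x : ι → ℝ} : euc x = 0 ↔ x = 0 := by
  simp [euc]

lemma abs_dotProduct_le (x y : ι → ℝ) : |x ⬝ᵥ y| ≤ euc x * euc y := by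
  have h := abs_real_inner_le_norm (WithLp.toLp 2 y : EuclideanSpace ℝ ι) (WithLp.toLp 2 x)
  rw [EuclideanSpace.inner_toLp_toLp] at h
  simpa [euc, mul_comm] using h

lemma dotProduct_le_euc (x y : ι → ℝ) : x ⬝ᵥ y ≤ euc x * euc y :=
  (le_abs_self _).trans (abs_dotProduct_le x y)

lemma frob_nonneg (M : Matrix ι κ ℝ) : 0 ≤ frob M := Real.sqrt_nonneg _

lemma frob_sq (M : Matrix ι κ ℝ) : frob M ^ 2 = ∑ i, ∑ j, M i j ^ 2 :=
  Real.sq_sqrt (Finset.sum_nonneg fun _ _ => Finset.sum_nonneg fun _ _ => sq_nonneg _)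

lemma frob_sq_col (M : Matrix ι κ ℝ) : frob M ^ 2 = ∑ j, euc (M.col j) ^ 2 := by
  rw [frob_sq, Finset.sum_comm]
  simp [euc_sq_sum]

lemma frob_transpose (M : Matrix ι κ ℝ) : frob Mᵀ = frob M := by
  simp only [frob, Matrix.transpose_apply]
  rw [Finset.sum_comm]

lemma frob_add_sq_le (M N : Matrix ι κ ℝ) :
    frob (M + N) ^ 2 ≤ 2 * frob M ^ 2 + 2 * frob N ^ 2 := by
  simp only [frob_sq, Matrix.add_apply, Finset.mul_sum, ← Finset.sum_add_distrib]
  gcongr with i _ j _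
  nlinarith [sq_nonneg (M i j - N i j)]

lemma frob_smul_sq (c : ℝ) (M : Matrix ι κ ℝ) : frob (c • M) ^ 2 = c ^ 2 * frob M ^ 2 := by
  simp only [frob_sq, Matrix.smul_apply, smul_eq_mul, Finset.mul_sum, mul_pow]

lemma euc_sumElim_sq (x : ι → ℝ) (u : κ → ℝ) :
    euc (Sum.elim x u) ^ 2 = euc x ^ 2 + euc u ^ 2 := by
  simp [euc_sq_sum]

lemma euc_sumElim_le (x : ι → ℝ) (u : κ → ℝ) : euc (Sum.elim x u) ≤ euc x + euc u := by
  have h := euc_sumElim_sq x u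
  nlinarith [euc_nonneg x, euc_nonneg u, euc_nonneg (Sum.elim x u)]

lemma euc_mulVec_le (M : Matrix ι κ ℝ) (x : κ → ℝ) : euc (M *ᵥ x) ≤ frob M * euc x := by
  refine abs_le_of_sq_le_sq' ?_ (mul_nonneg (frob_nonneg _) (euc_nonneg _)) |>.2
  rw [mul_pow, euc_sq_sum, frob_sq, euc_sq_sum, Finset.sum_mul]
  exact Finset.sum_le_sum fun i _ => Finset.sum_mul_sq_le_sq_mul_sq _ _ _

lemma dotProduct_mul_mulVec {ν : Type*} [Fintype ν] (A : Matrix κ ι ℝ) (N : Matrix κ ν ℝ)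
    (x : ι → ℝ) (y : ν → ℝ) : x ⬝ᵥ ((Aᵀ * N) *ᵥ y) = (A *ᵥ x) ⬝ᵥ (N *ᵥ y) := by
  rw [← Matrix.mulVec_mulVec, Matrix.dotProduct_transpose_mulVec, dotProduct_comm]

lemma Matrix.IsHermitian.dotProduct_mulVec_comm {P : Matrix ι ι ℝ} (hP : P.IsHermitian)
    (x y : ι → ℝ) : x ⬝ᵥ (P *ᵥ y) = y ⬝ᵥ (P *ᵥ x) := by
  have h : Pᵀ = P := by simpa [Matrix.IsHermitian] using hP
  conv_lhs => rw [← h]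
  rw [Matrix.dotProduct_transpose_mulVec]

lemma Matrix.PosSemidef.quad_nonneg {P : Matrix ι ι ℝ} (hP : P.PosSemidef) (x : ι → ℝ) :
    0 ≤ x ⬝ᵥ (P *ᵥ x) := by simpa using hP.dotProduct_mulVec_nonneg x

/-- Polarization: `4 xᵀDy` is the difference of the quadratic form at `x + y` and `x - y`, and the
parallelogram law adds up the norms. -/
lemma two_mul_abs_dotProduct_mulVec_le_of_quad_le {D : Matrix ι ι ℝ} (hD : D.IsHermitian) {c : ℝ}
    (h : ∀ x, |x ⬝ᵥ (D *ᵥ x)| ≤ c * euc x ^ 2) (x y : ι → ℝ) :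
    2 * |x ⬝ᵥ (D *ᵥ y)| ≤ c * (euc x ^ 2 + euc y ^ 2) := by
  have h1 := abs_le.1 (h (x + y))
  have h2 := abs_le.1 (h (x - y))
  have hs := hD.dotProduct_mulVec_comm x y
  simp only [euc_sq, Matrix.mulVec_add, Matrix.mulVec_sub, dotProduct_add, add_dotProduct,
    dotProduct_sub, sub_dotProduct] at h1 h2 ⊢
  have hs2 := dotProduct_comm x y
  rcases abs_cases (x ⬝ᵥ (D *ᵥ y)) with h | h <;> nlinarith

lemma abs_dotProduct_mulVec_le_of_quad_le {D : Matrix ι ι ℝ} (hD : D.IsHermitian) {c : ℝ}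
    (h : ∀ x, |x ⬝ᵥ (D *ᵥ x)| ≤ c * euc x ^ 2) (x y : ι → ℝ) :
    |x ⬝ᵥ (D *ᵥ y)| ≤ c * (euc x * euc y) := by
  rcases eq_or_ne x 0 with rfl | hx
  · simp
  rcases eq_or_ne y 0 with rfl | hy
  · simp
  have hx' : 0 < euc x := lt_of_le_of_ne (euc_nonneg _) (Ne.symm (mt euc_eq_zero.1 hx))
  have hy' : 0 < euc y := lt_of_le_of_ne (euc_nonneg _) (Ne.symm (mt euc_eq_zero.1 hy))
  -- After this rescaling both vectors have norm `|x| |y|`, so the arithmetic mean of the squares is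
  -- their geometric mean.
  have h1 := two_mul_abs_dotProduct_mulVec_le_of_quad_le hD h (euc y • x) (euc x • y)
  rw [Matrix.mulVec_smul, dotProduct_smul, smul_dotProduct, smul_eq_mul, smul_eq_mul, abs_mul,
    abs_mul, abs_of_pos hx', abs_of_pos hy', euc_smul, euc_smul, abs_of_pos hx',
    abs_of_pos hy'] at h1
  refine le_of_mul_le_mul_left ?_ (mul_pos hx' hy')
  linarith

variable [DecidableEq ι]

lemma sqrt_isHermitian (P : Matrix ι ι ℝ) : (CFC.sqrt P).IsHermitian :=
  (Matrix.nonneg_iff_posSemidef.1 (CFC.sqrt_nonneg P)).isHermitian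

lemma sqrt_transpose (P : Matrix ι ι ℝ) : (CFC.sqrt P)ᵀ = CFC.sqrt P := by
  simpa [Matrix.IsHermitian] using sqrt_isHermitian P

lemma Matrix.PosSemidef.sqrt_mul_sqrt {P : Matrix ι ι ℝ} (hP : P.PosSemidef) :
    CFC.sqrt P * CFC.sqrt P = P :=
  CFC.sqrt_mul_sqrt_self P (Matrix.nonneg_iff_posSemidef.2 hP)

lemma Matrix.PosSemidef.dotProduct_mulVec_eq_sqrt {P : Matrix ι ι ℝ} (hP : P.PosSemidef)
    (x y : ι → ℝ) : x ⬝ᵥ (P *ᵥ y) = (CFC.sqrt P *ᵥ x) ⬝ᵥ (CFC.sqrt P *ᵥ y) := by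
  conv_lhs => rw [← hP.sqrt_mul_sqrt]
  conv_lhs => rw [← sqrt_transpose P]
  rw [sqrt_transpose P]
  nth_rewrite 1 [← sqrt_transpose P]
  rw [dotProduct_mul_mulVec]

lemma Matrix.PosSemidef.frob_sqrt_sq {P : Matrix ι ι ℝ} (hP : P.PosSemidef) :
    frob (CFC.sqrt P) ^ 2 = P.trace := by
  conv_rhs => rw [← hP.sqrt_mul_sqrt]
  rw [frob_sq, Matrix.trace]
  refine Finset.sum_congr rfl fun i _ => ?_
  rw [Matrix.diag_apply, Matrix.mul_apply]
  refine Finset.sum_congr rfl fun j _ => ?_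
  rw [pow_two]
  congr 1
  exact congrFun (congrFun (sqrt_transpose P) j) i

/-- Cauchy–Schwarz for `√P`, with `‖√P‖_F² = Tr P`. The trace replaces the operator norm because the
admissible set bounds `Tr P(θ)`. -/
lemma Matrix.PosSemidef.abs_dotProduct_mulVec_le {P : Matrix ι ι ℝ} (hP : P.PosSemidef)
    (x y : ι → ℝ) : |x ⬝ᵥ (P *ᵥ y)| ≤ P.trace * (euc x * euc y) := by
  rw [hP.dotProduct_mulVec_eq_sqrt, ← hP.frob_sqrt_sq]
  refine (abs_dotProduct_le _ _).trans ?_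
  calc _ ≤ (frob (CFC.sqrt P) * euc x) * (frob (CFC.sqrt P) * euc y) :=
        mul_le_mul (euc_mulVec_le _ _) (euc_mulVec_le _ _) (euc_nonneg _)
          (mul_nonneg (frob_nonneg _) (euc_nonneg _))
    _ = _ := by ring

lemma Matrix.PosSemidef.quad_le {P : Matrix ι ι ℝ} (hP : P.PosSemidef) (x : ι → ℝ) :
    x ⬝ᵥ (P *ᵥ x) ≤ P.trace * euc x ^ 2 := by
  rw [pow_two]; exact (le_abs_self _).trans (hP.abs_dotProduct_mulVec_le x x)

lemma Matrix.PosDef.isUnit_sqrt {P : Matrix ι ι ℝ} (hP : P.PosDef) : IsUnit (CFC.sqrt P) := by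
  have h := hP.isUnit
  rw [← hP.posSemidef.sqrt_mul_sqrt] at h
  exact isUnit_of_mul_isUnit_left h

lemma Matrix.PosDef.exists_pos_le_quad {P : Matrix ι ι ℝ} (hP : P.PosDef) :
    ∃ q : ℝ, 0 < q ∧ ∀ x : ι → ℝ, q * euc x ^ 2 ≤ x ⬝ᵥ (P *ᵥ x) := by
  have hdet := (Matrix.isUnit_iff_isUnit_det _).1 hP.isUnit_sqrt
  set C := CFC.sqrt P with hC
  -- The `+ 1` keeps the denominator positive also for empty `ι`, where the Frobenius norm is `0`.
  have hpos : 0 < frob C⁻¹ ^ 2 + 1 := by positivity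
  refine ⟨1 / (frob C⁻¹ ^ 2 + 1), by positivity, fun x => ?_⟩
  rw [hP.posSemidef.dotProduct_mulVec_eq_sqrt, ← hC, ← euc_sq, div_mul_eq_mul_div, one_mul,
    div_le_iff₀ hpos]
  have h1 : euc x ≤ frob C⁻¹ * euc (C *ᵥ x) := by
    have := euc_mulVec_le C⁻¹ (C *ᵥ x)
    rwa [Matrix.mulVec_mulVec, Matrix.nonsing_inv_mul _ hdet, Matrix.one_mulVec] at this
  have h2 : euc x ^ 2 ≤ (frob C⁻¹ * euc (C *ᵥ x)) ^ 2 :=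
    pow_le_pow_left₀ (euc_nonneg _) h1 2
  nlinarith [sq_nonneg (euc (C *ᵥ x))]

end LinearAlgebra

lemma euc_mulVec_le_specNorm {n : ℕ} (M : Matrix (Fin n) (Fin n) ℝ) (x : Fin n → ℝ) :
    euc (M *ᵥ x) ≤ specNorm M * euc x := by
  rw [euc, specNorm, ← Matrix.toEuclideanCLM_toLp]
  exact ContinuousLinearMap.le_opNorm _ _

/-! ### The Riccati equation -/

section Riccati

variable {n m : ℕ} {Qc : Matrix (Fin n) (Fin n) ℝ} {Rc : Matrix (Fin m) (Fin m) ℝ}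

/-- The matrix `R + BᵀPB`. -/
def inputWeight (Rc : Matrix (Fin m) (Fin m) ℝ) (θ : Param n m) (P : Matrix (Fin n) (Fin n) ℝ) :
    Matrix (Fin m) (Fin m) ℝ := Rc + θ.Bᵀ * P * θ.B

lemma inputWeight_posDef (hR : Rc.PosDef) (θ : Param n m) {P : Matrix (Fin n) (Fin n) ℝ}
    (hP : P.PosSemidef) : (inputWeight Rc θ P).PosDef := by
  refine hR.add_posSemidef ?_
  simpa using hP.conjTranspose_mul_mul_same θ.B

lemma quad_inputWeight (θ : Param n m) (P : Matrix (Fin n) (Fin n) ℝ) (u v : Fin m → ℝ) :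
    u ⬝ᵥ (inputWeight Rc θ P *ᵥ v) =
      u ⬝ᵥ (Rc *ᵥ v) + (θ.B *ᵥ u) ⬝ᵥ (P *ᵥ (θ.B *ᵥ v)) := by
  rw [inputWeight, Matrix.add_mulVec, dotProduct_add, Matrix.mul_assoc, dotProduct_mul_mulVec,
    Matrix.mulVec_mulVec]

/-- The normal equation `(R + BᵀPB) K = -BᵀPA` in weak form, so that the inverse in the gain need
not be handled again. -/
lemma inputWeight_mulVec_gain (hR : Rc.PosDef) (θ : Param n m) {P : Matrix (Fin n) (Fin n) ℝ}
    (hP : P.PosSemidef) (x : Fin n → ℝ) (u : Fin m → ℝ) :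
    u ⬝ᵥ (inputWeight Rc θ P *ᵥ (gainOf Rc θ P *ᵥ x)) =
      -((θ.B *ᵥ u) ⬝ᵥ (P *ᵥ (θ.A *ᵥ x))) := by
  have hu := (Matrix.isUnit_iff_isUnit_det _).1 (inputWeight_posDef hR θ hP).isUnit
  have : inputWeight Rc θ P * gainOf Rc θ P = -(θ.Bᵀ * (P * θ.A)) := by
    rw [gainOf, ← inputWeight, Matrix.mul_neg, Matrix.mul_assoc, Matrix.mul_assoc,
      Matrix.mul_nonsing_inv_cancel_left _ _ hu]
  rw [Matrix.mulVec_mulVec, this, Matrix.neg_mulVec, dotProduct_neg, dotProduct_mul_mulVec,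
    Matrix.mulVec_mulVec]

/-- The optimality condition of the gain. -/
lemma gain_stationary (hR : Rc.PosDef) (θ : Param n m) {P : Matrix (Fin n) (Fin n) ℝ}
    (hP : P.PosSemidef) (x : Fin n → ℝ) (u : Fin m → ℝ) :
    u ⬝ᵥ (Rc *ᵥ (gainOf Rc θ P *ᵥ x)) =
      -((θ.B *ᵥ u) ⬝ᵥ (P *ᵥ (θ.A *ᵥ x + θ.B *ᵥ (gainOf Rc θ P *ᵥ x)))) := by
  have h := inputWeight_mulVec_gain hR θ hP x u
  rw [quad_inputWeight] at h
  rw [Matrix.mulVec_add, dotProduct_add]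
  linarith

/-- Completion of squares in the Bellman equation. -/
lemma IsRiccatiSolution.bellman (hR : Rc.PosDef) {θ : Param n m} {P : Matrix (Fin n) (Fin n) ℝ}
    (h : IsRiccatiSolution Qc Rc θ P) (x : Fin n → ℝ) (u : Fin m → ℝ) :
    x ⬝ᵥ (Qc *ᵥ x) + u ⬝ᵥ (Rc *ᵥ u)
        + (θ.A *ᵥ x + θ.B *ᵥ u) ⬝ᵥ (P *ᵥ (θ.A *ᵥ x + θ.B *ᵥ u)) =
      x ⬝ᵥ (P *ᵥ x)
        + (u - gainOf Rc θ P *ᵥ x) ⬝ᵥ (inputWeight Rc θ P *ᵥ (u - gainOf Rc θ P *ᵥ x)) := by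
  obtain ⟨hP, heq⟩ := h
  have hPs := hP.posSemidef
  set k := gainOf Rc θ P *ᵥ x with hk
  have h1 : x ⬝ᵥ (P *ᵥ x) = x ⬝ᵥ (Qc *ᵥ x) + (θ.A *ᵥ x) ⬝ᵥ (P *ᵥ (θ.A *ᵥ x))
      + (θ.A *ᵥ x) ⬝ᵥ (P *ᵥ (θ.B *ᵥ k)) := by
    conv_lhs => rw [heq]
    rw [Matrix.add_mulVec, Matrix.add_mulVec, dotProduct_add, dotProduct_add, Matrix.mul_assoc,
      dotProduct_mul_mulVec, Matrix.mul_assoc θ.Aᵀ, Matrix.mul_assoc θ.Aᵀ, dotProduct_mul_mulVec]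
    simp only [Matrix.mulVec_mulVec, hk, Matrix.mul_assoc]
  have h2 := inputWeight_mulVec_gain hR θ hPs x u
  have h3 := inputWeight_mulVec_gain hR θ hPs x k
  rw [← hk] at h2 h3
  have h4 := (inputWeight_posDef hR θ hPs).isHermitian.dotProduct_mulVec_comm u k
  have h5 := hP.isHermitian.dotProduct_mulVec_comm (θ.B *ᵥ u) (θ.A *ᵥ x)
  have h6 := hP.isHermitian.dotProduct_mulVec_comm (θ.B *ᵥ k) (θ.A *ᵥ x)
  have h7 := quad_inputWeight (Rc := Rc) θ P u u
  simp only [Matrix.mulVec_add, Matrix.mulVec_sub, dotProduct_add, add_dotProduct,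
    dotProduct_sub, sub_dotProduct]
  linarith

/-- The completed square is dropped: no input beats the optimal gain. With equality at the gain
(`quad_eq`), this is the tool for comparing two Riccati solutions. -/
lemma IsRiccatiSolution.quad_le (hR : Rc.PosDef) {θ : Param n m} {P : Matrix (Fin n) (Fin n) ℝ}
    (h : IsRiccatiSolution Qc Rc θ P) (x : Fin n → ℝ) (u : Fin m → ℝ) :
    x ⬝ᵥ (P *ᵥ x) ≤ x ⬝ᵥ (Qc *ᵥ x) + u ⬝ᵥ (Rc *ᵥ u)
        + (θ.A *ᵥ x + θ.B *ᵥ u) ⬝ᵥ (P *ᵥ (θ.A *ᵥ x + θ.B *ᵥ u)) := by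
  rw [h.bellman hR]
  have := (inputWeight_posDef hR θ h.1.posSemidef).posSemidef.quad_nonneg
    (u - gainOf Rc θ P *ᵥ x)
  linarith

lemma IsRiccatiSolution.quad_eq (hR : Rc.PosDef) {θ : Param n m} {P : Matrix (Fin n) (Fin n) ℝ}
    (h : IsRiccatiSolution Qc Rc θ P) (x : Fin n → ℝ) :
    x ⬝ᵥ (P *ᵥ x) = x ⬝ᵥ (Qc *ᵥ x) + (gainOf Rc θ P *ᵥ x) ⬝ᵥ (Rc *ᵥ (gainOf Rc θ P *ᵥ x))
        + (θ.A *ᵥ x + θ.B *ᵥ (gainOf Rc θ P *ᵥ x)) ⬝ᵥ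
          (P *ᵥ (θ.A *ᵥ x + θ.B *ᵥ (gainOf Rc θ P *ᵥ x))) := by
  rw [h.bellman hR, sub_self]
  simp

/-- A function that is dominated by its values at contracted points, up to an error, is bounded
by a geometric series of errors. -/
lemma le_of_le_contraction {V : Type*} {f N : V → ℝ} {a c ε : ℝ} (ha0 : 0 ≤ a) (ha1 : a < 1)
    (hε : 0 ≤ ε) (hc : 0 ≤ c) (hN : ∀ x, 0 ≤ N x) (hf : ∀ x, f x ≤ c * N x)
    (hstep : ∀ x, ∃ y, N y ≤ a * N x ∧ f x ≤ f y + ε * N x) (x : V) :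
    f x ≤ ε / (1 - a) * N x := by
  have h1a : 0 < 1 - a := by linarith
  -- After `j` contractions the a priori constant `c` survives only as `c * a ^ j`, which vanishes
  -- in the limit.
  have key : ∀ j : ℕ, ∀ x, f x ≤ (ε / (1 - a) + c * a ^ j) * N x := by
    intro j
    induction j with
    | zero =>
      intro x
      refine (hf x).trans (mul_le_mul_of_nonneg_right ?_ (hN x))
      simp only [pow_zero, mul_one]
      have : 0 ≤ ε / (1 - a) := by positivity
      linarith
    | succ j ih =>
      intro x
      obtain ⟨y, hy, hxy⟩ := hstep x
      have hb : 0 ≤ ε / (1 - a) + c * a ^ j := by positivity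
      calc f x ≤ (ε / (1 - a) + c * a ^ j) * (a * N x) + ε * N x :=
            hxy.trans (by have := mul_le_mul_of_nonneg_left hy hb; linarith [ih y])
        _ = _ := by rw [pow_succ]; field_simp; ring
  have hlim : Filter.Tendsto (fun j : ℕ => (ε / (1 - a) + c * a ^ j) * N x) Filter.atTop
      (nhds ((ε / (1 - a) + c * 0) * N x)) :=
    ((tendsto_pow_atTop_nhds_zero_of_lt_one ha0 ha1).const_mul c |>.const_add _).mul_const _
  simpa using ge_of_tendsto' hlim fun j => key j x

/-- Both solutions are compared along the closed loop that is optimal for `P'`. There `P - P'` does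
not decrease, while `xᵀP'x` contracts geometrically because each step pays at least `xᵀQx`. -/
lemma IsRiccatiSolution.quad_le_quad (hQ : Qc.PosDef) (hR : Rc.PosDef) {θ : Param n m}
    {P P' : Matrix (Fin n) (Fin n) ℝ} (h : IsRiccatiSolution Qc Rc θ P)
    (h' : IsRiccatiSolution Qc Rc θ P') (x : Fin n → ℝ) :
    x ⬝ᵥ (P *ᵥ x) ≤ x ⬝ᵥ (P' *ᵥ x) := by
  obtain ⟨q, hq, hQq⟩ := hQ.exists_pos_le_quad
  obtain ⟨p, hp, hPp⟩ := h'.1.exists_pos_le_quad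
  have htr : 0 ≤ P'.trace := h'.1.posSemidef.trace_nonneg
  -- Since `Q ≥ q` and `P' ≤ Tr P'`, each step removes at least this fraction of `xᵀP'x`. The added
  -- `q` keeps the denominator positive and `a` nonnegative.
  set a : ℝ := 1 - q / (P'.trace + q) with ha
  have htq : 0 < P'.trace + q := by linarith
  have hfrac : q / (P'.trace + q) ≤ 1 := (div_le_one htq).2 (by linarith)
  have hfrac0 : 0 < q / (P'.trace + q) := by positivity
  have hmain := le_of_le_contraction (V := Fin n → ℝ)
    (f := fun x => x ⬝ᵥ (P *ᵥ x) - x ⬝ᵥ (P' *ᵥ x)) (N := fun x => x ⬝ᵥ (P' *ᵥ x))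
    (a := a) (c := P.trace / p) (ε := 0) (by linarith) (by linarith) le_rfl
    (div_nonneg h.1.posSemidef.trace_nonneg hp.le) (fun x => h'.1.posSemidef.quad_nonneg x)
    (fun x => ?_) (fun x => ?_) x
  · simp only [zero_div, zero_mul] at hmain
    linarith
  · have h1 := h.1.posSemidef.quad_le x
    have h2 := mul_le_mul_of_nonneg_left (hPp x) (div_nonneg h.1.posSemidef.trace_nonneg hp.le)
    have h3 : P.trace / p * (p * euc x ^ 2) = P.trace * euc x ^ 2 := by field_simp
    have h4 := h'.1.posSemidef.quad_nonneg x
    linarith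
  · refine ⟨θ.A *ᵥ x + θ.B *ᵥ (gainOf Rc θ P' *ᵥ x), ?_, ?_⟩
    · have h1 := h'.quad_eq hR x
      have h2 := hR.posSemidef.quad_nonneg (gainOf Rc θ P' *ᵥ x)
      have h3 : q / (P'.trace + q) * (x ⬝ᵥ (P' *ᵥ x)) ≤ q * euc x ^ 2 := by
        rw [div_mul_eq_mul_div, div_le_iff₀ htq]
        have := h'.1.posSemidef.quad_le x
        nlinarith [sq_nonneg (euc x), mul_nonneg hq.le (sq_nonneg (euc x))]
      simp only [ha]
      linarith [hQq x]
    · have h1 := h'.quad_eq hR x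
      have h2 := h.quad_le hR x (gainOf Rc θ P' *ᵥ x)
      linarith

lemma eq_of_quad_eq {P P' : Matrix (Fin n) (Fin n) ℝ} (hP : P.IsHermitian) (hP' : P'.IsHermitian)
    (h : ∀ x : Fin n → ℝ, x ⬝ᵥ (P *ᵥ x) = x ⬝ᵥ (P' *ᵥ x)) : P = P' := by
  have hb : ∀ x y : Fin n → ℝ, x ⬝ᵥ ((P - P') *ᵥ y) = 0 := fun x y => by
    have := abs_dotProduct_mulVec_le_of_quad_le (hP.sub hP') (c := 0)
      (fun x => by rw [Matrix.sub_mulVec, dotProduct_sub, h x]; simp) x y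
    exact abs_eq_zero.1 (le_antisymm (by simpa using this) (abs_nonneg _))
  refine sub_eq_zero.1 ?_
  ext i j
  have := hb (Pi.single i 1) (Pi.single j 1)
  simpa using this

/-- Uniqueness of the positive definite solution of the Riccati equation. -/
lemma IsRiccatiSolution.unique (hQ : Qc.PosDef) (hR : Rc.PosDef) {θ : Param n m}
    {P P' : Matrix (Fin n) (Fin n) ℝ} (h : IsRiccatiSolution Qc Rc θ P)
    (h' : IsRiccatiSolution Qc Rc θ P') : P = P' :=
  eq_of_quad_eq h.1.isHermitian h'.1.isHermitian fun x =>
    le_antisymm (h.quad_le_quad hQ hR h' x) (h'.quad_le_quad hQ hR h x)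

lemma riccati_spec {θ : Param n m} (h : ∃ P, IsRiccatiSolution Qc Rc θ P) :
    IsRiccatiSolution Qc Rc θ (riccati Qc Rc θ) := by
  rw [riccati, dif_pos h]
  exact h.choose_spec

lemma Param.A_mulVec_add_B_mulVec (θ : Param n m) (x : Fin n → ℝ) (u : Fin m → ℝ) :
    θ.A *ᵥ x + θ.B *ᵥ u = θᵀ *ᵥ Sum.elim x u := by
  ext i
  simp [Param.A, Param.B, Matrix.mulVec, dotProduct, Matrix.toRows₁, Matrix.toRows₂]

lemma euc_transpose_mulVec_le (Δ : Param n m) (x : Fin n → ℝ) (u : Fin m → ℝ) :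
    euc (Δᵀ *ᵥ Sum.elim x u) ≤ frob Δ * (euc x + euc u) := by
  refine (euc_mulVec_le _ _).trans ?_
  rw [frob_transpose]
  exact mul_le_mul_of_nonneg_left (euc_sumElim_le x u) (frob_nonneg _)

/-- Excess cost-to-go of the gain of `θ` at the state `x` in the system `θstar`. -/
noncomputable def gainGap (Qc : Matrix (Fin n) (Fin n) ℝ) (Rc : Matrix (Fin m) (Fin m) ℝ)
    (θstar θ : Param n m) (x : Fin n → ℝ) : ℝ :=
  (optGain Qc Rc θ *ᵥ x - optGain Qc Rc θstar *ᵥ x) ⬝ᵥ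
    (inputWeight Rc θstar (riccati Qc Rc θstar) *ᵥ
      (optGain Qc Rc θ *ᵥ x - optGain Qc Rc θstar *ᵥ x))

/-! ### Perturbation theory of gains and Riccati solutions on the admissible set. -/

section Admissible

variable {MP ρ : ℝ} {θstar θ : Param n m}

lemma admissible.isRiccatiSolution (h : θ ∈ admissible Qc Rc MP ρ θstar) :
    IsRiccatiSolution Qc Rc θ (riccati Qc Rc θ) := riccati_spec h.1

lemma admissible.rho_nonneg (h : θ ∈ admissible Qc Rc MP ρ θstar) : 0 ≤ ρ :=
  (norm_nonneg _).trans h.2.2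

lemma admissible.MP_nonneg (h : θ ∈ admissible Qc Rc MP ρ θstar) : 0 ≤ MP :=
  (admissible.isRiccatiSolution h).1.posSemidef.trace_nonneg.trans h.2.1

lemma admissible.closedLoop_le (h : θ ∈ admissible Qc Rc MP ρ θstar) (x : Fin n → ℝ) :
    euc (θstar.A *ᵥ x + θstar.B *ᵥ (optGain Qc Rc θ *ᵥ x)) ≤ ρ * euc x := by
  have := euc_mulVec_le_specNorm (θstar.A + θstar.B * optGain Qc Rc θ) x
  rw [Matrix.add_mulVec, ← Matrix.mulVec_mulVec] at this
  exact this.trans (mul_le_mul_of_nonneg_right h.2.2 (euc_nonneg x))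

lemma admissible.abs_riccati_le (h : θ ∈ admissible Qc Rc MP ρ θstar) (x y : Fin n → ℝ) :
    |x ⬝ᵥ (riccati Qc Rc θ *ᵥ y)| ≤ MP * (euc x * euc y) :=
  ((admissible.isRiccatiSolution h).1.posSemidef.abs_dotProduct_mulVec_le x y).trans
    (mul_le_mul_of_nonneg_right h.2.1 (mul_nonneg (euc_nonneg x) (euc_nonneg y)))

/-- The Riccati identity gives `uᵀRu ≤ xᵀP(θ)x ≤ MP |x|²` for `u = K(θ)x`. -/
lemma admissible.gain_le (hQ : Qc.PosDef) (hR : Rc.PosDef) {q : ℝ} (hq : 0 < q)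
    (hRq : ∀ u : Fin m → ℝ, q * euc u ^ 2 ≤ u ⬝ᵥ (Rc *ᵥ u))
    (h : θ ∈ admissible Qc Rc MP ρ θstar) (x : Fin n → ℝ) :
    euc (optGain Qc Rc θ *ᵥ x) ≤ Real.sqrt (MP / q) * euc x := by
  have hs := admissible.isRiccatiSolution h
  have h1 := hs.quad_eq hR x
  have h2 := hQ.posSemidef.quad_nonneg x
  have h3 := hs.1.posSemidef.quad_nonneg
    (θ.A *ᵥ x + θ.B *ᵥ (gainOf Rc θ (riccati Qc Rc θ) *ᵥ x))
  have h4 := hRq (optGain Qc Rc θ *ᵥ x)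
  have h5 := (abs_le.1 (admissible.abs_riccati_le h x x)).2
  rw [optGain] at h4 ⊢
  refine abs_le_of_sq_le_sq' ?_ (mul_nonneg (Real.sqrt_nonneg _) (euc_nonneg _)) |>.2
  rw [mul_pow, Real.sq_sqrt (div_nonneg (admissible.MP_nonneg h) hq.le), div_mul_eq_mul_div,
    le_div_iff₀ hq]
  nlinarith

/-- Used with `y` a true closed-loop state and `e` the deviation of the model of `θ` from it. The
assumption `t ≤ 1` absorbs the part quadratic in `t`. -/
lemma abs_quad_increment_le (hρ : ρ < 1)
    {y e x : Fin n → ℝ} {t l : ℝ} (ht0 : 0 ≤ t) (ht : t ≤ 1) (hl : 0 ≤ l)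
    (hy : euc y ≤ ρ * euc x) (he : euc e ≤ t * l * euc x)
    {P : Matrix (Fin n) (Fin n) ℝ} (hMP : 0 ≤ MP)
    (hP : ∀ x y : Fin n → ℝ, |x ⬝ᵥ (P *ᵥ y)| ≤ MP * (euc x * euc y)) :
    |2 * y ⬝ᵥ (P *ᵥ e) + e ⬝ᵥ (P *ᵥ e)| ≤ MP * (2 * l + l ^ 2) * t * euc x ^ 2 := by
  have hx := euc_nonneg x
  have hy' : euc y ≤ euc x := hy.trans (by nlinarith)
  have h1 : euc y * euc e ≤ euc x * (t * l * euc x) :=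
    mul_le_mul hy' he (euc_nonneg _) hx
  have h2 : euc e * euc e ≤ (t * l * euc x) * (t * l * euc x) :=
    mul_le_mul he he (euc_nonneg _) (by positivity)
  have h3 : (t * l * euc x) * (t * l * euc x) ≤ t * l ^ 2 * euc x ^ 2 := by
    have : t * t ≤ t * 1 := mul_le_mul_of_nonneg_left ht ht0
    nlinarith [mul_le_mul_of_nonneg_right this (by positivity : 0 ≤ l ^ 2 * euc x ^ 2)]
  have h4 := hP y e
  have h5 := hP e e
  have h6 := mul_le_mul_of_nonneg_left h1 hMP
  have h7 := mul_le_mul_of_nonneg_left (h2.trans h3) hMP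
  calc _ ≤ |2 * y ⬝ᵥ (P *ᵥ e)| + |e ⬝ᵥ (P *ᵥ e)| := abs_add_le _ _
    _ = 2 * |y ⬝ᵥ (P *ᵥ e)| + |e ⬝ᵥ (P *ᵥ e)| := by rw [abs_mul]; norm_num
    _ ≤ _ := by nlinarith

/-- Lipschitz dependence of the solution of the Riccati equation on the parameter. -/
lemma admissible.abs_quad_riccati_sub_le (hQ : Qc.PosDef) (hR : Rc.PosDef) (hρ : ρ < 1) {q : ℝ}
    (hq : 0 < q) (hRq : ∀ u : Fin m → ℝ, q * euc u ^ 2 ≤ u ⬝ᵥ (Rc *ᵥ u))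
    (hs : θstar ∈ admissible Qc Rc MP ρ θstar) (h : θ ∈ admissible Qc Rc MP ρ θstar)
    (ht : frob (θ - θstar) ≤ 1) {l : ℝ} (hl : l = 1 + Real.sqrt (MP / q)) (x : Fin n → ℝ) :
    |x ⬝ᵥ ((riccati Qc Rc θstar - riccati Qc Rc θ) *ᵥ x)| ≤
      MP * (2 * l + l ^ 2) * frob (θ - θstar) / (1 - ρ ^ 2) * euc x ^ 2 := by
  have hMP := admissible.MP_nonneg h
  have hρ0 := admissible.rho_nonneg h
  have hl0 : 0 ≤ l := by rw [hl]; positivity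
  have ht0 := frob_nonneg (θ - θstar)
  set t := frob (θ - θstar)
  have hε : 0 ≤ MP * (2 * l + l ^ 2) * t := by positivity
  have hρ2 : ρ ^ 2 < 1 := by nlinarith
  have herr : ∀ (x : Fin n → ℝ) (u : Fin m → ℝ), euc u ≤ Real.sqrt (MP / q) * euc x →
      euc ((θ - θstar)ᵀ *ᵥ Sum.elim x u) ≤ t * l * euc x := fun x u hu => by
    refine (euc_transpose_mulVec_le _ x u).trans ?_
    rw [mul_assoc]
    refine mul_le_mul_of_nonneg_left ?_ ht0
    rw [hl]; linarith
  have hsplit : ∀ (x : Fin n → ℝ) (u : Fin m → ℝ),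
      θ.A *ᵥ x + θ.B *ᵥ u = (θstar.A *ᵥ x + θstar.B *ᵥ u) + (θ - θstar)ᵀ *ᵥ Sum.elim x u :=
    fun x u => by
      rw [Param.A_mulVec_add_B_mulVec, Param.A_mulVec_add_B_mulVec, Matrix.transpose_sub,
        Matrix.sub_mulVec]
      abel
  have hquad : ∀ y e : Fin n → ℝ, (y + e) ⬝ᵥ (riccati Qc Rc θ *ᵥ (y + e)) =
      y ⬝ᵥ (riccati Qc Rc θ *ᵥ y) + (2 * y ⬝ᵥ (riccati Qc Rc θ *ᵥ e)
        + e ⬝ᵥ (riccati Qc Rc θ *ᵥ e)) := fun y e => by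
    have := (admissible.isRiccatiSolution h).1.isHermitian.dotProduct_mulVec_comm e y
    simp only [Matrix.mulVec_add, dotProduct_add, add_dotProduct]
    linarith
  have hcontr : ∀ {θ' : Param n m}, θ' ∈ admissible Qc Rc MP ρ θstar → ∀ x : Fin n → ℝ,
      euc (θstar.A *ᵥ x + θstar.B *ᵥ (optGain Qc Rc θ' *ᵥ x)) ^ 2 ≤ ρ ^ 2 * euc x ^ 2 :=
    fun h' x => by
      rw [← mul_pow]
      exact pow_le_pow_left₀ (euc_nonneg _) (admissible.closedLoop_le h' x) 2
  have hsR := admissible.isRiccatiSolution hs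
  have hR' := admissible.isRiccatiSolution h
  rw [abs_le, ← neg_le]
  constructor
  -- Bound for `P(θ) - P(θ_*)`: the gain of `θ_*` is optimal for `θ_*` and merely feasible for `θ`.
  · have := le_of_le_contraction (V := Fin n → ℝ)
      (f := fun x => -(x ⬝ᵥ ((riccati Qc Rc θstar - riccati Qc Rc θ) *ᵥ x)))
      (N := fun x => euc x ^ 2) (c := MP) (sq_nonneg ρ) hρ2 hε hMP (fun x => sq_nonneg _)
      (fun x => ?_) (fun x => ⟨_, hcontr hs x, ?_⟩) x
    · exact this
    · rw [Matrix.sub_mulVec, dotProduct_sub]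
      have h1 := (abs_le.1 (admissible.abs_riccati_le h x x)).2
      have h2 := hsR.1.posSemidef.quad_nonneg x
      rw [pow_two]
      linarith
    · have h1 := hR'.quad_le hR x (optGain Qc Rc θstar *ᵥ x)
      have h2 := hsR.quad_eq hR x
      have h3 := abs_quad_increment_le hρ ht0 ht hl0
        (admissible.closedLoop_le hs x)
        (herr x (optGain Qc Rc θstar *ᵥ x) (admissible.gain_le hQ hR hq hRq hs x)) hMP
        (admissible.abs_riccati_le h)
      rw [hsplit, hquad] at h1
      rw [← optGain] at h2
      simp only [Matrix.sub_mulVec, dotProduct_sub]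
      linarith [(abs_le.1 h3).2]
  -- Bound for `P(θ_*) - P(θ)`: the roles are exchanged and the gain of `θ` is followed. In both
  -- directions the comparison point is a state of the true system, so the contraction factor is `ρ
  -- ^ 2`.
  · have := le_of_le_contraction (V := Fin n → ℝ)
      (f := fun x => x ⬝ᵥ ((riccati Qc Rc θstar - riccati Qc Rc θ) *ᵥ x))
      (N := fun x => euc x ^ 2) (c := MP) (sq_nonneg ρ) hρ2 hε hMP (fun x => sq_nonneg _)
      (fun x => ?_) (fun x => ⟨_, hcontr h x, ?_⟩) x
    · exact this
    · rw [Matrix.sub_mulVec, dotProduct_sub]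
      have h1 := (abs_le.1 (admissible.abs_riccati_le hs x x)).2
      have h2 := hR'.1.posSemidef.quad_nonneg x
      rw [pow_two]
      linarith
    · have h1 := hsR.quad_le hR x (optGain Qc Rc θ *ᵥ x)
      have h2 := hR'.quad_eq hR x
      have h3 := abs_quad_increment_le hρ ht0 ht hl0
        (admissible.closedLoop_le h x)
        (herr x (optGain Qc Rc θ *ᵥ x) (admissible.gain_le hQ hR hq hRq h x)) hMP
        (admissible.abs_riccati_le h)
      rw [← optGain, hsplit, hquad] at h2
      simp only [Matrix.sub_mulVec, dotProduct_sub]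
      linarith [(abs_le.1 h3).1]

lemma gainGap_nonneg (hR : Rc.PosDef) (hs : ∃ P, IsRiccatiSolution Qc Rc θstar P)
    (θ : Param n m) (x : Fin n → ℝ) : 0 ≤ gainGap Qc Rc θstar θ x :=
  (inputWeight_posDef hR θstar (riccati_spec hs).1.posSemidef).posSemidef.quad_nonneg _

/-- The crude bound for the suboptimality of a gain. -/
lemma admissible.gainGap_le (hQ : Qc.PosDef) (hR : Rc.PosDef) (hρ : ρ < 1) {q : ℝ}
    (hq : 0 < q) (hRq : ∀ u : Fin m → ℝ, q * euc u ^ 2 ≤ u ⬝ᵥ (Rc *ᵥ u))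
    (hs : θstar ∈ admissible Qc Rc MP ρ θstar) (h : θ ∈ admissible Qc Rc MP ρ θstar)
    (x : Fin n → ℝ) :
    gainGap Qc Rc θstar θ x ≤
      (4 * Real.sqrt (MP / q) ^ 2 * Rc.trace + 4 * MP) * euc x ^ 2 := by
  have hx := euc_nonneg x
  have hk := Real.sqrt_nonneg (MP / q)
  set k0 := Real.sqrt (MP / q)
  have hMP := admissible.MP_nonneg h
  rw [gainGap, quad_inputWeight]
  set v := optGain Qc Rc θ *ᵥ x - optGain Qc Rc θstar *ᵥ x with hv
  -- `B_* v` is a difference of two closed-loop successors of `x`, so it is bounded without a bound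
  -- for `B_*`.
  have hBv : θstar.B *ᵥ v = (θstar.A *ᵥ x + θstar.B *ᵥ (optGain Qc Rc θ *ᵥ x))
      - (θstar.A *ᵥ x + θstar.B *ᵥ (optGain Qc Rc θstar *ᵥ x)) := by
    rw [hv, Matrix.mulVec_sub]; abel
  have h1 : euc v ≤ 2 * k0 * euc x := by
    have := euc_sub_le (optGain Qc Rc θ *ᵥ x) (optGain Qc Rc θstar *ᵥ x)
    have h2 := admissible.gain_le hQ hR hq hRq h x
    have h3 := admissible.gain_le hQ hR hq hRq hs x
    rw [hv]; linarith
  have h2 : euc (θstar.B *ᵥ v) ≤ 2 * euc x := by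
    rw [hBv]
    refine (euc_sub_le _ _).trans ?_
    have h2 := admissible.closedLoop_le h x
    have h3 := admissible.closedLoop_le hs x
    nlinarith
  have h3 := hR.posSemidef.quad_le v
  have h4 := (abs_le.1 (admissible.abs_riccati_le hs (θstar.B *ᵥ v) (θstar.B *ᵥ v))).2
  have h5 : euc v ^ 2 ≤ (2 * k0 * euc x) ^ 2 := pow_le_pow_left₀ (euc_nonneg _) h1 2
  have h6 : euc (θstar.B *ᵥ v) ^ 2 ≤ (2 * euc x) ^ 2 := pow_le_pow_left₀ (euc_nonneg _) h2 2
  have h7 := mul_le_mul_of_nonneg_left h5 hR.posSemidef.trace_nonneg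
  have h8 := mul_le_mul_of_nonneg_left h6 hMP
  nlinarith

/-- The quadratic bound for the suboptimality of the gain of a nearby parameter. -/
lemma admissible.gainGap_le_sq (hQ : Qc.PosDef) (hR : Rc.PosDef) (hρ : ρ < 1) {q μ : ℝ}
    (hq : 0 < q) (hRq : ∀ u : Fin m → ℝ, q * euc u ^ 2 ≤ u ⬝ᵥ (Rc *ᵥ u))
    (hμ : 0 < μ) (hμq : μ ≤ q) (hQμ : ∀ x : Fin n → ℝ, μ * euc x ^ 2 ≤ x ⬝ᵥ (Qc *ᵥ x))
    (hs : θstar ∈ admissible Qc Rc MP ρ θstar) (h : θ ∈ admissible Qc Rc MP ρ θstar)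
    (ht : frob (θ - θstar) ≤ 1) {l b : ℝ} (hl : l = 1 + Real.sqrt (MP / q))
    (hb : b = MP * (2 * l + l ^ 2) / (1 - ρ ^ 2) + MP * l + MP * (1 + l)) (x : Fin n → ℝ) :
    gainGap Qc Rc θstar θ x ≤ 2 * b ^ 2 / μ * (frob (θ - θstar) ^ 2 * euc x ^ 2) := by
  have hMP := admissible.MP_nonneg h
  have hρ0 := admissible.rho_nonneg h
  have hl0 : 0 ≤ l := by rw [hl]; positivity
  have ht0 := frob_nonneg (θ - θstar)
  have hx := euc_nonneg x
  have hρ2 : 0 < 1 - ρ ^ 2 := by nlinarith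
  have hsR := admissible.isRiccatiSolution hs
  have hR' := admissible.isRiccatiSolution h
  have hD := abs_dotProduct_mulVec_le_of_quad_le
    (hsR.1.isHermitian.sub hR'.1.isHermitian)
    (admissible.abs_quad_riccati_sub_le hQ hR hρ hq hRq hs h ht hl)
  set t := frob (θ - θstar) with ht_def
  set k := optGain Qc Rc θ *ᵥ x with hk
  set kstar := optGain Qc Rc θstar *ᵥ x with hkstar
  set v := k - kstar with hv
  set P := riccati Qc Rc θstar with hP
  set P' := riccati Qc Rc θ with hP'
  set y := θstar.A *ᵥ x + θstar.B *ᵥ k with hy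
  set e := (θ - θstar)ᵀ *ᵥ Sum.elim x k with he
  set f := (θ - θstar)ᵀ *ᵥ Sum.elim (0 : Fin n → ℝ) v with hf
  have hy' : θ.A *ᵥ x + θ.B *ᵥ k = y + e := by
    rw [hy, he, Param.A_mulVec_add_B_mulVec, Param.A_mulVec_add_B_mulVec, Matrix.transpose_sub,
      Matrix.sub_mulVec]
    abel
  have hB' : θ.B *ᵥ v = θstar.B *ᵥ v + f := by
    have h1 := Param.A_mulVec_add_B_mulVec θ 0 v
    have h2 := Param.A_mulVec_add_B_mulVec θstar 0 v
    simp only [Matrix.mulVec_zero, zero_add] at h1 h2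
    rw [hf, h1, h2, Matrix.transpose_sub, Matrix.sub_mulVec]
    abel
  have hstat := gain_stationary hR θ hR'.1.posSemidef x v
  rw [← optGain, ← hk, hy', hB'] at hstat
  have hstat' := inputWeight_mulVec_gain hR θstar hsR.1.posSemidef x v
  rw [← optGain, ← hkstar] at hstat'
  -- The stationarity conditions of the two gains cancel the leading terms. What remains is linear
  -- in `v` and carries a factor `P(θ_*) - P(θ)` or `θ - θ_*`.
  have hZ : gainGap Qc Rc θstar θ x = (θstar.B *ᵥ v) ⬝ᵥ ((P - P') *ᵥ y)
      - (θstar.B *ᵥ v) ⬝ᵥ (P' *ᵥ e) - f ⬝ᵥ (P' *ᵥ (y + e)) := by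
    have h1 : gainGap Qc Rc θstar θ x = v ⬝ᵥ (inputWeight Rc θstar P *ᵥ k)
        - v ⬝ᵥ (inputWeight Rc θstar P *ᵥ kstar) := by
      rw [← dotProduct_sub, ← Matrix.mulVec_sub]; rfl
    rw [h1, hstat', quad_inputWeight, hstat, hy]
    simp only [Matrix.sub_mulVec, Matrix.mulVec_add, dotProduct_add, add_dotProduct,
      dotProduct_sub]
    ring
  have hylen : euc y ≤ euc x := (admissible.closedLoop_le h x).trans (by nlinarith)
  have helen : euc e ≤ t * (l * euc x) := by
    refine (euc_transpose_mulVec_le _ x k).trans (mul_le_mul_of_nonneg_left ?_ ht0)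
    have := admissible.gain_le hQ hR hq hRq h x
    rw [hl]; linarith
  have hflen : euc f ≤ t * euc v := by
    refine (euc_transpose_mulVec_le _ _ _).trans_eq ?_
    rw [euc_zero, zero_add]
  have hyelen : euc (y + e) ≤ (1 + l) * euc x := by
    refine (euc_add_le _ _).trans ?_
    nlinarith [mul_le_mul_of_nonneg_right ht (mul_nonneg hl0 hx)]
  set g := euc (θstar.B *ᵥ v) with hg
  have hg0 : 0 ≤ g := euc_nonneg _
  have hv0 : 0 ≤ euc v := euc_nonneg _
  have b1 : |(θstar.B *ᵥ v) ⬝ᵥ ((P - P') *ᵥ y)| ≤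
      MP * (2 * l + l ^ 2) / (1 - ρ ^ 2) * t * (g * euc x) := by
    refine (hD _ _).trans ?_
    rw [mul_div_right_comm]
    exact mul_le_mul_of_nonneg_left (mul_le_mul_of_nonneg_left hylen hg0) (by positivity)
  have b2 : |(θstar.B *ᵥ v) ⬝ᵥ (P' *ᵥ e)| ≤ MP * (g * (t * (l * euc x))) :=
    (admissible.abs_riccati_le h _ _).trans
      (mul_le_mul_of_nonneg_left (mul_le_mul_of_nonneg_left helen hg0) hMP)
  have b3 : |f ⬝ᵥ (P' *ᵥ (y + e))| ≤ MP * (t * euc v * ((1 + l) * euc x)) :=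
    (admissible.abs_riccati_le h _ _).trans (mul_le_mul_of_nonneg_left
      (mul_le_mul hflen hyelen (euc_nonneg _) (by positivity)) hMP)
  have hE : 0 ≤ MP * (2 * l + l ^ 2) / (1 - ρ ^ 2) := by positivity
  have hup : gainGap Qc Rc θstar θ x ≤ b * t * euc x * (g + euc v) := by
    have hr1 : 0 ≤ (MP * (2 * l + l ^ 2) / (1 - ρ ^ 2) + MP * l) * t * euc x * euc v := by
      positivity
    have hr2 : 0 ≤ MP * (1 + l) * t * euc x * g := by positivity
    rw [hZ, hb]
    linarith [(abs_le.1 b1).2, (abs_le.1 b2).1, (abs_le.1 b3).1]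
  -- `P(θ_*) ≥ Q ≥ μ` gives coercivity also in `B_* v`, again avoiding a bound for `B_*`.
  have hlow : μ * (g ^ 2 + euc v ^ 2) ≤ gainGap Qc Rc θstar θ x := by
    have h1 : gainGap Qc Rc θstar θ x = v ⬝ᵥ (Rc *ᵥ v)
        + (θstar.B *ᵥ v) ⬝ᵥ (P *ᵥ (θstar.B *ᵥ v)) := quad_inputWeight _ _ _ _
    have h2 := hRq v
    have h3 := hQμ (θstar.B *ᵥ v)
    have h4 := hsR.quad_eq hR (θstar.B *ᵥ v)
    have h5 := hR.posSemidef.quad_nonneg (gainOf Rc θstar P *ᵥ (θstar.B *ᵥ v))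
    have h6 := hsR.1.posSemidef.quad_nonneg
      (θstar.A *ᵥ (θstar.B *ᵥ v) + θstar.B *ᵥ (gainOf Rc θstar P *ᵥ (θstar.B *ᵥ v)))
    have h7 := mul_le_mul_of_nonneg_right hμq (sq_nonneg (euc v))
    rw [h1]
    linarith
  rw [div_mul_eq_mul_div, le_div_iff₀ hμ]
  set Z := gainGap Qc Rc θstar θ x
  have hs2 : μ * (g + euc v) ^ 2 ≤ 2 * Z := by
    linarith [mul_nonneg hμ.le (sq_nonneg (g - euc v))]
  -- The gap is at most linear (`hup`) and at least quadratic (`hs2`) in `g + |v|`. Eliminating `g +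
  -- |v|` by this square leaves the square of `b t |x|`.
  have ham := sq_nonneg (μ * (g + euc v) - 2 * (b * t * euc x))
  have hup2 := mul_le_mul_of_nonneg_left hup hμ.le
  have hs3 := mul_le_mul_of_nonneg_left hs2 hμ.le
  linarith

end Admissible

/-- Uniform bounds for the gains of the admissible parameters. -/
lemma exists_gain_bounds (hQ : Qc.PosDef) (hR : Rc.PosDef) (MP : ℝ) {ρ : ℝ} (hρ : ρ < 1) :
    ∃ C₁ C₂ κ : ℝ, 0 ≤ C₁ ∧ 0 ≤ C₂ ∧ 0 ≤ κ ∧ ∀ θstar θ : Param n m,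
      θstar ∈ admissible Qc Rc MP ρ θstar → θ ∈ admissible Qc Rc MP ρ θstar →
      ∀ x : Fin n → ℝ, gainGap Qc Rc θstar θ x ≤ C₁ * euc x ^ 2 ∧
        gainGap Qc Rc θstar θ x ≤ C₂ * frob (θ - θstar) ^ 2 * euc x ^ 2 ∧
        euc (optGain Qc Rc θ *ᵥ x) ^ 2 ≤ κ * euc x ^ 2 := by
  obtain ⟨q, hq, hRq⟩ := hR.exists_pos_le_quad
  obtain ⟨q', hq', hQq⟩ := hQ.exists_pos_le_quad
  -- The absolute value is needed because `0 ≤ MP` is only known once an admissible parameter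
  -- exists.
  set C₁ := 4 * Real.sqrt (MP / q) ^ 2 * Rc.trace + 4 * |MP| with hC₁
  have hC₁0 : 0 ≤ C₁ := by have := hR.posSemidef.trace_nonneg; positivity
  set l := 1 + Real.sqrt (MP / q) with hl
  set b := MP * (2 * l + l ^ 2) / (1 - ρ ^ 2) + MP * l + MP * (1 + l) with hb
  have hμ : 0 < min q q' := lt_min hq hq'
  -- The quadratic bound needs `‖θ - θ_*‖ ≤ 1`. For larger errors the summand `C₁` of the second
  -- constant lets the crude bound take over.
  refine ⟨C₁, C₁ + 2 * b ^ 2 / min q q', Real.sqrt (MP / q) ^ 2, hC₁0, by positivity,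
    by positivity, fun θstar θ hs h x => ?_⟩
  have hMP := admissible.MP_nonneg h
  have h1 := admissible.gainGap_le hQ hR hρ hq hRq hs h x
  have h1' : gainGap Qc Rc θstar θ x ≤ C₁ * euc x ^ 2 := by
    rwa [hC₁, abs_of_nonneg hMP]
  have hx := sq_nonneg (euc x)
  refine ⟨h1', ?_, ?_⟩
  · rcases le_total (frob (θ - θstar)) 1 with ht | ht
    · refine (admissible.gainGap_le_sq hQ hR hρ hq hRq hμ (min_le_left _ _)
        (fun x => (mul_le_mul_of_nonneg_right (min_le_right _ _) (sq_nonneg _)).trans (hQq x))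
        hs h ht hl hb x).trans ?_
      have : 0 ≤ C₁ * frob (θ - θstar) ^ 2 * euc x ^ 2 := by positivity
      linarith
    · refine h1'.trans ?_
      have ht2 : 1 ≤ frob (θ - θstar) ^ 2 := one_le_pow₀ ht
      have h2 : 0 ≤ 2 * b ^ 2 / min q q' := by positivity
      refine mul_le_mul_of_nonneg_right ?_ hx
      nlinarith [mul_le_mul_of_nonneg_left ht2 (add_nonneg hC₁0 h2)]
  · rw [← mul_pow]
    exact pow_le_pow_left₀ (euc_nonneg _) (admissible.gain_le hQ hR hq hRq h x) 2

end Riccati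

/-! ### Measurability -/

section Measurability

instance Matrix.instMeasurableSpaceReal {ι κ : Type*} : MeasurableSpace (Matrix ι κ ℝ) :=
  inferInstanceAs (MeasurableSpace (ι → κ → ℝ))

instance Matrix.instPolishSpaceReal {ι κ : Type*} [Finite ι] [Finite κ] :
    PolishSpace (Matrix ι κ ℝ) := inferInstanceAs (PolishSpace (ι → κ → ℝ))

instance Matrix.instBorelSpaceReal {ι κ : Type*} [Finite ι] [Finite κ] :
    BorelSpace (Matrix ι κ ℝ) := inferInstanceAs (BorelSpace (ι → κ → ℝ))

/-- A function whose graph is a Borel set over its domain of definition, and which is constant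
outside, is measurable. -/
lemma measurable_of_unique_graph {X Y : Type*} [MeasurableSpace X] [StandardBorelSpace X]
    [MeasurableSpace Y] [StandardBorelSpace Y] {Γ : Set (X × Y)} (hΓ : MeasurableSet Γ)
    (huniq : ∀ x y y', (x, y) ∈ Γ → (x, y') ∈ Γ → y = y') {f : X → Y} {y₀ : Y}
    (hf : ∀ x, (∃ y, (x, y) ∈ Γ) → (x, f x) ∈ Γ) (hf' : ∀ x, ¬ (∃ y, (x, y) ∈ Γ) → f x = y₀) :
    MeasurableSet {x | ∃ y, (x, y) ∈ Γ} ∧ Measurable f := by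
  have himg : ∀ s : Set Y, MeasurableSet s → MeasurableSet {x | ∃ y, (x, y) ∈ Γ ∧ y ∈ s} := by
    intro s hs
    -- Lusin–Souslin: uniqueness makes the projection injective on the graph, so the image of a
    -- Borel set is Borel.
    have h1 : MeasurableSet (Prod.fst '' (Γ ∩ Prod.snd ⁻¹' s)) := by
      refine (hΓ.inter (measurable_snd hs)).image_of_measurable_injOn measurable_fst ?_
      rintro ⟨x, y⟩ ⟨hxy, -⟩ ⟨x', y'⟩ ⟨hxy', -⟩ (rfl : x = x')
      rw [huniq x y y' hxy hxy']
    convert h1 using 1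
    ext x
    constructor
    · rintro ⟨y, hy, hs⟩; exact ⟨(x, y), ⟨hy, hs⟩, rfl⟩
    · rintro ⟨⟨x', y⟩, ⟨hy, hs⟩, rfl⟩; exact ⟨y, hy, hs⟩
  have hdom : MeasurableSet {x | ∃ y, (x, y) ∈ Γ} := by
    simpa using himg Set.univ MeasurableSet.univ
  refine ⟨hdom, fun s hs => ?_⟩
  have : f ⁻¹' s = {x | ∃ y, (x, y) ∈ Γ ∧ y ∈ s} ∪ ({x | ∃ y, (x, y) ∈ Γ}ᶜ ∩ {_x | y₀ ∈ s}) := by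
    ext x
    by_cases hx : ∃ y, (x, y) ∈ Γ
    · have h1 := hf x hx
      simp only [Set.mem_preimage, Set.mem_union, Set.mem_inter_iff, Set.mem_compl_iff,
        Set.mem_ofPred_eq, hx, not_true_eq_false, false_and, or_false]
      exact ⟨fun h => ⟨_, h1, h⟩, fun ⟨y, hy, hys⟩ => huniq x _ _ hy h1 ▸ hys⟩
    · have h1 := hf' x hx
      have h2 : ¬ ∃ y, (x, y) ∈ Γ ∧ y ∈ s := fun ⟨y, hy, _⟩ => hx ⟨y, hy⟩
      simp only [Set.mem_preimage, Set.mem_union, Set.mem_inter_iff, Set.mem_compl_iff,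
        Set.mem_ofPred_eq, hx, h2, not_false_eq_true, true_and, false_or, h1]
  rw [this]
  exact (himg s hs).union (hdom.compl.inter (MeasurableSet.const _))

variable {Ω : Type*} [MeasurableSpace Ω] {ι κ ν : Type*}

lemma measurable_matrix_iff {M : Ω → Matrix ι κ ℝ} :
    Measurable M ↔ ∀ i j, Measurable fun ω => M ω i j := by
  constructor
  · intro h i j
    exact (measurable_pi_apply j).comp ((measurable_pi_apply i).comp h)
  · intro h
    exact measurable_pi_iff.2 fun i => measurable_pi_iff.2 fun j => h i j

lemma Measurable.matrix_apply {M : Ω → Matrix ι κ ℝ} (h : Measurable M) (i : ι) (j : κ) :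
    Measurable fun ω => M ω i j := measurable_matrix_iff.1 h i j

lemma Measurable.matrix_add {M N : Ω → Matrix ι κ ℝ} (hM : Measurable M) (hN : Measurable N) :
    Measurable fun ω => M ω + N ω :=
  measurable_matrix_iff.2 fun i j => (hM.matrix_apply i j).add (hN.matrix_apply i j)

lemma Measurable.matrix_sub {M N : Ω → Matrix ι κ ℝ} (hM : Measurable M) (hN : Measurable N) :
    Measurable fun ω => M ω - N ω :=
  measurable_matrix_iff.2 fun i j => (hM.matrix_apply i j).sub (hN.matrix_apply i j)

lemma Measurable.matrix_neg {M : Ω → Matrix ι κ ℝ} (hM : Measurable M) :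
    Measurable fun ω => -M ω :=
  measurable_matrix_iff.2 fun i j => (hM.matrix_apply i j).neg

lemma Measurable.matrix_smul {c : Ω → ℝ} {M : Ω → Matrix ι κ ℝ} (hc : Measurable c)
    (hM : Measurable M) : Measurable fun ω => c ω • M ω :=
  measurable_matrix_iff.2 fun i j => hc.mul (hM.matrix_apply i j)

lemma Measurable.matrix_transpose {M : Ω → Matrix ι κ ℝ} (hM : Measurable M) :
    Measurable fun ω => (M ω)ᵀ :=
  measurable_matrix_iff.2 fun i j => hM.matrix_apply j i

lemma Measurable.matrix_mul [Fintype κ] {M : Ω → Matrix ι κ ℝ} {N : Ω → Matrix κ ν ℝ}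
    (hM : Measurable M) (hN : Measurable N) : Measurable fun ω => M ω * N ω := by
  refine measurable_matrix_iff.2 fun i j => ?_
  simp only [Matrix.mul_apply]
  exact Finset.measurable_sum _ fun k _ => (hM.matrix_apply i k).mul (hN.matrix_apply k j)

lemma Measurable.matrix_mulVec [Fintype κ] {M : Ω → Matrix ι κ ℝ} {x : Ω → κ → ℝ}
    (hM : Measurable M) (hx : Measurable x) : Measurable fun ω => M ω *ᵥ x ω := by
  refine measurable_pi_iff.2 fun i => ?_
  simp only [Matrix.mulVec, dotProduct]
  exact Finset.measurable_sum _ fun k _ =>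
    (hM.matrix_apply i k).mul ((measurable_pi_apply k).comp hx)

lemma Measurable.dotProduct [Fintype ι] {x y : Ω → ι → ℝ} (hx : Measurable x)
    (hy : Measurable y) : Measurable fun ω => x ω ⬝ᵥ y ω :=
  Finset.measurable_sum _ fun k _ =>
    ((measurable_pi_apply k).comp hx).mul ((measurable_pi_apply k).comp hy)

lemma Measurable.vecMulVec {x : Ω → ι → ℝ} {y : Ω → κ → ℝ} (hx : Measurable x)
    (hy : Measurable y) : Measurable fun ω => Matrix.vecMulVec (x ω) (y ω) :=
  measurable_matrix_iff.2 fun i j =>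
    ((measurable_pi_apply i).comp hx).mul ((measurable_pi_apply j).comp hy)

lemma Measurable.vec_sumElim {x : Ω → ι → ℝ} {y : Ω → κ → ℝ} (hx : Measurable x)
    (hy : Measurable y) : Measurable fun ω => Sum.elim (x ω) (y ω) := by
  refine measurable_pi_iff.2 fun i => ?_
  rcases i with i | i
  · exact (measurable_pi_apply i).comp hx
  · exact (measurable_pi_apply i).comp hy

lemma Measurable.matrix_trace [Fintype ι] {M : Ω → Matrix ι ι ℝ} (hM : Measurable M) :
    Measurable fun ω => (M ω).trace :=
  Finset.measurable_sum _ fun i _ => hM.matrix_apply i i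

lemma Measurable.matrix_det [Fintype ι] [DecidableEq ι] {M : Ω → Matrix ι ι ℝ}
    (hM : Measurable M) : Measurable fun ω => (M ω).det :=
  (Continuous.matrix_det continuous_id).measurable.comp hM

lemma Measurable.matrix_inv [Fintype ι] [DecidableEq ι] {M : Ω → Matrix ι ι ℝ}
    (hM : Measurable M) : Measurable fun ω => (M ω)⁻¹ := by
  simp only [Matrix.inv_def, Ring.inverse_eq_inv']
  exact hM.matrix_det.inv.matrix_smul
    ((Continuous.matrix_adjugate continuous_id).measurable.comp hM)

lemma Measurable.euc [Fintype ι] {x : Ω → ι → ℝ} (hx : Measurable x) :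
    Measurable fun ω => euc (x ω) := by
  have : ∀ ω, _root_.euc (x ω) = Real.sqrt (x ω ⬝ᵥ x ω) := fun ω => by
    rw [← euc_sq, Real.sqrt_sq (euc_nonneg _)]
  simp only [this]
  exact (hx.dotProduct hx).sqrt

lemma Measurable.frob [Fintype ι] [Fintype κ] {M : Ω → Matrix ι κ ℝ} (hM : Measurable M) :
    Measurable fun ω => frob (M ω) :=
  (Finset.measurable_sum _ fun i _ => Finset.measurable_sum _ fun j _ =>
    (hM.matrix_apply i j).pow_const 2).sqrt

lemma measurableSet_posSemidef [Fintype ι] :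
    MeasurableSet {M : Matrix ι ι ℝ | M.PosSemidef} := by
  have : {M : Matrix ι ι ℝ | M.PosSemidef} =
      {M | Mᵀ = M} ∩ ⋂ x : ι → ℝ, {M | 0 ≤ x ⬝ᵥ (M *ᵥ x)} := by
    ext M
    simp [Matrix.posSemidef_iff_dotProduct_mulVec, Matrix.IsHermitian]
  rw [this]
  refine (IsClosed.inter (isClosed_eq (by fun_prop) continuous_id)
    (isClosed_iInter fun x => isClosed_le continuous_const ?_)).measurableSet
  exact Continuous.dotProduct continuous_const (Continuous.matrix_mulVec continuous_id
    continuous_const)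

lemma measurableSet_posDef [Fintype ι] [DecidableEq ι] :
    MeasurableSet {M : Matrix ι ι ℝ | M.PosDef} := by
  have : {M : Matrix ι ι ℝ | M.PosDef} = {M | M.PosSemidef} ∩ {M | M.det ≠ 0} := by
    ext M
    constructor
    · exact fun h => ⟨h.posSemidef, h.det_pos.ne'⟩
    · rintro ⟨h1, h2⟩
      exact h1.posDef_iff_isUnit.2 ((Matrix.isUnit_iff_isUnit_det _).2 (isUnit_iff_ne_zero.2 h2))
  rw [this]
  exact measurableSet_posSemidef.inter
    (measurableSet_eq_fun (measurable_id.matrix_det) measurable_const).compl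

/-- The square root is the unique positive semidefinite root, so its graph is Borel; `0` is the
value of `CFC.sqrt` outside the positive semidefinite cone. -/
lemma measurable_cfcSqrt [Fintype ι] [DecidableEq ι] :
    Measurable fun M : Matrix ι ι ℝ => CFC.sqrt M := by
  refine (measurable_of_unique_graph
    (Γ := {p : Matrix ι ι ℝ × Matrix ι ι ℝ | p.2.PosSemidef ∧ p.2 * p.2 = p.1}) (y₀ := 0)
    ?_ ?_ ?_ ?_).2
  · exact (measurable_snd measurableSet_posSemidef).inter
      (measurableSet_eq_fun (measurable_snd.matrix_mul measurable_snd) measurable_fst)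
  · rintro x y y' ⟨h1, h2⟩ ⟨h3, h4⟩
    dsimp only at h1 h2 h3 h4
    rw [← CFC.sqrt_unique h2 (Matrix.nonneg_iff_posSemidef.2 h1),
      ← CFC.sqrt_unique h4 (Matrix.nonneg_iff_posSemidef.2 h3)]
  · rintro x ⟨y, h1, h2⟩
    simp only [Set.mem_ofPred_eq] at h1 h2 ⊢
    rw [CFC.sqrt_unique h2 (Matrix.nonneg_iff_posSemidef.2 h1)]
    exact ⟨h1, h2⟩
  · intro x hx
    refine CFC.sqrt_of_not_nonneg fun h => hx ⟨CFC.sqrt x, ?_, ?_⟩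
    · exact Matrix.nonneg_iff_posSemidef.1 (CFC.sqrt_nonneg x)
    · exact CFC.sqrt_mul_sqrt_self x h

lemma measurable_specNorm {n : ℕ} :
    Measurable fun M : Matrix (Fin n) (Fin n) ℝ => specNorm M := by
  refine Continuous.measurable ?_
  unfold specNorm
  have : Continuous (Matrix.toEuclideanCLM (n := Fin n) (𝕜 := ℝ)) :=
    LinearMap.continuous_of_finiteDimensional
      (Matrix.toEuclideanCLM (n := Fin n) (𝕜 := ℝ)).toAlgEquiv.toLinearMap
  exact this.norm

end Measurability

/-! ### Measurability of the Riccati solution, of rejection sampling and of the run. -/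

section MeasurabilityLQR

variable {n m : ℕ} {Qc : Matrix (Fin n) (Fin n) ℝ} {Rc : Matrix (Fin m) (Fin m) ℝ}

lemma Param.measurable_A : Measurable (Param.A : Param n m → _) :=
  measurable_matrix_iff.2 fun i j => measurable_id.matrix_apply (Sum.inl j) i

lemma Param.measurable_B : Measurable (Param.B : Param n m → _) :=
  measurable_matrix_iff.2 fun i j => measurable_id.matrix_apply (Sum.inr j) i

lemma Measurable.gainOf {Ω : Type*} [MeasurableSpace Ω] {θ : Ω → Param n m}
    {P : Ω → Matrix (Fin n) (Fin n) ℝ} (hθ : Measurable θ) (hP : Measurable P) :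
    Measurable fun ω => gainOf Rc (θ ω) (P ω) := by
  have hA := Param.measurable_A.comp hθ
  have hB := Param.measurable_B.comp hθ
  exact (((((measurable_const.matrix_add
    ((hB.matrix_transpose.matrix_mul hP).matrix_mul hB)).matrix_inv).matrix_mul
      hB.matrix_transpose).matrix_mul hP).matrix_mul hA).matrix_neg

/-- `riccati` is defined by choice. Uniqueness of the solution makes it the function of a Borel
graph, hence measurable. -/
lemma riccati_measurability (hQ : Qc.PosDef) (hR : Rc.PosDef) :
    MeasurableSet {θ : Param n m | ∃ P, IsRiccatiSolution Qc Rc θ P} ∧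
      Measurable (riccati Qc Rc : Param n m → _) := by
  refine measurable_of_unique_graph
    (Γ := {p : Param n m × Matrix (Fin n) (Fin n) ℝ | IsRiccatiSolution Qc Rc p.1 p.2})
    (y₀ := 0) ?_ ?_ ?_ ?_
  · have hA := Param.measurable_A.comp
      (measurable_fst : Measurable fun p : Param n m × Matrix (Fin n) (Fin n) ℝ => p.1)
    have hB := Param.measurable_B.comp
      (measurable_fst : Measurable fun p : Param n m × Matrix (Fin n) (Fin n) ℝ => p.1)
    have hAP := hA.matrix_transpose.matrix_mul measurable_snd
    exact (measurable_snd measurableSet_posDef).inter (measurableSet_eq_fun measurable_snd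
      ((measurable_const.matrix_add (hAP.matrix_mul hA)).matrix_add
        ((hAP.matrix_mul hB).matrix_mul (measurable_fst.gainOf measurable_snd))))
  · exact fun θ P P' h h' => IsRiccatiSolution.unique hQ hR h h'
  · exact fun θ h => riccati_spec h
  · exact fun θ h => dif_neg h

lemma measurable_riccati (hQ : Qc.PosDef) (hR : Rc.PosDef) :
    Measurable (riccati Qc Rc : Param n m → _) := (riccati_measurability hQ hR).2

lemma measurable_optGain (hQ : Qc.PosDef) (hR : Rc.PosDef) :
    Measurable (optGain Qc Rc : Param n m → _) :=
  measurable_id.gainOf (measurable_riccati hQ hR)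

lemma measurableSet_admissible (hQ : Qc.PosDef) (hR : Rc.PosDef) (MP ρ : ℝ) :
    MeasurableSet {p : Param n m × Param n m | p.2 ∈ admissible Qc Rc MP ρ p.1} := by
  have hric := (measurable_riccati hQ hR).comp
    (measurable_snd : Measurable fun p : Param n m × Param n m => p.2)
  have hgain := (measurable_optGain hQ hR).comp
    (measurable_snd : Measurable fun p : Param n m × Param n m => p.2)
  refine (measurable_snd (riccati_measurability hQ hR).1).inter
    ((measurableSet_le hric.matrix_trace measurable_const).inter
      (measurableSet_le (measurable_specNorm.comp ?_) measurable_const))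
  exact (Param.measurable_A.comp measurable_fst).matrix_add
    ((Param.measurable_B.comp measurable_fst).matrix_mul hgain)

lemma Measurable.stageCost {Ω : Type*} [MeasurableSpace Ω] {x : Ω → Fin n → ℝ}
    {u : Ω → Fin m → ℝ} (hx : Measurable x) (hu : Measurable u) :
    Measurable fun ω => stageCost Qc Rc (x ω) (u ω) :=
  (hx.dotProduct (measurable_const.matrix_mulVec hx)).add
    (hu.dotProduct (measurable_const.matrix_mulVec hu))

lemma rejectionSample_eq {Q : Set (Param n m)} {c : ℕ → Param n m} {j : ℕ} (hj : c j ∈ Q)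
    (hlt : ∀ i < j, c i ∉ Q) : rejectionSample Q c = c j := by
  have : sInf {j | c j ∈ Q} = j := by
    refine le_antisymm (Nat.sInf_le hj) ?_
    by_contra! h
    exact hlt _ h (Nat.sInf_mem (s := {j | c j ∈ Q}) ⟨j, hj⟩)
  rw [rejectionSample, this]

/-- The default `sInf ∅ = 0` selects candidate `0`. This event turns out to be null, but
measurability must cover it. -/
lemma rejectionSample_of_forall_notMem {Q : Set (Param n m)} {c : ℕ → Param n m}
    (h : ∀ j, c j ∉ Q) : rejectionSample Q c = c 0 := by
  have : {j | c j ∈ Q} = ∅ := Set.eq_empty_iff_forall_notMem.2 h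
  rw [rejectionSample, this, Nat.sInf_empty]

lemma rejectionSample_mem {Q : Set (Param n m)} {c : ℕ → Param n m} {j : ℕ} (hj : c j ∈ Q) :
    rejectionSample Q c ∈ Q :=
  Nat.sInf_mem (s := {j | c j ∈ Q}) ⟨j, hj⟩

/-- The preimage is split according to the index of the first accepted candidate, with one more
piece for the case of no acceptance. -/
lemma measurable_rejectionSample {Ω : Type*} [MeasurableSpace Ω] {Q : Ω → Set (Param n m)}
    {c : ℕ → Ω → Param n m} (hQ : ∀ j, MeasurableSet {ω | c j ω ∈ Q ω})
    (hc : ∀ j, Measurable (c j)) :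
    Measurable fun ω => rejectionSample (Q ω) fun j => c j ω := by
  intro s hs
  have : (fun ω => rejectionSample (Q ω) fun j => c j ω) ⁻¹' s =
      (⋃ j, ({ω | c j ω ∈ Q ω} ∩ ⋂ i, ⋂ (_ : i < j), {ω | c i ω ∈ Q ω}ᶜ) ∩ c j ⁻¹' s) ∪
        ((⋂ j, {ω | c j ω ∈ Q ω}ᶜ) ∩ c 0 ⁻¹' s) := by
    ext ω
    by_cases h : ∃ j, c j ω ∈ Q ω
    · classical
      have h1 := Nat.find_spec h
      have h2 := fun i (hi : i < Nat.find h) => Nat.find_min h hi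
      have h3 := rejectionSample_eq (c := fun j => c j ω) h1 h2
      simp only [Set.mem_preimage, Set.mem_union, Set.mem_iUnion, Set.mem_inter_iff,
        Set.mem_iInter, Set.mem_compl_iff, Set.mem_ofPred_eq]
      constructor
      · intro h4
        exact Or.inl ⟨Nat.find h, ⟨h1, h2⟩, h3 ▸ h4⟩
      · rintro (⟨j, ⟨h5, h6⟩, h7⟩ | ⟨h5, -⟩)
        · rwa [rejectionSample_eq (c := fun j => c j ω) h5 h6]
        · exact absurd h1 (h5 _)
    · push Not at h
      have h3 := rejectionSample_of_forall_notMem (c := fun j => c j ω) h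
      simp only [Set.mem_preimage, Set.mem_union, Set.mem_iUnion, Set.mem_inter_iff,
        Set.mem_iInter, Set.mem_compl_iff, Set.mem_ofPred_eq, h3, h]
      simp
  rw [this]
  refine (MeasurableSet.iUnion fun j => ((hQ j).inter (MeasurableSet.iInter fun i =>
    MeasurableSet.iInter fun _ => (hQ i).compl)).inter (hc j hs)).union
      ((MeasurableSet.iInter fun j => (hQ j).compl).inter (hc 0 hs))

/-- The offline data the online run depends on: `θstar`, `U`, `θhat` and `α`. -/
abbrev OfflineData (n m : ℕ) :=
  Param n m × Matrix (Fin n ⊕ Fin m) (Fin n ⊕ Fin m) ℝ × Param n m × ℝ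

/-- The run (with `M_δ = 0`) for given offline data and noise. -/
def runOf (Qc : Matrix (Fin n) (Fin n) ℝ) (Rc : Matrix (Fin m) (Fin m) ℝ) (MP ρ δ₂ : ℝ)
    (d : OfflineData n m) (w : ℕ → Fin n → ℝ) (η : ℕ → ℕ → Param n m) : RunInput n m where
  Qc := Qc
  Rc := Rc
  MP := MP
  ρ := ρ
  θstar := d.1
  U := d.2.1
  θhat := d.2.2.1
  α := d.2.2.2
  δ₂ := δ₂
  Mδ := 0
  w := w
  η := η

instance OnlineState.instMeasurableSpace : MeasurableSpace (OnlineState n m) :=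
  MeasurableSpace.comap (fun s => (s.x, s.V, s.b)) inferInstance

lemma OnlineState.measurable_fields :
    Measurable fun s : OnlineState n m => (s.x, s.V, s.b) := comap_measurable _

lemma OnlineState.measurable_x : Measurable (OnlineState.x : OnlineState n m → _) :=
  OnlineState.measurable_fields.fst

lemma OnlineState.measurable_V : Measurable (OnlineState.V : OnlineState n m → _) :=
  OnlineState.measurable_fields.snd.fst

lemma OnlineState.measurable_b : Measurable (OnlineState.b : OnlineState n m → _) :=
  OnlineState.measurable_fields.snd.snd

lemma OnlineState.measurable_mk {Ω : Type*} [MeasurableSpace Ω] {x : Ω → Fin n → ℝ}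
    {V : Ω → Matrix (Fin n ⊕ Fin m) (Fin n ⊕ Fin m) ℝ} {b : Ω → Param n m}
    (hx : Measurable x) (hV : Measurable V) (hb : Measurable b) :
    Measurable fun ω => OnlineState.mk (x ω) (V ω) (b ω) :=
  measurable_comap_iff.2 (hx.prodMk (hV.prodMk hb))

lemma Measurable.betaWidth {Ω : Type*} [MeasurableSpace Ω]
    {U V : Ω → Matrix (Fin n ⊕ Fin m) (Fin n ⊕ Fin m) ℝ} {α : Ω → ℝ} {δ₂ : ℝ}
    (hU : Measurable U) (hV : Measurable V) (hα : Measurable α) :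
    Measurable fun ω => betaWidth (U ω) (V ω) (α ω) δ₂ 0 := by
  simp only [_root_.betaWidth, mul_zero, add_zero]
  exact (measurable_const.mul ((measurable_const.mul ((hV.matrix_det.sqrt.div
    (hU.matrix_det.sqrt.mul measurable_const)).log)).sqrt)).add hα

variable {Ω : Type*} [MeasurableSpace Ω] {d : Ω → OfflineData n m} {w : ℕ → Ω → Fin n → ℝ}
  {η : ℕ → ℕ → Ω → Param n m} {s : Ω → OnlineState n m} {MP ρ δ₂ : ℝ} {k : ℕ}

lemma measurable_candidate (hd : Measurable d) (hs : Measurable s)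
    (hη : ∀ j, Measurable (η k j)) (j : ℕ) :
    Measurable fun ω => (runOf Qc Rc MP ρ δ₂ (d ω) (fun k => w k ω)
      (fun k j => η k j ω)).candidate k (s ω) j := by
  have hV := OnlineState.measurable_V.comp hs
  exact (hV.matrix_inv.matrix_mul (OnlineState.measurable_b.comp hs)).matrix_add
    ((hd.snd.fst.betaWidth hV hd.snd.snd.snd).matrix_smul
      ((measurable_cfcSqrt.comp hV).matrix_inv.matrix_mul (hη j)))

lemma measurable_sample (hQ : Qc.PosDef) (hR : Rc.PosDef) (hd : Measurable d)
    (hs : Measurable s) (hη : ∀ j, Measurable (η k j)) :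
    Measurable fun ω => (runOf Qc Rc MP ρ δ₂ (d ω) (fun k => w k ω)
      (fun k j => η k j ω)).sample k (s ω) := by
  have hc := measurable_candidate (Qc := Qc) (Rc := Rc) (MP := MP) (ρ := ρ) (δ₂ := δ₂) (w := w)
    hd hs hη
  exact measurable_rejectionSample
    (fun j => (hd.fst.prodMk (hc j)) (measurableSet_admissible hQ hR MP ρ)) hc

lemma measurable_control (hQ : Qc.PosDef) (hR : Rc.PosDef) (hd : Measurable d)
    (hs : Measurable s) (hη : ∀ j, Measurable (η k j)) :
    Measurable fun ω => (runOf Qc Rc MP ρ δ₂ (d ω) (fun k => w k ω)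
      (fun k j => η k j ω)).control k (s ω) :=
  ((measurable_optGain hQ hR).comp (measurable_sample hQ hR hd hs hη)).matrix_mulVec
    (OnlineState.measurable_x.comp hs)

lemma measurable_step (hQ : Qc.PosDef) (hR : Rc.PosDef) (hd : Measurable d)
    (hs : Measurable s) (hw : Measurable (w k)) (hη : ∀ j, Measurable (η k j)) :
    Measurable fun ω => (runOf Qc Rc MP ρ δ₂ (d ω) (fun k => w k ω)
      (fun k j => η k j ω)).step k (s ω) := by
  have hz := (OnlineState.measurable_x.comp hs).vec_sumElim
    (measurable_control (MP := MP) (ρ := ρ) (δ₂ := δ₂) (w := w) hQ hR hd hs hη)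
  have hx := (hd.fst.matrix_transpose.matrix_mulVec hz).add hw
  exact OnlineState.measurable_mk hx
    ((OnlineState.measurable_V.comp hs).matrix_add (hz.vecMulVec hz))
    ((OnlineState.measurable_b.comp hs).matrix_add (hz.vecMulVec hx))

/-- Only noise from before step `k` has to be measurable. With the σ-algebra of the past as
`MeasurableSpace Ω` this says that the run is adapted. -/
lemma measurable_state (hQ : Qc.PosDef) (hR : Rc.PosDef) (hd : Measurable d) (k : ℕ)
    (hw : ∀ i < k, Measurable (w i)) (hη : ∀ i < k, ∀ j, Measurable (η i j)) :
    Measurable fun ω => (runOf Qc Rc MP ρ δ₂ (d ω) (fun k => w k ω)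
      (fun k j => η k j ω)).state k := by
  induction k with
  | zero =>
    exact OnlineState.measurable_mk measurable_const hd.snd.fst
      (hd.snd.fst.matrix_mul hd.snd.snd.fst)
  | succ k ih =>
    exact measurable_step hQ hR hd
      (ih (fun i hi => hw i (by omega)) fun i hi => hη i (by omega)) (hw k (by omega))
      (hη k (by omega))

lemma measurable_excessCost (hQ : Qc.PosDef) (hR : Rc.PosDef) (hd : Measurable d) (T : ℕ)
    (hw : ∀ i, Measurable (w i)) (hη : ∀ i j, Measurable (η i j)) :
    Measurable fun ω => (runOf Qc Rc MP ρ δ₂ (d ω) (fun k => w k ω)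
      (fun k j => η k j ω)).excessCost T := by
  refine Finset.measurable_sum _ fun k _ => Measurable.sub ?_ ?_
  · have hs := measurable_state (MP := MP) (ρ := ρ) (δ₂ := δ₂) hQ hR hd k (fun i _ => hw i)
      (fun i _ => hη i)
    exact (OnlineState.measurable_x.comp hs).stageCost (measurable_control hQ hR hd hs (hη k))
  · exact ((measurable_riccati hQ hR).comp hd.fst).matrix_trace

end MeasurabilityLQR

/-! ### The least squares estimate -/

section Estimate

/-! ### Norm estimates for inverses of matrices bounded below. -/

section Weighted

variable {ι κ : Type*} [Fintype ι]

lemma col_mul {ν : Type*} (M : Matrix κ ι ℝ) (N : Matrix ι ν ℝ) (j : ν) :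
    (M * N).col j = M *ᵥ N.col j := by
  ext i
  simp [Matrix.mul_apply, Matrix.mulVec, dotProduct]

lemma quad_add_vecMulVec_self (V : Matrix ι ι ℝ) (z x : ι → ℝ) :
    x ⬝ᵥ ((V + Matrix.vecMulVec z z) *ᵥ x) = x ⬝ᵥ (V *ᵥ x) + (z ⬝ᵥ x) ^ 2 := by
  rw [Matrix.add_mulVec, dotProduct_add, Matrix.vecMulVec_mulVec]
  simp [dotProduct_comm x z, pow_two]

variable [Fintype κ] [DecidableEq ι] {U V : Matrix ι ι ℝ} {c : ℝ}

lemma Matrix.PosDef.mulVec_inv_mulVec (hV : V.PosDef) (g : ι → ℝ) : V *ᵥ (V⁻¹ *ᵥ g) = g := by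
  rw [Matrix.mulVec_mulVec,
    Matrix.mul_nonsing_inv _ ((Matrix.isUnit_iff_isUnit_det _).1 hV.isUnit), Matrix.one_mulVec]

lemma euc_inv_mulVec_le (hc : 0 < c) (hV : V.PosDef)
    (hVc : ∀ x : ι → ℝ, c * euc x ^ 2 ≤ x ⬝ᵥ (V *ᵥ x)) (g : ι → ℝ) :
    euc (V⁻¹ *ᵥ g) ≤ c⁻¹ * euc g := by
  have h1 := hVc (V⁻¹ *ᵥ g)
  rw [hV.mulVec_inv_mulVec] at h1
  have h2 := h1.trans (dotProduct_le_euc _ _)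
  rw [inv_mul_eq_div, le_div_iff₀ hc]
  rcases (euc_nonneg (V⁻¹ *ᵥ g)).eq_or_lt with h | h
  · rw [← h, zero_mul]; exact euc_nonneg _
  · refine le_of_mul_le_mul_left ?_ h
    linarith

lemma frob_inv_mul_sq_le (hc : 0 < c) (hV : V.PosDef)
    (hVc : ∀ x : ι → ℝ, c * euc x ^ 2 ≤ x ⬝ᵥ (V *ᵥ x)) (G : Matrix ι κ ℝ) :
    frob (V⁻¹ * G) ^ 2 ≤ (c⁻¹) ^ 2 * frob G ^ 2 := by
  rw [frob_sq_col, frob_sq_col, Finset.mul_sum]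
  refine Finset.sum_le_sum fun j _ => ?_
  rw [col_mul, ← mul_pow]
  exact pow_le_pow_left₀ (euc_nonneg _) (euc_inv_mulVec_le hc hV hVc _) 2

/-- For `y = V⁻¹Ua` one has `|√U y|² ≤ yᵀVy = ⟨√U y, √U a⟩`, hence `c |y|² ≤ yᵀVy ≤ |√U a|²`.
Measuring the error in the `U`-norm costs a factor `c⁻¹` only. -/
lemma frob_inv_mul_mul_sq_le (hc : 0 < c) (hV : V.PosDef)
    (hVc : ∀ x : ι → ℝ, c * euc x ^ 2 ≤ x ⬝ᵥ (V *ᵥ x)) (hU : U.PosSemidef)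
    (hUV : ∀ x : ι → ℝ, x ⬝ᵥ (U *ᵥ x) ≤ x ⬝ᵥ (V *ᵥ x)) (D : Matrix ι κ ℝ) :
    frob (V⁻¹ * (U * D)) ^ 2 ≤ c⁻¹ * frob (CFC.sqrt U * D) ^ 2 := by
  rw [frob_sq_col, frob_sq_col, Finset.mul_sum]
  refine Finset.sum_le_sum fun j _ => ?_
  rw [col_mul, col_mul, col_mul]
  set a := D.col j
  set y := V⁻¹ *ᵥ (U *ᵥ a) with hy
  have h1 : y ⬝ᵥ (V *ᵥ y) = (CFC.sqrt U *ᵥ y) ⬝ᵥ (CFC.sqrt U *ᵥ a) := by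
    rw [hy, hV.mulVec_inv_mulVec, hU.dotProduct_mulVec_eq_sqrt]
  have h2 := dotProduct_le_euc (CFC.sqrt U *ᵥ y) (CFC.sqrt U *ᵥ a)
  have h3 : euc (CFC.sqrt U *ᵥ y) ^ 2 ≤ y ⬝ᵥ (V *ᵥ y) := by
    rw [euc_sq, ← hU.dotProduct_mulVec_eq_sqrt]; exact hUV y
  have h4 := hVc y
  rw [inv_mul_eq_div, le_div_iff₀ hc]
  nlinarith [sq_nonneg (euc (CFC.sqrt U *ᵥ y) - euc (CFC.sqrt U *ᵥ a))]

lemma frob_sqrt_inv_mul_sq_le (hc : 0 < c) (hV : V.PosDef)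
    (hVc : ∀ x : ι → ℝ, c * euc x ^ 2 ≤ x ⬝ᵥ (V *ᵥ x)) (H : Matrix ι κ ℝ) :
    frob ((CFC.sqrt V)⁻¹ * H) ^ 2 ≤ c⁻¹ * frob H ^ 2 := by
  rw [frob_sq_col, frob_sq_col, Finset.mul_sum]
  refine Finset.sum_le_sum fun j _ => ?_
  rw [col_mul]
  set y := (CFC.sqrt V)⁻¹ *ᵥ H.col j with hy
  have h1 : CFC.sqrt V *ᵥ y = H.col j := by
    rw [hy, Matrix.mulVec_mulVec, Matrix.mul_nonsing_inv _
      ((Matrix.isUnit_iff_isUnit_det _).1 hV.isUnit_sqrt), Matrix.one_mulVec]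
  have h2 := hVc y
  rw [hV.posSemidef.dotProduct_mulVec_eq_sqrt, h1, ← euc_sq] at h2
  rw [inv_mul_eq_div, le_div_iff₀ hc]
  linarith

lemma det_add_vecMulVec_self (hV : V.PosDef) (z : ι → ℝ) :
    (V + Matrix.vecMulVec z z).det = V.det * (1 + z ⬝ᵥ (V⁻¹ *ᵥ z)) := by
  rw [Matrix.vecMulVec_eq Unit, Matrix.det_add_replicateCol_mul_replicateRow
    ((Matrix.isUnit_iff_isUnit_det _).1 hV.isUnit)]
  congr 2
  simp [Matrix.mul_assoc, Matrix.mul_apply, dotProduct, Matrix.mulVec, Matrix.replicateRow,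
    Matrix.replicateCol]

end Weighted

/-! ### Error of the estimate and size of the confidence width along a run. -/

namespace RunInput

variable {n m : ℕ} (I : RunInput n m)

/-- The state-action pair of the step `k`. -/
noncomputable def pair (k : ℕ) : Fin n ⊕ Fin m → ℝ :=
  Sum.elim (I.state k).x (I.control k (I.state k))

/-- The noise correlation `∑_{i < k} z_i w_iᵀ`. -/
noncomputable def noiseCorr (k : ℕ) : Param n m :=
  ∑ i ∈ Finset.range k, Matrix.vecMulVec (I.pair i) (I.w i)

lemma state_succ_x (k : ℕ) : (I.state (k + 1)).x = I.θstarᵀ *ᵥ I.pair k + I.w k := rfl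

lemma state_succ_V (k : ℕ) :
    (I.state (k + 1)).V = (I.state k).V + Matrix.vecMulVec (I.pair k) (I.pair k) := rfl

lemma state_succ_b (k : ℕ) : (I.state (k + 1)).b =
    (I.state k).b + Matrix.vecMulVec (I.pair k) (I.state (k + 1)).x := rfl

lemma noiseCorr_succ (k : ℕ) :
    I.noiseCorr (k + 1) = I.noiseCorr k + Matrix.vecMulVec (I.pair k) (I.w k) := by
  rw [noiseCorr, Finset.sum_range_succ]; rfl

/-- The normal equations separate the two error sources of the estimate: the offline error and the
correlation with the online noise. -/
lemma state_b (k : ℕ) : (I.state k).b =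
    (I.state k).V * I.θstar + (I.U * (I.θhat - I.θstar) + I.noiseCorr k) := by
  induction k with
  | zero =>
    have h1 : (I.state 0).b = I.U * I.θhat := rfl
    have h2 : (I.state 0).V = I.U := rfl
    rw [h1, h2, noiseCorr, Finset.sum_range_zero, Matrix.mul_sub]
    abel
  | succ k ih =>
    rw [state_succ_b, ih, state_succ_V, state_succ_x, noiseCorr_succ, Matrix.add_mul,
      Matrix.vecMulVec_mul, Matrix.vecMulVec_add, Matrix.mulVec_transpose]
    abel

variable {I} {c : ℝ}

lemma state_V_isHermitian (hU : I.U.PosDef) (k : ℕ) : (I.state k).V.IsHermitian := by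
  induction k with
  | zero => exact hU.isHermitian
  | succ k ih =>
    rw [state_succ_V]
    exact ih.add (by simpa using (Matrix.posSemidef_vecMulVec_self_star (I.pair k)).isHermitian)

lemma quad_U_le_quad_state_V (k : ℕ) (x : Fin n ⊕ Fin m → ℝ) :
    x ⬝ᵥ (I.U *ᵥ x) ≤ x ⬝ᵥ ((I.state k).V *ᵥ x) := by
  induction k with
  | zero => exact le_rfl
  | succ k ih =>
    rw [state_succ_V, quad_add_vecMulVec_self]
    exact ih.trans (le_add_of_nonneg_right (sq_nonneg _))

lemma state_V_posDef (hU : I.U.PosDef) (k : ℕ) : (I.state k).V.PosDef := by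
  refine Matrix.PosDef.of_dotProduct_mulVec_pos (state_V_isHermitian hU k) fun x hx => ?_
  have := hU.dotProduct_mulVec_pos hx
  simp only [star_trivial] at this ⊢
  exact this.trans_le (quad_U_le_quad_state_V k x)

/-- The offline error is damped by `c⁻¹` and the noise correlation by `c⁻²`. The latter suffices
because the second moment of the correlation grows linearly in time. -/
lemma frob_estimate_sub_sq_le (hc : 0 < c) (hU : I.U.PosDef)
    (hUc : ∀ x : Fin n ⊕ Fin m → ℝ, c * euc x ^ 2 ≤ x ⬝ᵥ (I.U *ᵥ x)) (k : ℕ) :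
    frob (estimate (I.state k) - I.θstar) ^ 2 ≤
      2 * (c⁻¹ * frob (CFC.sqrt I.U * (I.θhat - I.θstar)) ^ 2)
        + 2 * ((c⁻¹) ^ 2 * frob (I.noiseCorr k) ^ 2) := by
  have hV := state_V_posDef hU k
  have hVc := fun x => (hUc x).trans (quad_U_le_quad_state_V k x)
  have hdet := (Matrix.isUnit_iff_isUnit_det _).1 hV.isUnit
  have : estimate (I.state k) - I.θstar =
      (I.state k).V⁻¹ * (I.U * (I.θhat - I.θstar)) + (I.state k).V⁻¹ * I.noiseCorr k := by
    rw [estimate, state_b, Matrix.mul_add, ← Matrix.mul_assoc,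
      Matrix.nonsing_inv_mul _ hdet, Matrix.one_mul, Matrix.mul_add]
    abel
  rw [this]
  refine (frob_add_sq_le _ _).trans ?_
  gcongr
  · exact frob_inv_mul_mul_sq_le hc hV hVc hU.posSemidef (quad_U_le_quad_state_V k) _
  · exact frob_inv_mul_sq_le hc hV hVc _

/-- Matrix determinant lemma at each step, with `1 + x ≤ exp x` and `V⁻¹ ≤ c⁻¹`. -/
lemma det_state_V_le (hc : 0 < c) (hU : I.U.PosDef)
    (hUc : ∀ x : Fin n ⊕ Fin m → ℝ, c * euc x ^ 2 ≤ x ⬝ᵥ (I.U *ᵥ x)) (k : ℕ) :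
    I.U.det ≤ (I.state k).V.det ∧ (I.state k).V.det ≤
      I.U.det * Real.exp (c⁻¹ * ∑ i ∈ Finset.range k, euc (I.pair i) ^ 2) := by
  induction k with
  | zero => simp [show (I.state 0).V = I.U from rfl]
  | succ k ih =>
    have hV := state_V_posDef hU k
    have hVc := fun x => (hUc x).trans (quad_U_le_quad_state_V k x)
    rw [state_succ_V, det_add_vecMulVec_self hV]
    have h0 := hV.inv.posSemidef.quad_nonneg (I.pair k)
    have h1 : I.pair k ⬝ᵥ ((I.state k).V⁻¹ *ᵥ I.pair k) ≤ c⁻¹ * euc (I.pair k) ^ 2 := by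
      refine (dotProduct_le_euc _ _).trans ?_
      have := mul_le_mul_of_nonneg_left (euc_inv_mulVec_le hc hV hVc (I.pair k))
        (euc_nonneg (I.pair k))
      linarith
    have h2 := Real.add_one_le_exp (c⁻¹ * euc (I.pair k) ^ 2)
    have hdet := hV.det_pos
    refine ⟨by nlinarith [ih.1], ?_⟩
    rw [Finset.sum_range_succ, mul_add c⁻¹, Real.exp_add, ← mul_assoc]
    exact mul_le_mul ih.2 (by linarith) (by linarith)
      (mul_nonneg hU.det_pos.le (Real.exp_pos _).le)

/-- Positivity gives the proposals full support; it needs `0 < n` because of the factor `n` in front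
of the root. The bound for the square comes from the growth of the determinant. -/
lemma betaWidth_state (hc : 0 < c) (hU : I.U.PosDef)
    (hUc : ∀ x : Fin n ⊕ Fin m → ℝ, c * euc x ^ 2 ≤ x ⬝ᵥ (I.U *ᵥ x)) (hα : 0 ≤ I.α)
    (hδ : 0 < I.δ₂) (hδ1 : I.δ₂ < 1) (hM : I.Mδ = 0) (k : ℕ) :
    (0 < n → 0 < betaWidth I.U (I.state k).V I.α I.δ₂ I.Mδ) ∧
      betaWidth I.U (I.state k).V I.α I.δ₂ I.Mδ ^ 2 ≤
        2 * n ^ 2 * (c⁻¹ * ∑ i ∈ Finset.range k, euc (I.pair i) ^ 2)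
          + 4 * n ^ 2 * Real.log (1 / I.δ₂) + 2 * I.α ^ 2 := by
  obtain ⟨h1, h2⟩ := det_state_V_le hc hU hUc k
  set zsum := ∑ i ∈ Finset.range k, euc (I.pair i) ^ 2
  have hUd := hU.det_pos
  have hsU : 0 < Real.sqrt I.U.det := Real.sqrt_pos.2 hUd
  set q := Real.sqrt (I.state k).V.det / (Real.sqrt I.U.det * I.δ₂) with hq
  have hq1 : 1 / I.δ₂ ≤ q := by
    rw [hq, div_le_div_iff₀ hδ (by positivity)]
    have := Real.sqrt_le_sqrt h1
    nlinarith
  have hlogδ : 0 < Real.log (1 / I.δ₂) := Real.log_pos (by rw [lt_div_iff₀ hδ]; linarith)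
  have hlog1 : Real.log (1 / I.δ₂) ≤ Real.log q := Real.log_le_log (by positivity) hq1
  have hq2 : q ≤ Real.exp (c⁻¹ * zsum / 2) * (1 / I.δ₂) := by
    rw [hq, mul_one_div, div_le_div_iff₀ (by positivity) hδ]
    have h3 := Real.sqrt_le_sqrt h2
    rw [Real.sqrt_mul hUd.le, ← Real.exp_half] at h3
    have := mul_le_mul_of_nonneg_right h3 hδ.le
    linarith
  have hlog2 : Real.log q ≤ c⁻¹ * zsum / 2 + Real.log (1 / I.δ₂) := by
    refine (Real.log_le_log (lt_of_lt_of_le (by positivity) hq1) hq2).trans_eq ?_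
    rw [Real.log_mul (Real.exp_pos _).ne' (by positivity), Real.log_exp]
  have hb : betaWidth I.U (I.state k).V I.α I.δ₂ I.Mδ = n * Real.sqrt (2 * Real.log q) + I.α := by
    rw [betaWidth, hM, mul_zero, add_zero]
  have hs : Real.sqrt (2 * Real.log q) ^ 2 = 2 * Real.log q := Real.sq_sqrt (by linarith)
  have hs0 : 0 < Real.sqrt (2 * Real.log q) := Real.sqrt_pos.2 (by linarith)
  rw [hb]
  constructor
  · intro hn
    have : (0 : ℝ) < n := by exact_mod_cast hn
    positivity
  · have h5 := sq_nonneg (n * Real.sqrt (2 * Real.log q) - I.α)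
    have h6 : (n * Real.sqrt (2 * Real.log q)) ^ 2 = n ^ 2 * (2 * Real.log q) := by
      rw [mul_pow, hs]
    have h7 := mul_le_mul_of_nonneg_left hlog2 (sq_nonneg (n : ℝ))
    nlinarith

lemma frob_candidate_sub_sq_le (hc : 0 < c) {s : OnlineState n m} (hV : s.V.PosDef)
    (hVc : ∀ x : Fin n ⊕ Fin m → ℝ, c * euc x ^ 2 ≤ x ⬝ᵥ (s.V *ᵥ x)) (k j : ℕ) :
    frob (I.candidate k s j - I.θstar) ^ 2 ≤
      2 * frob (estimate s - I.θstar) ^ 2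
        + 2 * betaWidth I.U s.V I.α I.δ₂ I.Mδ ^ 2 * (c⁻¹ * frob (I.η k j) ^ 2) := by
  have : I.candidate k s j - I.θstar = (estimate s - I.θstar)
      + betaWidth I.U s.V I.α I.δ₂ I.Mδ • ((CFC.sqrt s.V)⁻¹ * I.η k j) := by
    rw [candidate]; abel
  rw [this]
  refine (frob_add_sq_le _ _).trans ?_
  rw [frob_smul_sq, mul_assoc]
  gcongr
  exact frob_sqrt_inv_mul_sq_le hc hV hVc _

end RunInput

end Estimate

/-! ### Gaussian noise -/

section Noise

open scoped ENNReal

/-- Freezing lemma: by Fubini, an independent variable may be averaged with the other one held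
fixed. This replaces conditional expectations within the run. -/
lemma lintegral_comp_prod_of_indepFun {Ω α β : Type*} [MeasurableSpace Ω] [MeasurableSpace α]
    [MeasurableSpace β] {P : Measure Ω} [IsProbabilityMeasure P] {f : Ω → α} {h : Ω → β}
    (hf : Measurable f) (hh : Measurable h) (hind : IndepFun f h P) {φ : α × β → ℝ≥0∞}
    (hφ : Measurable φ) :
    ∫⁻ ω, φ (f ω, h ω) ∂P = ∫⁻ ω, ∫⁻ ω', φ (f ω, h ω') ∂P ∂P := by
  have h1 := (indepFun_iff_map_prod_eq_prod_map_map hf.aemeasurable hh.aemeasurable).1 hind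
  have : IsProbabilityMeasure (P.map h) := Measure.isProbabilityMeasure_map hh.aemeasurable
  rw [← lintegral_map hφ (hf.prodMk hh), h1, lintegral_prod _ hφ.aemeasurable,
    lintegral_map hφ.lintegral_prod_right' hf]
  refine lintegral_congr fun ω => ?_
  exact lintegral_map (f := fun y => φ (f ω, y)) (hφ.comp measurable_prodMk_left) hh

variable {n m : ℕ} {Ω : Type*}

/-- The index set of the scalar noise variables of the online run. -/
abbrev NoiseIndex (n m : ℕ) := (ℕ × Fin n) ⊕ (ℕ × ℕ × (Fin n ⊕ Fin m) × Fin n)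

/-- The system noise of the step `k`. -/
def noiseW (g : NoiseIndex n m → Ω → ℝ) (k : ℕ) (ω : Ω) : Fin n → ℝ := fun i => g (.inl (k, i)) ω

/-- The Gaussian matrix of the `j`-th proposal of the step `k`. -/
def noiseEta (g : NoiseIndex n m → Ω → ℝ) (k j : ℕ) (ω : Ω) : Param n m :=
  fun a i => g (.inr (k, j, a, i)) ω

/-- The σ-algebra generated by the noise variables with index in `A`. -/
abbrev noiseSigma (g : NoiseIndex n m → Ω → ℝ) (A : Set (NoiseIndex n m)) : MeasurableSpace Ω :=
  ⨆ c ∈ A, MeasurableSpace.comap (g c) inferInstance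

variable {g : NoiseIndex n m → Ω → ℝ}

lemma measurable_noiseSigma {A : Set (NoiseIndex n m)} {c : NoiseIndex n m} (hc : c ∈ A) :
    Measurable[noiseSigma g A] (g c) :=
  (comap_measurable (g c)).mono (le_iSup₂_of_le c hc le_rfl) le_rfl

lemma measurable_noiseW_sigma {A : Set (NoiseIndex n m)} {k : ℕ}
    (hA : ∀ i, (.inl (k, i) : NoiseIndex n m) ∈ A) : Measurable[noiseSigma g A] (noiseW g k) :=
  @measurable_pi_lambda _ _ _ (noiseSigma g A) _ _ fun i => measurable_noiseSigma (hA i)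

lemma measurable_noiseEta_sigma {A : Set (NoiseIndex n m)} {k j : ℕ}
    (hA : ∀ a i, (.inr (k, j, a, i) : NoiseIndex n m) ∈ A) :
    Measurable[noiseSigma g A] (noiseEta g k j) :=
  (@measurable_matrix_iff _ (noiseSigma g A) _ _ _).2 fun a i => measurable_noiseSigma (hA a i)

variable [mΩ : MeasurableSpace Ω] {P : Measure Ω}

/-- A family of independent standard normal variables. -/
structure IsStdNoise (g : NoiseIndex n m → Ω → ℝ) (P : Measure Ω) : Prop where
  meas : ∀ c, Measurable (g c)
  law : ∀ c, P.map (g c) = gaussianReal 0 1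
  indep : iIndepFun g P

namespace IsStdNoise

lemma indepFun (hg : IsStdNoise g P) {A B : Set (NoiseIndex n m)} (hAB : Disjoint A B)
    {α β : Type*} [MeasurableSpace α] [MeasurableSpace β] {f : Ω → α} {h : Ω → β}
    (hf : Measurable[noiseSigma g A] f) (hh : Measurable[noiseSigma g B] h) : IndepFun f h P := by
  have h1 : Indep (noiseSigma g A) (noiseSigma g B) P :=
    indep_iSup_of_disjoint (fun c => (hg.meas c).comap_le) hg.indep.iIndep hAB
  rw [IndepFun_iff_Indep]
  exact indep_of_indep_of_le_left (indep_of_indep_of_le_right h1 hh.comap_le) hf.comap_le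

lemma measurable_noiseW (hg : IsStdNoise g P) (k : ℕ) : Measurable (noiseW g k) :=
  measurable_pi_lambda _ fun _ => hg.meas _

lemma measurable_noiseEta (hg : IsStdNoise g P) (k j : ℕ) : Measurable (noiseEta g k j) :=
  measurable_matrix_iff.2 fun _ _ => hg.meas _

lemma memLp (hg : IsStdNoise g P) (c : NoiseIndex n m) (p : ℝ≥0∞) (hp : p ≠ ∞) :
    MemLp (g c) p P := by
  have := memLp_id_gaussianReal' (μ := 0) (v := 1) p hp
  rw [← hg.law c] at this
  exact (memLp_map_measure_iff aestronglyMeasurable_id (hg.meas c).aemeasurable).1 this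

lemma integral_comp (hg : IsStdNoise g P) (c : NoiseIndex n m) {φ : ℝ → ℝ} (hφ : Measurable φ) :
    ∫ ω, φ (g c ω) ∂P = ∫ x, φ x ∂(gaussianReal 0 1) := by
  rw [← hg.law c, integral_map (hg.meas c).aemeasurable hφ.aestronglyMeasurable]

lemma integral_eq_zero (hg : IsStdNoise g P) (c : NoiseIndex n m) : ∫ ω, g c ω ∂P = 0 := by
  rw [hg.integral_comp c (φ := fun x => x) measurable_id, integral_id_gaussianReal]

lemma integral_sq (hg : IsStdNoise g P) (c : NoiseIndex n m) : ∫ ω, g c ω ^ 2 ∂P = 1 := by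
  rw [hg.integral_comp c (φ := fun x => x ^ 2) (measurable_id.pow_const 2)]
  have h1 := variance_fun_id_gaussianReal (μ := 0) (v := 1)
  rw [variance_of_integral_eq_zero (X := fun x => x) measurable_id.aemeasurable
    integral_id_gaussianReal] at h1
  simpa using h1

lemma integrable (hg : IsStdNoise g P) [IsProbabilityMeasure P] (c : NoiseIndex n m) :
    Integrable (g c) P := (hg.memLp c 2 (by simp)).integrable (by norm_num)

lemma integrable_mul (hg : IsStdNoise g P) (c c' : NoiseIndex n m) :
    Integrable (fun ω => g c ω * g c' ω) P :=
  (hg.memLp c 2 (by simp)).integrable_mul (hg.memLp c' 2 (by simp))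

lemma integral_mul (hg : IsStdNoise g P) [IsProbabilityMeasure P] (c c' : NoiseIndex n m) :
    ∫ ω, g c ω * g c' ω ∂P = if c = c' then 1 else 0 := by
  split_ifs with h
  · subst h
    simp only [← pow_two]
    exact hg.integral_sq c
  · rw [(hg.indep.indepFun h).integral_fun_mul_eq_mul_integral
      (hg.meas c).aestronglyMeasurable (hg.meas c').aestronglyMeasurable, hg.integral_eq_zero,
      zero_mul]

lemma integral_add_mul_add (hg : IsStdNoise g P) [IsProbabilityMeasure P] (c c' : NoiseIndex n m)
    (a b s t : ℝ) : Integrable (fun ω => (a + s * g c ω) * (b + t * g c' ω)) P ∧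
      ∫ ω, (a + s * g c ω) * (b + t * g c' ω) ∂P = a * b + s * t * if c = c' then 1 else 0 := by
  have h1 := hg.integrable c
  have h2 := hg.integrable c'
  have h3 := hg.integrable_mul c c'
  have h : (fun ω => (a + s * g c ω) * (b + t * g c' ω)) =
      fun ω => ((a * b + a * t * g c' ω) + b * s * g c ω) + s * t * (g c ω * g c' ω) := by
    ext ω; ring
  have i1 : Integrable (fun ω => a * b + a * t * g c' ω) P :=
    (integrable_const (μ := P) (a * b)).add (h2.const_mul (a * t))
  have i2 : Integrable (fun ω => a * b + a * t * g c' ω + b * s * g c ω) P :=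
    i1.add (h1.const_mul (b * s))
  rw [h]
  refine ⟨i2.add (h3.const_mul (s * t)), ?_⟩
  rw [integral_add i2 (h3.const_mul _), integral_add i1 (h1.const_mul _),
    integral_add (integrable_const _) (h2.const_mul _)]
  simp only [integral_const_mul, hg.integral_eq_zero, hg.integral_mul]
  simp

/-- The expectation of a quadratic form of a shifted noise vector. -/
lemma lintegral_quad_add_noiseW (hg : IsStdNoise g P) [IsProbabilityMeasure P] (k : ℕ)
    {M : Matrix (Fin n) (Fin n) ℝ} (hM : M.PosSemidef) (y : Fin n → ℝ) :
    ∫⁻ ω, ENNReal.ofReal ((y + noiseW g k ω) ⬝ᵥ (M *ᵥ (y + noiseW g k ω))) ∂P =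
      ENNReal.ofReal (y ⬝ᵥ (M *ᵥ y) + M.trace) := by
  have hexp : ∀ v : Fin n → ℝ, v ⬝ᵥ (M *ᵥ v) = ∑ i, ∑ j, M i j * (v i * v j) := fun v => by
    simp only [dotProduct, Matrix.mulVec, Finset.mul_sum]
    exact Finset.sum_congr rfl fun i _ => Finset.sum_congr rfl fun j _ => by ring
  have hij := fun i j : Fin n =>
    hg.integral_add_mul_add (.inl (k, i)) (.inl (k, j)) (y i) (y j) 1 1
  have hfun : (fun ω => (y + noiseW g k ω) ⬝ᵥ (M *ᵥ (y + noiseW g k ω))) = fun ω =>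
      ∑ i, ∑ j, M i j * ((y i + 1 * g (.inl (k, i)) ω) * (y j + 1 * g (.inl (k, j)) ω)) := by
    ext ω
    rw [hexp]
    simp [noiseW]
  have hint1 : ∀ i j, Integrable (fun ω =>
      M i j * ((y i + 1 * g (.inl (k, i)) ω) * (y j + 1 * g (.inl (k, j)) ω))) P :=
    fun i j => (hij i j).1.const_mul _
  rw [← ofReal_integral_eq_lintegral_ofReal]
  · congr 1
    rw [hfun, integral_finsetSum _ fun i _ => integrable_finsetSum _ fun j _ => hint1 i j]
    rw [hexp y, Matrix.trace, ← Finset.sum_add_distrib]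
    refine Finset.sum_congr rfl fun i _ => ?_
    rw [integral_finsetSum _ fun j _ => hint1 i j]
    simp_rw [integral_const_mul, (hij i _).2, mul_add, Finset.sum_add_distrib]
    simp
  · rw [hfun]
    exact integrable_finsetSum _ fun i _ => integrable_finsetSum _ fun j _ => hint1 i j
  · exact Filter.Eventually.of_forall fun ω => hM.quad_nonneg _

/-- The noise is centred, so the cross terms vanish. -/
lemma lintegral_frob_add_vecMulVec_noiseW (hg : IsStdNoise g P) [IsProbabilityMeasure P] (k : ℕ)
    (G : Param n m) (z : Fin n ⊕ Fin m → ℝ) :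
    ∫⁻ ω, ENNReal.ofReal (frob (G + Matrix.vecMulVec z (noiseW g k ω)) ^ 2) ∂P =
      ENNReal.ofReal (frob G ^ 2 + n * euc z ^ 2) := by
  have hij := fun (a : Fin n ⊕ Fin m) (i : Fin n) =>
    hg.integral_add_mul_add (.inl (k, i)) (.inl (k, i)) (G a i) (G a i) (z a) (z a)
  have hfun : (fun ω => frob (G + Matrix.vecMulVec z (noiseW g k ω)) ^ 2) = fun ω =>
      ∑ a, ∑ i, (G a i + z a * g (.inl (k, i)) ω) * (G a i + z a * g (.inl (k, i)) ω) := by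
    ext ω
    rw [frob_sq]
    simp [noiseW, Matrix.vecMulVec_apply, pow_two]
  rw [← ofReal_integral_eq_lintegral_ofReal]
  · congr 1
    rw [hfun, integral_finsetSum _ fun a _ => integrable_finsetSum _ fun i _ => (hij a i).1,
      frob_sq, euc_sq_sum, Finset.mul_sum, ← Finset.sum_add_distrib]
    refine Finset.sum_congr rfl fun a _ => ?_
    rw [integral_finsetSum _ fun i _ => (hij a i).1]
    simp_rw [(hij a _).2, Finset.sum_add_distrib, ← pow_two]
    simp
  · rw [hfun]
    exact integrable_finsetSum _ fun a _ => integrable_finsetSum _ fun i _ => (hij a i).1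
  · exact Filter.Eventually.of_forall fun ω => sq_nonneg _

lemma lintegral_euc_noiseW_sq (hg : IsStdNoise g P) [IsProbabilityMeasure P] (k : ℕ) :
    ∫⁻ ω, ENNReal.ofReal (euc (noiseW g k ω) ^ 2) ∂P = ENNReal.ofReal n := by
  have := hg.lintegral_quad_add_noiseW k Matrix.PosSemidef.one 0
  simpa [euc_sq] using this

lemma lintegral_frob_noiseEta_sq (hg : IsStdNoise g P) [IsProbabilityMeasure P] (k j : ℕ) :
    ∫⁻ ω, ENNReal.ofReal (frob (noiseEta g k j ω) ^ 2) ∂P = ENNReal.ofReal ((n + m) * n) := by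
  have hi : ∀ (a : Fin n ⊕ Fin m) (i : Fin n),
      Integrable (fun ω => g (.inr (k, j, a, i)) ω ^ 2) P := fun a i => by
    simp only [pow_two]; exact hg.integrable_mul _ _
  have hfun : (fun ω => frob (noiseEta g k j ω) ^ 2) = fun ω =>
      ∑ a, ∑ i, g (.inr (k, j, a, i)) ω ^ 2 := by
    ext ω; rw [frob_sq]; rfl
  rw [← ofReal_integral_eq_lintegral_ofReal]
  · congr 1
    rw [hfun, integral_finsetSum _ fun a _ => integrable_finsetSum _ fun i _ => hi a i]
    simp only [integral_finsetSum _ fun i _ => hi _ i, hg.integral_sq]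
    simp
  · rw [hfun]
    exact integrable_finsetSum _ fun a _ => integrable_finsetSum _ fun i _ => hi a i
  · exact Filter.Eventually.of_forall fun ω => sq_nonneg _

/-- The fourth moment of the standard normal distribution. -/
noncomputable def _root_.gaussFourth : ℝ := ∫ x, x ^ 4 ∂(gaussianReal 0 1)

lemma _root_.gaussFourth_nonneg : 0 ≤ gaussFourth :=
  integral_nonneg fun x => by positivity

lemma integrable_euc_noiseW_pow_four (hg : IsStdNoise g P) [IsProbabilityMeasure P] (k : ℕ) :
    Integrable (fun ω => n * ∑ i, noiseW g k ω i ^ 4) P := by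
  refine (integrable_finsetSum _ fun i _ => ?_).const_mul _
  have := (hg.memLp (.inl (k, i)) 4 (by simp)).integrable_norm_pow (by norm_num)
  refine this.congr (Filter.Eventually.of_forall fun ω => ?_)
  simp [noiseW, Even.pow_abs (by decide : Even 4)]

lemma lintegral_euc_noiseW_pow_four_le (hg : IsStdNoise g P) [IsProbabilityMeasure P] (k : ℕ) :
    ∫⁻ ω, ENNReal.ofReal (euc (noiseW g k ω) ^ 4) ∂P ≤ ENNReal.ofReal (n ^ 2 * gaussFourth) := by
  have hle : ∀ ω, euc (noiseW g k ω) ^ 4 ≤ n * ∑ i, noiseW g k ω i ^ 4 := fun ω => by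
    have h1 : euc (noiseW g k ω) ^ 4 = (∑ i, noiseW g k ω i ^ 2) ^ 2 := by
      rw [← euc_sq_sum]; ring
    have h2 := sq_sum_le_card_mul_sum_sq (s := Finset.univ) (f := fun i => noiseW g k ω i ^ 2)
    simp only [Finset.card_univ, Fintype.card_fin, ← pow_mul] at h2
    rw [h1]; exact h2
  refine (lintegral_mono fun ω => ENNReal.ofReal_le_ofReal (hle ω)).trans ?_
  rw [← ofReal_integral_eq_lintegral_ofReal (hg.integrable_euc_noiseW_pow_four k)
    (Filter.Eventually.of_forall fun ω => by positivity)]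
  refine ENNReal.ofReal_le_ofReal (le_of_eq ?_)
  have hi : ∀ i, Integrable (fun ω => noiseW g k ω i ^ 4) P := fun i => by
    have := (hg.memLp (.inl (k, i)) 4 (by simp)).integrable_norm_pow (by norm_num)
    refine this.congr (Filter.Eventually.of_forall fun ω => ?_)
    simp [noiseW, Even.pow_abs (by decide : Even 4)]
  rw [integral_const_mul, integral_finsetSum _ fun i _ => hi i]
  have : ∀ i, ∫ ω, noiseW g k ω i ^ 4 ∂P = gaussFourth := fun i =>
    hg.integral_comp (.inl (k, i)) (φ := fun x => x ^ 4) (measurable_id.pow_const 4)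
  simp only [this]
  simp
  ring

/-- The Gaussian matrices charge every nonempty open set. -/
lemma measure_noiseEta_pos (hg : IsStdNoise g P) [IsProbabilityMeasure P] (k j : ℕ)
    {O : Set (Param n m)} (hO : IsOpen O) (hne : O.Nonempty) :
    0 < P (noiseEta g k j ⁻¹' O) := by
  let e : (Fin n ⊕ Fin m) × Fin n → NoiseIndex n m := fun p => .inr (k, j, p.1, p.2)
  have he : Function.Injective e := by
    rintro ⟨a, i⟩ ⟨a', i'⟩ h
    simpa [e] using h
  have h1 := (hg.indep.precomp he).map_fun_eq_pi_map fun p => (hg.meas (e p)).aemeasurable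
  have h2 : ∀ p, P.map (g (e p)) = gaussianReal 0 1 := fun p => hg.law _
  simp only [h2] at h1
  have : (gaussianReal 0 1).IsOpenPosMeasure :=
    (gaussianReal_absolutelyContinuous' 0 one_ne_zero).isOpenPosMeasure
  let c : ((Fin n ⊕ Fin m) × Fin n → ℝ) → Param n m := fun f a i => f (a, i)
  have hc : Continuous c := continuous_pi fun a => continuous_pi fun i => continuous_apply _
  have hO' : IsOpen (c ⁻¹' O) := hO.preimage hc
  have hne' : (c ⁻¹' O).Nonempty := by
    obtain ⟨M, hM⟩ := hne
    exact ⟨fun p => M p.1 p.2, hM⟩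
  have h3 := hO'.measure_pos (Measure.pi fun _ : (Fin n ⊕ Fin m) × Fin n => gaussianReal 0 1) hne'
  rw [← h1, Measure.map_apply (measurable_pi_lambda _ fun p => hg.meas _) hO'.measurableSet] at h3
  exact h3

end IsStdNoise

end Noise

/-! ### Rejection sampling -/

section Rejection

open scoped ENNReal

variable {n m : ℕ} {Ω : Type*} [MeasurableSpace Ω] {c : ℕ → Ω → Param n m}
  {Q : Set (Param n m)}

lemma measurableSet_rejected (hc : ∀ j, Measurable (c j)) (hQ : MeasurableSet Q) (j : ℕ) :
    MeasurableSet {ω | ∀ i < j, c i ω ∉ Q} := by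
  have : {ω | ∀ i < j, c i ω ∉ Q} = ⋂ i, ⋂ (_ : i < j), (c i ⁻¹' Q)ᶜ := by
    ext ω; simp
  rw [this]
  exact MeasurableSet.iInter fun i => MeasurableSet.iInter fun _ => (hc i hQ).compl

variable {P : Measure Ω} [IsProbabilityMeasure P]

/-- The first `j` rejections are independent of the `j`-th proposal, and each has the same
probability. -/
lemma lintegral_rejected_mul (hc : ∀ j, Measurable (c j))
    (hind : ∀ j, IndepFun (fun ω (i : Fin j) => c i ω) (c j) P)
    (hid : ∀ j, P.map (c j) = P.map (c 0)) (hQ : MeasurableSet Q) (j : ℕ)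
    {φ : Param n m → ℝ≥0∞} (hφ : Measurable φ) :
    ∫⁻ ω, {ω | ∀ i < j, c i ω ∉ Q}.indicator 1 ω * φ (c j ω) ∂P =
      P {ω | c 0 ω ∉ Q} ^ j * ∫⁻ ω, φ (c 0 ω) ∂P := by
  have hmeas := measurableSet_rejected hc hQ
  have hlaw : ∀ j (φ : Param n m → ℝ≥0∞), Measurable φ →
      ∫⁻ ω, φ (c j ω) ∂P = ∫⁻ ω, φ (c 0 ω) ∂P := fun j φ hφ => by
    rw [← lintegral_map hφ (hc j), hid j, lintegral_map hφ (hc 0)]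
  have hfac : ∀ j (φ : Param n m → ℝ≥0∞), Measurable φ →
      ∫⁻ ω, {ω | ∀ i < j, c i ω ∉ Q}.indicator 1 ω * φ (c j ω) ∂P =
        P {ω | ∀ i < j, c i ω ∉ Q} * ∫⁻ ω, φ (c 0 ω) ∂P := fun j φ hφ => by
    have hA : MeasurableSet {f : Fin j → Param n m | ∀ i, f i ∉ Q} := by
      have : {f : Fin j → Param n m | ∀ i, f i ∉ Q} = ⋂ i, ((fun f => f i) ⁻¹' Q)ᶜ := by
        ext f; simp
      rw [this]
      exact MeasurableSet.iInter fun i => (measurable_pi_apply i hQ).compl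
    have hψ : Measurable ({f : Fin j → Param n m | ∀ i, f i ∉ Q}.indicator
      (1 : (Fin j → Param n m) → ℝ≥0∞)) :=
      measurable_one.indicator hA
    have h1 := lintegral_mul_eq_lintegral_mul_lintegral_of_indepFun
      (hψ.comp (measurable_pi_lambda _ fun i : Fin j => hc i)) (hφ.comp (hc j))
      ((hind j).comp hψ hφ)
    have heq : ({f : Fin j → Param n m | ∀ i, f i ∉ Q}.indicator
      (1 : (Fin j → Param n m) → ℝ≥0∞)) ∘
        (fun ω (i : Fin j) => c i ω) = {ω | ∀ i < j, c i ω ∉ Q}.indicator 1 := by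
      ext ω
      have : (∀ i : Fin j, c i ω ∉ Q) ↔ ∀ i < j, c i ω ∉ Q :=
        ⟨fun h i hi => h ⟨i, hi⟩, fun h i => h i i.2⟩
      classical
      rw [Function.comp_apply, Set.indicator_apply, Set.indicator_apply]
      exact if_congr this rfl rfl
    rw [heq] at h1
    simp only [Pi.mul_apply, Function.comp_apply] at h1
    rw [h1, lintegral_indicator_one (hmeas j), hlaw j φ hφ]
  have hpow : ∀ j, P {ω | ∀ i < j, c i ω ∉ Q} = P {ω | c 0 ω ∉ Q} ^ j := by
    intro j
    induction j with
    | zero => simp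
    | succ j ih =>
      -- The factorization with the indicator of rejection as test function yields the geometric law
      -- by induction.
      have h1 := hfac j (Qᶜ.indicator 1) (measurable_one.indicator hQ.compl)
      have h2 : ∀ ω, {ω | ∀ i < j, c i ω ∉ Q}.indicator (1 : Ω → ℝ≥0∞) ω
          * (Qᶜ.indicator (1 : Param n m → ℝ≥0∞)) (c j ω)
          = {ω | ∀ i < j + 1, c i ω ∉ Q}.indicator 1 ω := fun ω => by
        have : (∀ i < j + 1, c i ω ∉ Q) ↔ (∀ i < j, c i ω ∉ Q) ∧ c j ω ∉ Q :=
          Nat.forall_lt_succ_right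
        classical
        rw [Set.indicator_apply, Set.indicator_apply, Set.indicator_apply,
          if_congr (show ω ∈ {ω | ∀ i < j + 1, c i ω ∉ Q} ↔ _ from this) rfl rfl, ite_and]
        simp only [Set.mem_ofPred_eq, Set.mem_compl_iff, Pi.one_apply, ite_mul, one_mul, zero_mul]
      have h5 : ∀ ω, (Qᶜ.indicator (1 : Param n m → ℝ≥0∞)) (c 0 ω) = {ω | c 0 ω ∉ Q}.indicator 1 ω :=
        fun ω => rfl
      simp only [h2, h5] at h1
      rw [lintegral_indicator_one (hmeas _), ih,
        lintegral_indicator_one (show MeasurableSet {ω | c 0 ω ∉ Q} from (hc 0 hQ).compl)] at h1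
      rw [h1, pow_succ]
  rw [hfac j φ hφ, hpow]

/-- The probability of no acceptance is at most the `j`-th power of a number below `1`, for every
`j`. -/
lemma ae_exists_accepted (hc : ∀ j, Measurable (c j))
    (hind : ∀ j, IndepFun (fun ω (i : Fin j) => c i ω) (c j) P)
    (hid : ∀ j, P.map (c j) = P.map (c 0)) (hQ : MeasurableSet Q)
    (hp : 0 < P {ω | c 0 ω ∈ Q}) : ∀ᵐ ω ∂P, ∃ j, c j ω ∈ Q := by
  have hq : P {ω | c 0 ω ∉ Q} < 1 := by
    have h : P {ω | c 0 ω ∉ Q} = 1 - P {ω | c 0 ω ∈ Q} :=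
      prob_compl_eq_one_sub (s := {ω | c 0 ω ∈ Q}) (hc 0 hQ)
    rw [h]
    exact ENNReal.sub_lt_self ENNReal.one_ne_top one_ne_zero hp.ne'
  have hle : ∀ j, P {ω | ¬ ∃ j, c j ω ∈ Q} ≤ P {ω | c 0 ω ∉ Q} ^ j := fun j => by
    have h1 := lintegral_rejected_mul hc hind hid hQ j (φ := 1) measurable_one
    simp only [Pi.one_apply, mul_one, lintegral_one, measure_univ] at h1
    rw [← h1, lintegral_indicator_one (measurableSet_rejected hc hQ j)]
    exact measure_mono fun ω hω i _ hi => hω ⟨i, hi⟩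
  rw [ae_iff]
  exact le_antisymm (ge_of_tendsto' (ENNReal.tendsto_pow_atTop_nhds_zero_of_lt_one hq) hle)
    zero_le

/-- The law of the accepted proposal. -/
lemma lintegral_rejectionSample_le (hc : ∀ j, Measurable (c j))
    (hind : ∀ j, IndepFun (fun ω (i : Fin j) => c i ω) (c j) P)
    (hid : ∀ j, P.map (c j) = P.map (c 0)) (hQ : MeasurableSet Q)
    (hp : 0 < P {ω | c 0 ω ∈ Q}) {φ : Param n m → ℝ≥0∞} (hφ : Measurable φ) :
    ∫⁻ ω, φ (rejectionSample Q fun j => c j ω) ∂P ≤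
      (P {ω | c 0 ω ∈ Q})⁻¹ * ∫⁻ ω, φ (c 0 ω) ∂P := by
  have hmeas := measurableSet_rejected hc hQ
  have h1 : ∀ᵐ ω ∂P, φ (rejectionSample Q fun j => c j ω) ≤
      ∑' j, {ω | ∀ i < j, c i ω ∉ Q}.indicator 1 ω * φ (c j ω) := by
    filter_upwards [ae_exists_accepted hc hind hid hQ hp] with ω h
    classical
    have h2 := Nat.find_spec h
    have h3 : ∀ i < Nat.find h, c i ω ∉ Q := fun i hi => Nat.find_min h hi
    rw [rejectionSample_eq (c := fun j => c j ω) h2 h3]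
    refine le_trans (le_of_eq ?_) (ENNReal.le_tsum (Nat.find h))
    rw [Set.indicator_of_mem (show ω ∈ {ω | ∀ i < Nat.find h, c i ω ∉ Q} from h3), Pi.one_apply,
      one_mul]
  refine (lintegral_mono_ae h1).trans ?_
  have hterm : ∀ j, Measurable fun ω => {ω | ∀ i < j, c i ω ∉ Q}.indicator 1 ω * φ (c j ω) :=
    fun j => (measurable_one.indicator (hmeas j)).mul (hφ.comp (hc j))
  rw [lintegral_tsum fun j => (hterm j).aemeasurable]
  simp only [lintegral_rejected_mul hc hind hid hQ _ hφ]
  -- The geometric series of the rejection probabilities sums to the inverse acceptance probability.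
  rw [ENNReal.tsum_mul_right, ENNReal.tsum_geometric]
  have : P {ω | c 0 ω ∉ Q} = 1 - P {ω | c 0 ω ∈ Q} :=
    prob_compl_eq_one_sub (s := {ω | c 0 ω ∈ Q}) (hc 0 hQ)
  rw [this, ENNReal.sub_sub_cancel ENNReal.one_ne_top prob_le_one]

/-- If `Q` contains a ball around `θstar`, then the accepted proposal is as close to `θstar`
as a single proposal. -/
lemma lintegral_min_rejectionSample_le (hc : ∀ j, Measurable (c j))
    (hind : ∀ j, IndepFun (fun ω (i : Fin j) => c i ω) (c j) P)
    (hid : ∀ j, P.map (c j) = P.map (c 0)) (hQ : MeasurableSet Q)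
    (hp : 0 < P {ω | c 0 ω ∈ Q}) {θstar : Param n m} {r C₁ C₂ : ℝ} (hr : 0 < r) (hC₁ : 0 ≤ C₁)
    (hC₂ : 0 ≤ C₂) (hball : ∀ θ, frob (θ - θstar) < r → θ ∈ Q) :
    ∫⁻ ω, ENNReal.ofReal (min C₁ (C₂ *
        frob ((rejectionSample Q fun j => c j ω) - θstar) ^ 2)) ∂P ≤
      ENNReal.ofReal (2 * C₂ + 2 * C₁ / r ^ 2) *
        ∫⁻ ω, ENNReal.ofReal (frob (c 0 ω - θstar) ^ 2) ∂P := by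
  have hfm : Measurable fun θ : Param n m => frob (θ - θstar) ^ 2 :=
    ((measurable_id.matrix_sub measurable_const).frob).pow_const 2
  have hfc : Measurable fun ω => ENNReal.ofReal (frob (c 0 ω - θstar) ^ 2) :=
    (hfm.comp (hc 0)).ennreal_ofReal
  set D := ∫⁻ ω, ENNReal.ofReal (frob (c 0 ω - θstar) ^ 2) ∂P with hD
  -- If acceptance has probability at least one half, conditioning on it costs a factor `2`.
  -- Otherwise a proposal leaves the ball of radius `r` with probability at least one half, so `D ≥
  -- r² / 2` by Markov and the truncation `C₁` is already below `2 C₁ / r² * D`. No lower bound for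
  -- the acceptance probability is needed.
  rcases le_total (2⁻¹ : ℝ≥0∞) (P {ω | c 0 ω ∈ Q}) with hcase | hcase
  · have h1 := lintegral_rejectionSample_le hc hind hid hQ hp
      (φ := fun θ => ENNReal.ofReal (min C₁ (C₂ * frob (θ - θstar) ^ 2)))
      ((measurable_const.min (hfm.const_mul C₂)).ennreal_ofReal)
    refine h1.trans ?_
    have h2 : ∫⁻ ω, ENNReal.ofReal (min C₁ (C₂ * frob (c 0 ω - θstar) ^ 2)) ∂P ≤
        ENNReal.ofReal C₂ * D := by
      rw [hD, ← lintegral_const_mul _ hfc]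
      refine lintegral_mono fun ω => ?_
      rw [← ENNReal.ofReal_mul hC₂]
      exact ENNReal.ofReal_le_ofReal (min_le_right _ _)
    have h3 : (P {ω | c 0 ω ∈ Q})⁻¹ ≤ 2 := by
      rw [ENNReal.inv_le_iff_inv_le]; exact hcase
    calc _ ≤ 2 * (ENNReal.ofReal C₂ * D) := mul_le_mul' h3 h2
      _ = ENNReal.ofReal (2 * C₂) * D := by
          rw [ENNReal.ofReal_mul (by norm_num), mul_assoc]; norm_num
      _ ≤ _ := by
          gcongr
          have : 0 ≤ 2 * C₁ / r ^ 2 := by positivity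
          linarith
  · have h1 : (2⁻¹ : ℝ≥0∞) ≤ P {ω | c 0 ω ∉ Q} := by
      have : P {ω | c 0 ω ∉ Q} = 1 - P {ω | c 0 ω ∈ Q} :=
        prob_compl_eq_one_sub (s := {ω | c 0 ω ∈ Q}) (hc 0 hQ)
      rw [this]
      refine le_trans ?_ (tsub_le_tsub_left hcase 1)
      rw [ENNReal.one_sub_inv_two]
    have h2 : ENNReal.ofReal (r ^ 2) * P {ω | c 0 ω ∉ Q} ≤ D := by
      refine le_trans ?_ (mul_meas_ge_le_lintegral hfc (ENNReal.ofReal (r ^ 2)))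
      refine mul_le_mul_right (measure_mono fun ω hω => ?_) _
      refine ENNReal.ofReal_le_ofReal (pow_le_pow_left₀ hr.le ?_ 2)
      by_contra! h
      exact hω (hball _ h)
    have h3 : ENNReal.ofReal C₁ ≤ ENNReal.ofReal (2 * C₁ / r ^ 2) * D := by
      calc ENNReal.ofReal C₁ = ENNReal.ofReal (2 * C₁ / r ^ 2) *
            (ENNReal.ofReal (r ^ 2) * ENNReal.ofReal 2⁻¹) := by
            rw [← ENNReal.ofReal_mul (by positivity), ← ENNReal.ofReal_mul (by positivity)]
            congr 1; field_simp
        _ ≤ _ := by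
            refine mul_le_mul_right (le_trans (mul_le_mul_right ?_ _) h2) _
            rwa [ENNReal.ofReal_inv_of_pos (by norm_num), ENNReal.ofReal_ofNat]
    calc _ ≤ ∫⁻ _ω, ENNReal.ofReal C₁ ∂P :=
          lintegral_mono fun ω => ENNReal.ofReal_le_ofReal (min_le_left _ _)
      _ = ENNReal.ofReal C₁ := by simp
      _ ≤ _ := h3
      _ ≤ _ := by gcongr; linarith

end Rejection

/-! ### The online run for fixed offline data -/

section OnlineRun

open scoped ENNReal

variable {n m : ℕ}

/-- The time step a noise variable belongs to. -/
def NoiseIndex.time : NoiseIndex n m → ℕ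
  | .inl (k, _) => k
  | .inr (k, _) => k

/-- The noise variables of the steps before `k`. -/
def pastIndex (n m k : ℕ) : Set (NoiseIndex n m) := {c | NoiseIndex.time c < k}

/-- The noise variables of the sampling at step `k`. -/
def etaIndex (n m k : ℕ) : Set (NoiseIndex n m) := {c | ∃ j a i, c = .inr (k, j, a, i)}

/-- The noise variables of the `j`-th proposal at step `k`. -/
def proposalIndex (n m k j : ℕ) : Set (NoiseIndex n m) := {c | ∃ a i, c = .inr (k, j, a, i)}

/-- The system noise variables of the step `k`. -/
def systemIndex (n m k : ℕ) : Set (NoiseIndex n m) := {c | ∃ i, c = .inl (k, i)}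

lemma disjoint_pastIndex_etaIndex (k : ℕ) : Disjoint (pastIndex n m k) (etaIndex n m k) := by
  rw [Set.disjoint_left]
  rintro c hc ⟨j, a, i, rfl⟩
  exact lt_irrefl k hc

lemma disjoint_pastIndex_union_systemIndex (k : ℕ) :
    Disjoint (pastIndex n m k ∪ etaIndex n m k) (systemIndex n m k) := by
  rw [Set.disjoint_left]
  rintro c (hc | ⟨j, a, i, rfl⟩) ⟨i', hi⟩
  · subst hi; exact lt_irrefl k hc
  · simp at hi

variable {Ω : Type*}

/-- The run for given offline data and noise. -/
def noisyRun (Qc : Matrix (Fin n) (Fin n) ℝ) (Rc : Matrix (Fin m) (Fin m) ℝ) (MP ρ δ₂ : ℝ)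
    (d : OfflineData n m) (g : NoiseIndex n m → Ω → ℝ) (ω : Ω) : RunInput n m :=
  runOf Qc Rc MP ρ δ₂ d (fun k => noiseW g k ω) (fun k j => noiseEta g k j ω)

variable {Qc : Matrix (Fin n) (Fin n) ℝ} {Rc : Matrix (Fin m) (Fin m) ℝ} {MP ρ δ₂ : ℝ}
  {d : OfflineData n m} {g : NoiseIndex n m → Ω → ℝ}

/-- The σ-algebra `m'` is free: the ambient one gives plain measurability, `noiseSigma g A` gives
adaptedness and thereby independence of the noise outside `A`. -/
lemma measurable_noisyRun_state (hQ : Qc.PosDef) (hR : Rc.PosDef) {m' : MeasurableSpace Ω}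
    {A : Set (NoiseIndex n m)} (hA : ∀ c ∈ A, Measurable (g c)) {k : ℕ}
    (hk : pastIndex n m k ⊆ A) :
    Measurable fun ω => (noisyRun Qc Rc MP ρ δ₂ d g ω).state k :=
  measurable_state (d := fun _ => d) hQ hR measurable_const k
    (fun _ hi => measurable_pi_lambda _ fun _ => hA _ (hk hi))
    (fun _ hi _ => measurable_matrix_iff.2 fun _ _ => hA _ (hk hi))

lemma measurable_noisyRun_sample (hQ : Qc.PosDef) (hR : Rc.PosDef) {m' : MeasurableSpace Ω}
    {A : Set (NoiseIndex n m)} (hA : ∀ c ∈ A, Measurable (g c)) {k : ℕ}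
    (hk : pastIndex n m k ∪ etaIndex n m k ⊆ A) :
    Measurable fun ω => (noisyRun Qc Rc MP ρ δ₂ d g ω).sample k
      ((noisyRun Qc Rc MP ρ δ₂ d g ω).state k) :=
  measurable_sample (d := fun _ => d) (w := noiseW g) hQ hR measurable_const
    (measurable_noisyRun_state hQ hR hA (Set.subset_union_left.trans hk))
    (fun j => measurable_matrix_iff.2 fun a i => hA _ (hk (Or.inr ⟨j, a, i, rfl⟩)))

lemma measurable_noisyRun_control (hQ : Qc.PosDef) (hR : Rc.PosDef) {m' : MeasurableSpace Ω}
    {A : Set (NoiseIndex n m)} (hA : ∀ c ∈ A, Measurable (g c)) {k : ℕ}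
    (hk : pastIndex n m k ∪ etaIndex n m k ⊆ A) :
    Measurable fun ω => (noisyRun Qc Rc MP ρ δ₂ d g ω).control k
      ((noisyRun Qc Rc MP ρ δ₂ d g ω).state k) :=
  ((measurable_optGain hQ hR).comp (measurable_noisyRun_sample hQ hR hA hk)).matrix_mulVec
    (OnlineState.measurable_x.comp
      (measurable_noisyRun_state hQ hR hA (Set.subset_union_left.trans hk)))

lemma measurable_noisyRun_pair (hQ : Qc.PosDef) (hR : Rc.PosDef) {m' : MeasurableSpace Ω}
    {A : Set (NoiseIndex n m)} (hA : ∀ c ∈ A, Measurable (g c)) {k : ℕ}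
    (hk : pastIndex n m k ∪ etaIndex n m k ⊆ A) :
    Measurable fun ω => (noisyRun Qc Rc MP ρ δ₂ d g ω).pair k :=
  (OnlineState.measurable_x.comp (measurable_noisyRun_state hQ hR hA
    (Set.subset_union_left.trans hk))).vec_sumElim (measurable_noisyRun_control hQ hR hA hk)

lemma pastIndex_union_etaIndex_subset {i k : ℕ} (h : i < k) :
    pastIndex n m i ∪ etaIndex n m i ⊆ pastIndex n m k := by
  rintro c (hc | ⟨j, a, b, rfl⟩)
  · exact lt_trans hc h
  · exact h

lemma measurable_noisyRun_noiseCorr (hQ : Qc.PosDef) (hR : Rc.PosDef) {m' : MeasurableSpace Ω}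
    {A : Set (NoiseIndex n m)} (hA : ∀ c ∈ A, Measurable (g c)) {k : ℕ}
    (hk : pastIndex n m k ⊆ A) :
    Measurable fun ω => (noisyRun Qc Rc MP ρ δ₂ d g ω).noiseCorr k := by
  refine measurable_matrix_iff.2 fun a b => ?_
  simp only [RunInput.noiseCorr, Matrix.sum_apply]
  refine Finset.measurable_sum _ fun i hi => ?_
  have hik := Finset.mem_range.1 hi
  have hw : Measurable fun ω => noiseW g i ω :=
    measurable_pi_lambda _ fun _ => hA _ (hk hik)
  exact ((measurable_noisyRun_pair hQ hR hA
    ((pastIndex_union_etaIndex_subset hik).trans hk)).vecMulVec hw).matrix_apply a b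

/-- The hypotheses on the constants, the offline data and the noise under which the online run is
analyzed. The bound `c` is a lower bound for the eigenvalues of `U`. -/
structure OnlineSetting (Qc : Matrix (Fin n) (Fin n) ℝ) (Rc : Matrix (Fin m) (Fin m) ℝ)
    (MP ρ δ₂ r c C₁ C₂ κ : ℝ) (d : OfflineData n m) (g : NoiseIndex n m → Ω → ℝ)
    [MeasurableSpace Ω] (P : Measure Ω) : Prop where
  hQ : Qc.PosDef
  hR : Rc.PosDef
  rho_lt : ρ < 1
  r_pos : 0 < r
  c_pos : 0 < c
  delta_pos : 0 < δ₂
  delta_lt : δ₂ < 1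
  n_pos : 0 < n
  C₁_nonneg : 0 ≤ C₁
  C₂_nonneg : 0 ≤ C₂
  kappa_nonneg : 0 ≤ κ
  gain : ∀ θstar θ : Param n m,
    θstar ∈ admissible Qc Rc MP ρ θstar → θ ∈ admissible Qc Rc MP ρ θstar →
    ∀ x : Fin n → ℝ, gainGap Qc Rc θstar θ x ≤ C₁ * euc x ^ 2 ∧
      gainGap Qc Rc θstar θ x ≤ C₂ * frob (θ - θstar) ^ 2 * euc x ^ 2 ∧
      euc (optGain Qc Rc θ *ᵥ x) ^ 2 ≤ κ * euc x ^ 2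
  U_posDef : d.2.1.PosDef
  U_ge : ∀ x : Fin n ⊕ Fin m → ℝ, c * euc x ^ 2 ≤ x ⬝ᵥ (d.2.1 *ᵥ x)
  alpha_nonneg : 0 ≤ d.2.2.2
  ball : ∀ θ : Param n m, frob (θ - d.1) < r → θ ∈ admissible Qc Rc MP ρ d.1
  noise : IsStdNoise g P

namespace OnlineSetting

variable [mΩ : MeasurableSpace Ω] {P : Measure Ω} {r c C₁ C₂ κ : ℝ}

local notation "run" => noisyRun Qc Rc MP ρ δ₂ d g

lemma star_mem (h : OnlineSetting Qc Rc MP ρ δ₂ r c C₁ C₂ κ d g P) :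
    d.1 ∈ admissible Qc Rc MP ρ d.1 :=
  h.ball _ (by simpa [frob] using h.r_pos)

lemma rho_nonneg (h : OnlineSetting Qc Rc MP ρ δ₂ r c C₁ C₂ κ d g P) : 0 ≤ ρ :=
  admissible.rho_nonneg h.star_mem

lemma measurable_state (h : OnlineSetting Qc Rc MP ρ δ₂ r c C₁ C₂ κ d g P) (k : ℕ) :
    Measurable fun ω => (run ω).state k :=
  measurable_noisyRun_state h.hQ h.hR (A := Set.univ) (fun c _ => h.noise.meas c)
    (Set.subset_univ _)

lemma measurable_x (h : OnlineSetting Qc Rc MP ρ δ₂ r c C₁ C₂ κ d g P) (k : ℕ) :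
    Measurable fun ω => ((run ω).state k).x := OnlineState.measurable_x.comp (h.measurable_state k)

lemma measurable_pair (h : OnlineSetting Qc Rc MP ρ δ₂ r c C₁ C₂ κ d g P) (k : ℕ) :
    Measurable fun ω => (run ω).pair k :=
  measurable_noisyRun_pair h.hQ h.hR (A := Set.univ) (fun c _ => h.noise.meas c)
    (Set.subset_univ _)

lemma measurable_control (h : OnlineSetting Qc Rc MP ρ δ₂ r c C₁ C₂ κ d g P) (k : ℕ) :
    Measurable fun ω => (run ω).control k ((run ω).state k) :=
  measurable_noisyRun_control h.hQ h.hR (A := Set.univ) (fun c _ => h.noise.meas c)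
    (Set.subset_univ _)

lemma measurable_sample (h : OnlineSetting Qc Rc MP ρ δ₂ r c C₁ C₂ κ d g P) (k : ℕ) :
    Measurable fun ω => (run ω).sample k ((run ω).state k) :=
  measurable_noisyRun_sample h.hQ h.hR (A := Set.univ) (fun c _ => h.noise.meas c)
    (Set.subset_univ _)

lemma measurable_noiseCorr (h : OnlineSetting Qc Rc MP ρ δ₂ r c C₁ C₂ κ d g P) (k : ℕ) :
    Measurable fun ω => (run ω).noiseCorr k :=
  measurable_noisyRun_noiseCorr h.hQ h.hR (A := Set.univ) (fun c _ => h.noise.meas c)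
    (Set.subset_univ _)

/-- The state and the sampled action are independent of the system noise of the same step. -/
lemma indepFun_noiseW (h : OnlineSetting Qc Rc MP ρ δ₂ r c C₁ C₂ κ d g P) (k : ℕ) :
    IndepFun (fun ω => (((run ω).state k).x, (run ω).control k ((run ω).state k),
      (run ω).noiseCorr k)) (noiseW g k) P := by
  have hA : ∀ c ∈ pastIndex n m k ∪ etaIndex n m k,
      Measurable[noiseSigma g (pastIndex n m k ∪ etaIndex n m k)] (g c) :=
    fun c hc => measurable_noiseSigma hc
  refine h.noise.indepFun (disjoint_pastIndex_union_systemIndex k) ?_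
    (measurable_noiseW_sigma fun i => ⟨i, rfl⟩)
  exact (OnlineState.measurable_x.comp (measurable_noisyRun_state h.hQ h.hR hA
    Set.subset_union_left)).prodMk ((measurable_noisyRun_control h.hQ h.hR hA subset_rfl).prodMk
      (measurable_noisyRun_noiseCorr h.hQ h.hR hA Set.subset_union_left))

lemma indepFun_eta (h : OnlineSetting Qc Rc MP ρ δ₂ r c C₁ C₂ κ d g P) (k : ℕ) :
    IndepFun (fun ω => (run ω).state k) (fun ω j => noiseEta g k j ω) P := by
  refine h.noise.indepFun (disjoint_pastIndex_etaIndex k) ?_ ?_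
  · exact measurable_noisyRun_state h.hQ h.hR (fun c hc => measurable_noiseSigma hc) subset_rfl
  · exact @measurable_pi_lambda _ _ _ (noiseSigma g (etaIndex n m k)) _ _ fun j =>
      measurable_noiseEta_sigma fun a i => ⟨j, a, i, rfl⟩

lemma V_posDef (h : OnlineSetting Qc Rc MP ρ δ₂ r c C₁ C₂ κ d g P) (k : ℕ) (ω : Ω) :
    ((run ω).state k).V.PosDef := RunInput.state_V_posDef h.U_posDef k

lemma V_ge (h : OnlineSetting Qc Rc MP ρ δ₂ r c C₁ C₂ κ d g P) (k : ℕ) (ω : Ω)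
    (x : Fin n ⊕ Fin m → ℝ) : c * euc x ^ 2 ≤ x ⬝ᵥ (((run ω).state k).V *ᵥ x) :=
  (h.U_ge x).trans (RunInput.quad_U_le_quad_state_V (I := run ω) k x)

/-- The width of the proposals at step `k`. -/
noncomputable def _root_.RunInput.width (I : RunInput n m) (k : ℕ) : ℝ :=
  betaWidth I.U (I.state k).V I.α I.δ₂ I.Mδ

lemma measurableSet_admissible (h : OnlineSetting Qc Rc MP ρ δ₂ r c C₁ C₂ κ d g P) :
    MeasurableSet (admissible Qc Rc MP ρ d.1) :=
  measurable_prodMk_left (_root_.measurableSet_admissible h.hQ h.hR MP ρ)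

lemma measurable_proposal (h : OnlineSetting Qc Rc MP ρ δ₂ r c C₁ C₂ κ d g P) (k : ℕ)
    (s : OnlineState n m) (j : ℕ) : Measurable fun ω' => (run ω').candidate k s j :=
  measurable_candidate (d := fun _ => d) (s := fun _ => s) (w := noiseW g) measurable_const
    measurable_const (h.noise.measurable_noiseEta k) j

/-- A proposal as a function of the Gaussian matrix. -/
noncomputable def proposalMap (δ₂ : ℝ) (d : OfflineData n m) (s : OnlineState n m)
    (H : Param n m) : Param n m :=
  RunInput.estimate s + betaWidth d.2.1 s.V d.2.2.2 δ₂ 0 • ((CFC.sqrt s.V)⁻¹ * H)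

lemma measurable_proposalMap (s : OnlineState n m) : Measurable (proposalMap δ₂ d s) :=
  measurable_const.matrix_add (measurable_const.matrix_smul
    (measurable_const.matrix_mul measurable_id))

lemma continuous_proposalMap (s : OnlineState n m) : Continuous (proposalMap δ₂ d s) := by
  unfold proposalMap
  fun_prop

/-- With the state `s` frozen, different proposals use disjoint blocks of Gaussian entries. For the
random state this holds only conditionally, hence the freezing. -/
lemma indepFun_proposal (h : OnlineSetting Qc Rc MP ρ δ₂ r c C₁ C₂ κ d g P) (k : ℕ)
    (s : OnlineState n m) (j : ℕ) :
    IndepFun (fun ω' (i : Fin j) => (run ω').candidate k s i)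
      (fun ω' => (run ω').candidate k s j) P := by
  have hdisj : Disjoint (⋃ i : Fin j, proposalIndex n m k i) (proposalIndex n m k j) := by
    rw [Set.disjoint_left]
    rintro c hc ⟨a', b', hc'⟩
    obtain ⟨i, a, b, hi⟩ := Set.mem_iUnion.1 hc
    rw [hi] at hc'
    simp only [Sum.inr.injEq, Prod.mk.injEq] at hc'
    exact absurd hc'.2.1 i.2.ne
  refine h.noise.indepFun hdisj ?_ ?_
  · refine @measurable_pi_lambda _ _ _ (noiseSigma g _) _ _ fun i => ?_
    exact (measurable_proposalMap s).comp
      (measurable_noiseEta_sigma fun a b => Set.mem_iUnion.2 ⟨i, a, b, rfl⟩)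
  · exact (measurable_proposalMap s).comp (measurable_noiseEta_sigma fun a b => ⟨a, b, rfl⟩)

lemma map_noiseEta_eq (hg : IsStdNoise g P) (k j : ℕ) :
    P.map (noiseEta g k j) = P.map (noiseEta g k 0) := by
  have key : ∀ j, P.map (fun ω (p : (Fin n ⊕ Fin m) × Fin n) => g (.inr (k, j, p.1, p.2)) ω) =
      Measure.pi fun _ => gaussianReal 0 1 := fun j => by
    let e : (Fin n ⊕ Fin m) × Fin n → NoiseIndex n m := fun p => .inr (k, j, p.1, p.2)
    have he : Function.Injective e := by
      rintro ⟨a, i⟩ ⟨a', i'⟩ h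
      simpa [e] using h
    have h1 := (hg.indep.precomp he).map_fun_eq_pi_map fun p => (hg.meas (e p)).aemeasurable
    have h2 : ∀ p, P.map (g (e p)) = gaussianReal 0 1 := fun p => hg.law _
    simp only [h2] at h1
    exact h1
  let q : ((Fin n ⊕ Fin m) × Fin n → ℝ) → Param n m := fun f a i => f (a, i)
  have hq : Measurable q := measurable_matrix_iff.2 fun a i => measurable_pi_apply (a, i)
  have hmap : ∀ j, P.map (noiseEta g k j) =
      (P.map (fun ω (p : (Fin n ⊕ Fin m) × Fin n) => g (.inr (k, j, p.1, p.2)) ω)).map q :=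
    fun j => by
      rw [Measure.map_map hq (measurable_pi_lambda _ fun p => hg.meas _)]
      rfl
  rw [hmap, hmap, key, key]

lemma map_proposal_eq (h : OnlineSetting Qc Rc MP ρ δ₂ r c C₁ C₂ κ d g P) (k : ℕ)
    (s : OnlineState n m) (j : ℕ) : P.map (fun ω' => (run ω').candidate k s j) =
      P.map (fun ω' => (run ω').candidate k s 0) := by
  have hmap : ∀ j, P.map (fun ω' => (run ω').candidate k s j) =
      (P.map (noiseEta g k j)).map (proposalMap δ₂ d s) := fun j => by
    rw [Measure.map_map (measurable_proposalMap s) (h.noise.measurable_noiseEta k j)]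
    rfl
  rw [hmap, hmap, map_noiseEta_eq h.noise]

lemma width_pos (h : OnlineSetting Qc Rc MP ρ δ₂ r c C₁ C₂ κ d g P) (k : ℕ) (ω : Ω) :
    0 < (run ω).width k :=
  (RunInput.betaWidth_state h.c_pos h.U_posDef h.U_ge h.alpha_nonneg h.delta_pos
    h.delta_lt rfl k).1 h.n_pos

/-! ### Rejection sampling within the run. -/

section Proposals

variable [IsProbabilityMeasure P]

/-- The proposal is a continuous function of a Gaussian matrix with full support, and it can take
the value `θ_*`, which has an admissible ball around it. -/
lemma measure_proposal_pos (h : OnlineSetting Qc Rc MP ρ δ₂ r c C₁ C₂ κ d g P) (k : ℕ) (ω : Ω) :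
    0 < P {ω' | (run ω').candidate k ((run ω).state k) 0 ∈ admissible Qc Rc MP ρ d.1} := by
  set s := (run ω).state k with hs
  have hβ := (h.width_pos k ω).ne'
  have hfc : Continuous fun M : Param n m => frob M := by unfold frob; fun_prop
  have hO : IsOpen {H : Param n m | frob (proposalMap δ₂ d s H - d.1) < r} :=
    isOpen_lt (hfc.comp ((continuous_proposalMap s).sub continuous_const)) continuous_const
  refine (h.noise.measure_noiseEta_pos k 0 hO ?_).trans_le
    (measure_mono fun ω' hω' => h.ball _ hω')
  -- The Gaussian matrix for which the proposal is exactly `θ_*`.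
  refine ⟨((run ω).width k)⁻¹ • (CFC.sqrt s.V * (d.1 - RunInput.estimate s)), ?_⟩
  have hdet := (Matrix.isUnit_iff_isUnit_det _).1 (h.V_posDef k ω).isUnit_sqrt
  have : proposalMap δ₂ d s (((run ω).width k)⁻¹ • (CFC.sqrt s.V * (d.1 - RunInput.estimate s)))
      = d.1 := by
    rw [proposalMap, Matrix.mul_smul, ← Matrix.mul_assoc, Matrix.nonsing_inv_mul _ hdet,
      Matrix.one_mul, smul_smul]
    change _ + ((run ω).width k * ((run ω).width k)⁻¹) • _ = _
    rw [mul_inv_cancel₀ hβ, one_smul]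
    abel
  simp only [Set.mem_ofPred_eq, this, sub_self]
  simpa [frob] using h.r_pos

/-- Almost surely the sampled parameters are admissible. -/
lemma ae_sample_mem (h : OnlineSetting Qc Rc MP ρ δ₂ r c C₁ C₂ κ d g P) (k : ℕ) :
    ∀ᵐ ω ∂P, (run ω).sample k ((run ω).state k) ∈ admissible Qc Rc MP ρ d.1 := by
  -- The sample as a function of the state and the Gaussian matrices separately, so that the state
  -- can be frozen.
  let Ψ : OnlineState n m × (ℕ → Param n m) → Param n m := fun p =>
    rejectionSample (admissible Qc Rc MP ρ d.1) fun j => proposalMap δ₂ d p.1 (p.2 j)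
  have hΨ : Measurable Ψ := by
    exact _root_.measurable_sample (Qc := Qc) (Rc := Rc) (MP := MP) (ρ := ρ) (δ₂ := δ₂)
      (Ω := OnlineState n m × (ℕ → Param n m)) (d := fun _ => d) (k := 0) (w := fun _ _ => 0)
      (η := fun _ j p => p.2 j) h.hQ h.hR measurable_const measurable_fst
      (fun j => (measurable_pi_apply j).comp measurable_snd)
  have hset : MeasurableSet {p | Ψ p ∈ admissible Qc Rc MP ρ d.1}ᶜ :=
    (hΨ h.measurableSet_admissible).compl
  have hF := lintegral_comp_prod_of_indepFun (P := P) (h.measurable_state k)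
    (measurable_pi_lambda _ fun j => h.noise.measurable_noiseEta k j) (h.indepFun_eta k)
    (φ := {p | Ψ p ∈ admissible Qc Rc MP ρ d.1}ᶜ.indicator 1) (measurable_one.indicator hset)
  have hinner : ∀ ω, ∫⁻ ω', {p | Ψ p ∈ admissible Qc Rc MP ρ d.1}ᶜ.indicator (1 : _ × _ → ℝ≥0∞)
      ((run ω).state k, fun j => noiseEta g k j ω') ∂P = 0 := fun ω => by
    have h1 := ae_exists_accepted (P := P)
      (fun j => h.measurable_proposal k ((run ω).state k) j)
      (h.indepFun_proposal k ((run ω).state k)) (h.map_proposal_eq k ((run ω).state k))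
      h.measurableSet_admissible (h.measure_proposal_pos k ω)
    rw [← lintegral_zero (μ := P)]
    refine lintegral_congr_ae ?_
    filter_upwards [h1] with ω' hω'
    obtain ⟨j, hj⟩ := hω'
    have hmem : ((run ω).state k, fun j => noiseEta g k j ω') ∈
        {p | Ψ p ∈ admissible Qc Rc MP ρ d.1} :=
      rejectionSample_mem (c := fun j => proposalMap δ₂ d ((run ω).state k)
      (noiseEta g k j ω')) (j := j) hj
    exact Set.indicator_of_notMem (Set.notMem_compl_iff.2 hmem) _
  simp only [hinner, lintegral_zero] at hF
  have hmeas : MeasurableSet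
      {ω | (run ω).sample k ((run ω).state k) ∈ admissible Qc Rc MP ρ d.1}ᶜ :=
    (h.measurable_sample k h.measurableSet_admissible).compl
  have h2 : P {ω | (run ω).sample k ((run ω).state k) ∈ admissible Qc Rc MP ρ d.1}ᶜ = 0 := by
    rw [← lintegral_indicator_one hmeas]
    exact hF
  exact h2

/-- The sampled parameter is as close to the true one as a single proposal. -/
lemma lintegral_sample_le (h : OnlineSetting Qc Rc MP ρ δ₂ r c C₁ C₂ κ d g P) (k : ℕ) :
    ∫⁻ ω, ENNReal.ofReal (euc ((run ω).state k).x ^ 2 * min C₁ (C₂ *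
        frob ((run ω).sample k ((run ω).state k) - d.1) ^ 2)) ∂P ≤
      ∫⁻ ω, ENNReal.ofReal ((2 * C₂ + 2 * C₁ / r ^ 2) * (euc ((run ω).state k).x ^ 2 *
        (2 * frob (RunInput.estimate ((run ω).state k) - d.1) ^ 2
          + 2 * (run ω).width k ^ 2 * (c⁻¹ * ((n + m) * n))))) ∂P := by
  have hC₁ := h.C₁_nonneg
  have hC₂ := h.C₂_nonneg
  have hc := h.c_pos
  have hr := h.r_pos
  let Ψ : OnlineState n m × (ℕ → Param n m) → Param n m := fun p =>
    rejectionSample (admissible Qc Rc MP ρ d.1) fun j => proposalMap δ₂ d p.1 (p.2 j)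
  have hΨ : Measurable Ψ := by
    exact _root_.measurable_sample (Qc := Qc) (Rc := Rc) (MP := MP) (ρ := ρ) (δ₂ := δ₂)
      (Ω := OnlineState n m × (ℕ → Param n m)) (d := fun _ => d) (k := 0) (w := fun _ _ => 0)
      (η := fun _ j p => p.2 j) h.hQ h.hR measurable_const measurable_fst
      (fun j => (measurable_pi_apply j).comp measurable_snd)
  have hφ : Measurable fun p : OnlineState n m × (ℕ → Param n m) =>
      ENNReal.ofReal (euc p.1.x ^ 2 * min C₁ (C₂ * frob (Ψ p - d.1) ^ 2)) :=
    ((((OnlineState.measurable_x.comp measurable_fst).euc).pow_const 2).mul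
      (measurable_const.min ((((hΨ.matrix_sub measurable_const).frob).pow_const
        2).const_mul _))).ennreal_ofReal
  have hF := lintegral_comp_prod_of_indepFun (P := P) (h.measurable_state k)
    (measurable_pi_lambda _ fun j => h.noise.measurable_noiseEta k j) (h.indepFun_eta k) hφ
  refine (le_of_eq hF).trans (lintegral_mono fun ω => ?_)
  set s := (run ω).state k with hs
  have h1 := lintegral_min_rejectionSample_le (P := P) (fun j => h.measurable_proposal k s j)
    (h.indepFun_proposal k s) (h.map_proposal_eq k s) h.measurableSet_admissible
    (h.measure_proposal_pos k ω) hr hC₁ hC₂ h.ball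
  have h2 : ∫⁻ ω', ENNReal.ofReal (frob ((run ω').candidate k s 0 - d.1) ^ 2) ∂P ≤
      ENNReal.ofReal (2 * frob (RunInput.estimate s - d.1) ^ 2
          + 2 * (run ω).width k ^ 2 * (c⁻¹ * ((n + m) * n))) := by
    have h3 : ∀ ω', frob ((run ω').candidate k s 0 - d.1) ^ 2 ≤
        2 * frob (RunInput.estimate s - d.1) ^ 2
          + 2 * (run ω).width k ^ 2 * c⁻¹ * frob (noiseEta g k 0 ω') ^ 2 := fun ω' => by
      have := RunInput.frob_candidate_sub_sq_le (I := run ω') hc (h.V_posDef k ω) (h.V_ge k ω) k 0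
      rw [mul_assoc _ c⁻¹]
      exact this
    refine (lintegral_mono fun ω' => ENNReal.ofReal_le_ofReal (h3 ω')).trans ?_
    have h4 : ∀ ω', ENNReal.ofReal (2 * frob (RunInput.estimate s - d.1) ^ 2
          + 2 * (run ω).width k ^ 2 * c⁻¹ * frob (noiseEta g k 0 ω') ^ 2) =
        ENNReal.ofReal (2 * frob (RunInput.estimate s - d.1) ^ 2)
          + ENNReal.ofReal (2 * (run ω).width k ^ 2 * c⁻¹) *
            ENNReal.ofReal (frob (noiseEta g k 0 ω') ^ 2) := fun ω' => by
      rw [ENNReal.ofReal_add (by positivity) (by positivity),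
        ENNReal.ofReal_mul (p := 2 * (run ω).width k ^ 2 * c⁻¹) (by positivity)]
    simp only [h4]
    rw [lintegral_add_left measurable_const, lintegral_const_mul _
      (((h.noise.measurable_noiseEta k 0).frob.pow_const 2).ennreal_ofReal),
      h.noise.lintegral_frob_noiseEta_sq, lintegral_const, measure_univ, mul_one,
      ← ENNReal.ofReal_mul (by positivity), ← ENNReal.ofReal_add (by positivity) (by positivity)]
    exact ENNReal.ofReal_le_ofReal (le_of_eq (by ring))
  have hx : 0 ≤ euc s.x ^ 2 := sq_nonneg _
  have h5 : ∀ ω', ENNReal.ofReal (euc s.x ^ 2 * min C₁ (C₂ *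
      frob (Ψ (s, fun j => noiseEta g k j ω') - d.1) ^ 2)) = ENNReal.ofReal (euc s.x ^ 2) *
        ENNReal.ofReal (min C₁ (C₂ * frob (Ψ (s, fun j => noiseEta g k j ω') - d.1) ^ 2)) :=
    fun ω' => ENNReal.ofReal_mul hx
  simp only [h5]
  have hm : Measurable fun ω' => ENNReal.ofReal (min C₁ (C₂ *
      frob (Ψ (s, fun j => noiseEta g k j ω') - d.1) ^ 2)) :=
    (measurable_const.min ((((hΨ.comp (measurable_const.prodMk (measurable_pi_lambda _ fun j =>
      h.noise.measurable_noiseEta k j))).matrix_sub measurable_const).frob.pow_const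
        2).const_mul _)).ennreal_ofReal
  rw [lintegral_const_mul _ hm]
  calc _ ≤ ENNReal.ofReal (euc s.x ^ 2) * (ENNReal.ofReal (2 * C₂ + 2 * C₁ / r ^ 2) *
        ENNReal.ofReal (2 * frob (RunInput.estimate s - d.1) ^ 2
          + 2 * (run ω).width k ^ 2 * (c⁻¹ * ((n + m) * n)))) :=
        mul_le_mul_right (h1.trans (mul_le_mul_right h2 _)) _
    _ = _ := by
        rw [← ENNReal.ofReal_mul (by positivity), ← ENNReal.ofReal_mul (by positivity)]
        congr 1; ring

end Proposals

end OnlineSetting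

end OnlineRun

/-! ### Moments along the online run -/

section Moments

open scoped ENNReal

/-- All moments of `f` are finite. -/
def HasMoments {Ω : Type*} [MeasurableSpace Ω] (f : Ω → ℝ) (P : Measure Ω) : Prop :=
  ∀ p : ℝ≥0∞, p ≠ ∞ → MemLp f p P

namespace HasMoments

variable {Ω : Type*} [MeasurableSpace Ω] {P : Measure Ω} {f f' : Ω → ℝ}

lemma integrable (hf : HasMoments f P) : Integrable f P :=
  memLp_one_iff_integrable.1 (hf 1 (by simp))

lemma add (hf : HasMoments f P) (hf' : HasMoments f' P) : HasMoments (fun ω => f ω + f' ω) P :=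
  fun p hp => (hf p hp).add (hf' p hp)

/-- Hölder with exponents `2p`. Stability under products is the reason for working with all moments.
-/
lemma mul (hf : HasMoments f P) (hf' : HasMoments f' P) : HasMoments (fun ω => f ω * f' ω) P := by
  intro p hp
  have : ENNReal.HolderTriple (2 * p) (2 * p) p := ⟨by
    rw [ENNReal.mul_inv (by simp) (by simp), ← add_mul, ENNReal.inv_two_add_inv_two, one_mul]⟩
  exact (hf' (2 * p) (ENNReal.mul_ne_top (by simp) hp)).mul'
    (hf (2 * p) (ENNReal.mul_ne_top (by simp) hp))

lemma const_mul (hf : HasMoments f P) (a : ℝ) : HasMoments (fun ω => a * f ω) P :=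
  fun p hp => (hf p hp).const_mul a

lemma const [IsFiniteMeasure P] (a : ℝ) : HasMoments (fun _ => a) P := fun _ _ => memLp_const a

lemma pow [IsFiniteMeasure P] (hf : HasMoments f P) (j : ℕ) : HasMoments (fun ω => f ω ^ j) P := by
  induction j with
  | zero => simpa using const 1
  | succ j ih => simpa only [pow_succ] using ih.mul hf

lemma sum {ι : Type*} (s : Finset ι) {f : ι → Ω → ℝ} (hf : ∀ i ∈ s, HasMoments (f i) P) :
    HasMoments (fun ω => ∑ i ∈ s, f i ω) P :=
  fun p hp => memLp_finsetSum s fun i hi => hf i hi p hp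

lemma of_le (hf : HasMoments f P) (hf' : Measurable f') (h0 : ∀ ω, 0 ≤ f' ω)
    (hle : ∀ᵐ ω ∂P, f' ω ≤ f ω) : HasMoments f' P := fun p hp =>
  (hf p hp).mono' hf'.aestronglyMeasurable (hle.mono fun ω hω => by
    rwa [Real.norm_of_nonneg (h0 ω)])

end HasMoments

variable {n m : ℕ} {Ω : Type*} [mΩ : MeasurableSpace Ω] {P : Measure Ω}
  {g : NoiseIndex n m → Ω → ℝ}

lemma IsStdNoise.hasMoments_euc_noiseW (hg : IsStdNoise g P) (k : ℕ) :
    HasMoments (fun ω => euc (noiseW g k ω)) P := by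
  have h1 : HasMoments (fun ω => ∑ i, |g (.inl (k, i)) ω|) P :=
    HasMoments.sum _ fun i _ p hp => (hg.memLp (.inl (k, i)) p hp).norm
  refine h1.of_le (hg.measurable_noiseW k).euc (fun ω => euc_nonneg _)
    (Filter.Eventually.of_forall fun ω => ?_)
  refine abs_le_of_sq_le_sq' ?_ (Finset.sum_nonneg fun _ _ => abs_nonneg _) |>.2
  rw [euc_sq_sum]
  have := Finset.sum_sq_le_sq_sum_of_nonneg (s := Finset.univ)
    (f := fun i : Fin n => |g (.inl (k, i)) ω|) fun _ _ => abs_nonneg _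
  simp only [sq_abs] at this
  exact this

lemma IsStdNoise.integral_euc_noiseW_sq (hg : IsStdNoise g P) [IsProbabilityMeasure P] (k : ℕ) :
    ∫ ω, euc (noiseW g k ω) ^ 2 ∂P = n := by
  rw [integral_eq_lintegral_of_nonneg_ae (Filter.Eventually.of_forall fun ω => sq_nonneg _)
    ((hg.measurable_noiseW k).euc.pow_const 2).aestronglyMeasurable, hg.lintegral_euc_noiseW_sq,
    ENNReal.toReal_ofReal (Nat.cast_nonneg n)]

lemma IsStdNoise.integral_euc_noiseW_pow_four_le (hg : IsStdNoise g P) [IsProbabilityMeasure P]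
    (k : ℕ) : ∫ ω, euc (noiseW g k ω) ^ 4 ∂P ≤ n ^ 2 * gaussFourth := by
  rw [integral_eq_lintegral_of_nonneg_ae (Filter.Eventually.of_forall fun ω => by positivity)
    ((hg.measurable_noiseW k).euc.pow_const 4).aestronglyMeasurable]
  exact ENNReal.toReal_le_of_le_ofReal (mul_nonneg (by positivity) gaussFourth_nonneg)
    (hg.lintegral_euc_noiseW_pow_four_le k)

/-- Convexity of the square for the weights `ρ` and `1 - ρ` at the points `a` and `b / (1 - ρ)`. -/
lemma sq_contraction_add_le {ρ a b : ℝ} (h0 : 0 ≤ ρ) (h1 : ρ < 1) :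
    (ρ * a + b) ^ 2 ≤ ρ * a ^ 2 + b ^ 2 / (1 - ρ) := by
  have hs : 0 < 1 - ρ := by linarith
  rw [← sub_nonneg]
  have : ρ * a ^ 2 + b ^ 2 / (1 - ρ) - (ρ * a + b) ^ 2 =
      ρ * (((1 - ρ) * a - b) ^ 2 / (1 - ρ)) := by
    field_simp
    ring
  rw [this]; positivity

/-- `F` stands for the squared noise correlation. With Young parameter `1 - ρ` the product `F x²` is
multiplied by `(2 - ρ) ρ = 1 - (1 - ρ)²`, which is below `1`, so the mixed moment still contracts.
-/
lemma mixed_step_le {ρ κ F x w : ℝ} (h0 : 0 ≤ ρ) (h1 : ρ < 1) (hκ : 0 ≤ κ) (hF : 0 ≤ F) :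
    ((1 + (1 - ρ)) * F + (1 + (1 - ρ)⁻¹) * ((1 + κ) * (x ^ 2 * w ^ 2))) *
        (ρ * x ^ 2 + w ^ 2 / (1 - ρ)) ≤
      (1 - (1 - ρ) ^ 2) * (F * x ^ 2) + 2 / (1 - ρ) * (F * w ^ 2)
        + 2 / (1 - ρ) * (1 + κ) * (x ^ 4 * w ^ 2)
        + 2 / (1 - ρ) ^ 2 * (1 + κ) * (x ^ 2 * w ^ 4) := by
  have hs : 0 < 1 - ρ := by linarith
  set t := (1 - ρ)⁻¹ with ht
  have ht1 : 1 ≤ t := by rw [ht]; exact one_le_inv_iff₀.2 ⟨hs, by linarith⟩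
  have hst : t * (1 - ρ) = 1 := inv_mul_cancel₀ hs.ne'
  have e1 : (2 : ℝ) / (1 - ρ) = 2 * t := div_eq_mul_inv _ _
  have e2 : (2 : ℝ) / (1 - ρ) ^ 2 = 2 * t ^ 2 := by rw [ht, inv_pow]; exact div_eq_mul_inv _ _
  have e3 : w ^ 2 / (1 - ρ) = w ^ 2 * t := div_eq_mul_inv _ _
  rw [e1, e2, e3, ← sub_nonneg]
  have key : 0 ≤ ρ * t * (F * w ^ 2) + (2 * t - (1 + t) * ρ) * ((1 + κ) * (x ^ 4 * w ^ 2))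
      + (t * (t - 1)) * ((1 + κ) * (x ^ 2 * w ^ 4)) := by
    have : 0 ≤ 2 * t - (1 + t) * ρ := by nlinarith
    have : 0 ≤ t - 1 := by linarith
    positivity
  refine key.trans_eq ?_
  ring

lemma frob_add_vecMulVec_sq_le {s : ℝ} (hs : 0 < s) {ι κ : Type*} [Fintype ι] [Fintype κ]
    (G : Matrix ι κ ℝ) (z : ι → ℝ) (w : κ → ℝ) :
    frob (G + Matrix.vecMulVec z w) ^ 2 ≤
      (1 + s) * frob G ^ 2 + (1 + s⁻¹) * (euc z ^ 2 * euc w ^ 2) := by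
  rw [euc_sq_sum, euc_sq_sum, Finset.sum_mul_sum, frob_sq, frob_sq]
  simp only [Finset.mul_sum, ← Finset.sum_add_distrib, Matrix.add_apply, Matrix.vecMulVec_apply,
    ← mul_pow]
  gcongr with i _ j _
  rw [← sub_nonneg]
  have : (1 + s) * G i j ^ 2 + (1 + s⁻¹) * (z i * w j) ^ 2 - (G i j + z i * w j) ^ 2 =
      s⁻¹ * (s * G i j - z i * w j) ^ 2 := by
    field_simp
    ring
  rw [this]; positivity

namespace OnlineSetting

variable {Qc : Matrix (Fin n) (Fin n) ℝ} {Rc : Matrix (Fin m) (Fin m) ℝ} {MP ρ δ₂ : ℝ}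
  {d : OfflineData n m} {r c C₁ C₂ κ : ℝ}

local notation "run" => noisyRun Qc Rc MP ρ δ₂ d g

/-- A bound for the fourth moments of the states. -/
noncomputable def fourthMomentBound (n : ℕ) (ρ : ℝ) : ℝ := n ^ 2 * gaussFourth / (1 - ρ) ^ 4

lemma fourthMomentBound_nonneg (n : ℕ) (ρ : ℝ) : 0 ≤ fourthMomentBound n ρ :=
  div_nonneg (mul_nonneg (by positivity) gaussFourth_nonneg) (by positivity)

/-- Expectations factor over functions of the past and of the current system noise. -/
lemma integral_mul_noiseW (h : OnlineSetting Qc Rc MP ρ δ₂ r c C₁ C₂ κ d g P) (k : ℕ)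
    {φ : (Fin n → ℝ) × (Fin m → ℝ) × Param n m → ℝ} (hφ : Measurable φ) {ψ : (Fin n → ℝ) → ℝ}
    (hψ : Measurable ψ) :
    ∫ ω, φ (((run ω).state k).x, (run ω).control k ((run ω).state k), (run ω).noiseCorr k) *
        ψ (noiseW g k ω) ∂P =
      (∫ ω, φ (((run ω).state k).x, (run ω).control k ((run ω).state k), (run ω).noiseCorr k) ∂P) *
        ∫ ω, ψ (noiseW g k ω) ∂P :=
  ((h.indepFun_noiseW k).comp hφ hψ).integral_fun_mul_eq_mul_integral
    (hφ.comp ((h.measurable_x k).prodMk ((h.measurable_control k).prodMk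
      (h.measurable_noiseCorr k)))).aestronglyMeasurable
    (hψ.comp (h.noise.measurable_noiseW k)).aestronglyMeasurable

variable [IsProbabilityMeasure P]

lemma ae_euc_state_succ_le (h : OnlineSetting Qc Rc MP ρ δ₂ r c C₁ C₂ κ d g P) (k : ℕ) :
    ∀ᵐ ω ∂P, euc ((run ω).state (k + 1)).x ≤
      ρ * euc ((run ω).state k).x + euc (noiseW g k ω) := by
  filter_upwards [h.ae_sample_mem k] with ω hω
  rw [RunInput.state_succ_x]
  refine (euc_add_le _ _).trans (add_le_add_left ?_ _)
  have := admissible.closedLoop_le hω ((run ω).state k).x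
  rw [Param.A_mulVec_add_B_mulVec] at this
  exact this

lemma ae_euc_control_sq_le (h : OnlineSetting Qc Rc MP ρ δ₂ r c C₁ C₂ κ d g P) (k : ℕ) :
    ∀ᵐ ω ∂P, euc ((run ω).control k ((run ω).state k)) ^ 2 ≤
      κ * euc ((run ω).state k).x ^ 2 := by
  filter_upwards [h.ae_sample_mem k] with ω hω
  exact (h.gain _ _ h.star_mem hω _).2.2

lemma ae_euc_pair_sq_le (h : OnlineSetting Qc Rc MP ρ δ₂ r c C₁ C₂ κ d g P) (k : ℕ) :
    ∀ᵐ ω ∂P, euc ((run ω).pair k) ^ 2 ≤ (1 + κ) * euc ((run ω).state k).x ^ 2 := by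
  filter_upwards [h.ae_euc_control_sq_le k] with ω hω
  rw [RunInput.pair, euc_sumElim_sq]
  linarith

lemma hasMoments_euc_state (h : OnlineSetting Qc Rc MP ρ δ₂ r c C₁ C₂ κ d g P) (k : ℕ) :
    HasMoments (fun ω => euc ((run ω).state k).x) P := by
  induction k with
  | zero =>
    refine (HasMoments.const 0).of_le (h.measurable_x 0).euc (fun _ => euc_nonneg _)
      (Filter.Eventually.of_forall fun ω => le_of_eq ?_)
    exact euc_zero
  | succ k ih =>
    exact ((ih.const_mul ρ).add (h.noise.hasMoments_euc_noiseW k)).of_le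
      (h.measurable_x (k + 1)).euc (fun _ => euc_nonneg _) (h.ae_euc_state_succ_le k)

lemma hasMoments_euc_pair_sq (h : OnlineSetting Qc Rc MP ρ δ₂ r c C₁ C₂ κ d g P) (k : ℕ) :
    HasMoments (fun ω => euc ((run ω).pair k) ^ 2) P :=
  (((h.hasMoments_euc_state k).pow 2).const_mul (1 + κ)).of_le
    ((h.measurable_pair k).euc.pow_const 2) (fun _ => sq_nonneg _) (h.ae_euc_pair_sq_le k)

lemma ae_frob_noiseCorr_succ_le (h : OnlineSetting Qc Rc MP ρ δ₂ r c C₁ C₂ κ d g P) {s : ℝ}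
    (hs : 0 < s) (k : ℕ) : ∀ᵐ ω ∂P, frob ((run ω).noiseCorr (k + 1)) ^ 2 ≤
      (1 + s) * frob ((run ω).noiseCorr k) ^ 2 + (1 + s⁻¹) * ((1 + κ) *
        (euc ((run ω).state k).x ^ 2 * euc (noiseW g k ω) ^ 2)) := by
  filter_upwards [h.ae_euc_pair_sq_le k] with ω hω
  rw [RunInput.noiseCorr_succ]
  refine (frob_add_vecMulVec_sq_le hs _ _ _).trans ?_
  rw [← mul_assoc (1 + κ)]
  have hκ := h.kappa_nonneg
  exact add_le_add_right (mul_le_mul_of_nonneg_left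
    (mul_le_mul_of_nonneg_right hω (sq_nonneg _)) (by positivity)) _

lemma hasMoments_frob_noiseCorr_sq (h : OnlineSetting Qc Rc MP ρ δ₂ r c C₁ C₂ κ d g P) (k : ℕ) :
    HasMoments (fun ω => frob ((run ω).noiseCorr k) ^ 2) P := by
  induction k with
  | zero =>
    refine (HasMoments.const 0).of_le ((h.measurable_noiseCorr 0).frob.pow_const 2)
      (fun _ => sq_nonneg _) (Filter.Eventually.of_forall fun ω => le_of_eq ?_)
    simp [RunInput.noiseCorr, frob]
  | succ k ih =>
    exact ((ih.const_mul (1 + 1)).add ((((h.hasMoments_euc_state k).pow 2).mul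
      ((h.noise.hasMoments_euc_noiseW k).pow 2)).const_mul (1 + κ) |>.const_mul (1 + 1⁻¹))).of_le
      ((h.measurable_noiseCorr (k + 1)).frob.pow_const 2) (fun _ => sq_nonneg _)
      (h.ae_frob_noiseCorr_succ_le one_pos k)

lemma integral_euc_state_pow_four_le (h : OnlineSetting Qc Rc MP ρ δ₂ r c C₁ C₂ κ d g P) (k : ℕ) :
    ∫ ω, euc ((run ω).state k).x ^ 4 ∂P ≤ fourthMomentBound n ρ := by
  have hs : 0 < 1 - ρ := by linarith [h.rho_lt]
  induction k with
  | zero =>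
    have : ∀ ω, euc ((run ω).state 0).x ^ 4 = 0 := fun ω => by
      have : ((run ω).state 0).x = 0 := rfl
      simp [this]
    simpa only [this, integral_zero] using fourthMomentBound_nonneg n ρ
  | succ k ih =>
    have hx := (h.hasMoments_euc_state k).pow 4
    have hw := (h.noise.hasMoments_euc_noiseW k).pow 4
    have hle : ∫ ω, euc ((run ω).state (k + 1)).x ^ 4 ∂P ≤
        ∫ ω, (ρ * euc ((run ω).state k).x ^ 4 + ((1 - ρ) ^ 3)⁻¹ * euc (noiseW g k ω) ^ 4) ∂P := by
      refine integral_mono_ae ((h.hasMoments_euc_state (k + 1)).pow 4).integrable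
        ((hx.const_mul _).add (hw.const_mul _)).integrable ?_
      filter_upwards [h.ae_euc_state_succ_le k] with ω hω
      -- The convexity estimate is applied twice, to the norm and then to its square, to reach
      -- fourth powers.
      have h1 := pow_le_pow_left₀ (euc_nonneg _) hω 2
      have h2 := h1.trans (sq_contraction_add_le h.rho_nonneg h.rho_lt)
      have h3 := (pow_le_pow_left₀ (sq_nonneg _) h2 2).trans
        (sq_contraction_add_le h.rho_nonneg h.rho_lt)
      calc euc ((run ω).state (k + 1)).x ^ 4 = (euc ((run ω).state (k + 1)).x ^ 2) ^ 2 := by ring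
        _ ≤ _ := h3
        _ = _ := by
          field_simp
    rw [integral_add (hx.const_mul _).integrable (hw.const_mul _).integrable, integral_const_mul,
      integral_const_mul] at hle
    refine hle.trans ?_
    have h4 := mul_le_mul_of_nonneg_left ih h.rho_nonneg
    have h5 := mul_le_mul_of_nonneg_left (h.noise.integral_euc_noiseW_pow_four_le k)
      (inv_nonneg.2 (pow_nonneg hs.le 3))
    -- `fourthMomentBound` is the fixed point of the recursion.
    have h6 : ((1 - ρ) ^ 3)⁻¹ * (n ^ 2 * gaussFourth) = (1 - ρ) * fourthMomentBound n ρ := by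
      rw [fourthMomentBound]
      field_simp
    rw [h6] at h5
    linarith

lemma integral_euc_state_sq_le (h : OnlineSetting Qc Rc MP ρ δ₂ r c C₁ C₂ κ d g P) (k : ℕ) :
    ∫ ω, euc ((run ω).state k).x ^ 2 ∂P ≤ 1 + fourthMomentBound n ρ := by
  have h4 := (h.hasMoments_euc_state k).pow 4
  have hle : ∫ ω, euc ((run ω).state k).x ^ 2 ∂P ≤
      ∫ ω, (1 + euc ((run ω).state k).x ^ 4) ∂P :=
    integral_mono ((h.hasMoments_euc_state k).pow 2).integrable
      ((HasMoments.const 1).add h4).integrable fun ω => by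
        nlinarith [sq_nonneg (euc ((run ω).state k).x ^ 2 - 1)]
  rw [integral_add (integrable_const _) h4.integrable] at hle
  have := h.integral_euc_state_pow_four_le k
  simp only [integral_const, probReal_univ, one_smul] at hle
  linarith

lemma integral_euc_pair_sq_le (h : OnlineSetting Qc Rc MP ρ δ₂ r c C₁ C₂ κ d g P) (k : ℕ) :
    ∫ ω, euc ((run ω).pair k) ^ 2 ∂P ≤ (1 + κ) * (1 + fourthMomentBound n ρ) := by
  have hκ := h.kappa_nonneg
  refine (integral_mono_ae (h.hasMoments_euc_pair_sq k).integrable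
    (((h.hasMoments_euc_state k).pow 2).const_mul (1 + κ)).integrable
    (h.ae_euc_pair_sq_le k)).trans ?_
  rw [integral_const_mul]
  exact mul_le_mul_of_nonneg_left (h.integral_euc_state_sq_le k) (by linarith)

/-- The increment bound for the second moment of the noise correlation. -/
noncomputable def corrRate (n : ℕ) (ρ κ : ℝ) : ℝ := n * ((1 + κ) * (1 + fourthMomentBound n ρ))

lemma corrRate_nonneg (n : ℕ) (ρ : ℝ) (hκ : 0 ≤ κ) : 0 ≤ corrRate n ρ κ := by
  have := fourthMomentBound_nonneg n ρ
  unfold corrRate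
  positivity

/-- The increments `z wᵀ` are martingale differences, so their second moments add up without cross
terms. -/
lemma integral_frob_noiseCorr_sq_le (h : OnlineSetting Qc Rc MP ρ δ₂ r c C₁ C₂ κ d g P) (k : ℕ) :
    ∫ ω, frob ((run ω).noiseCorr k) ^ 2 ∂P ≤ k * corrRate n ρ κ := by
  induction k with
  | zero => simp [RunInput.noiseCorr, frob]
  | succ k ih =>
    have hz := (h.hasMoments_euc_pair_sq k).const_mul n
    have hF := h.hasMoments_frob_noiseCorr_sq k
    have hind := h.indepFun_noiseW k
    have hφ : Measurable fun p : ((Fin n → ℝ) × (Fin m → ℝ) × Param n m) × (Fin n → ℝ) =>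
        ENNReal.ofReal (frob (p.1.2.2 + Matrix.vecMulVec (Sum.elim p.1.1 p.1.2.1) p.2) ^ 2) :=
      (((measurable_fst.snd.snd.matrix_add ((measurable_fst.fst.vec_sumElim
        measurable_fst.snd.fst).vecMulVec measurable_snd)).frob).pow_const 2).ennreal_ofReal
    have hL := lintegral_comp_prod_of_indepFun ((h.measurable_x k).prodMk
      ((h.measurable_control k).prodMk (h.measurable_noiseCorr k)))
      (h.noise.measurable_noiseW k) hind hφ
    have hinner : ∀ ω, ∫⁻ ω', ENNReal.ofReal (frob ((run ω).noiseCorr k +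
        Matrix.vecMulVec (Sum.elim ((run ω).state k).x ((run ω).control k ((run ω).state k)))
          (noiseW g k ω')) ^ 2) ∂P = ENNReal.ofReal (frob ((run ω).noiseCorr k) ^ 2
            + n * euc ((run ω).pair k) ^ 2) :=
      fun ω => h.noise.lintegral_frob_add_vecMulVec_noiseW k _ _
    simp only [hinner] at hL
    have hL' : ∫⁻ ω, ENNReal.ofReal (frob ((run ω).noiseCorr (k + 1)) ^ 2) ∂P =
        ∫⁻ ω, ENNReal.ofReal (frob ((run ω).noiseCorr k) ^ 2 + n * euc ((run ω).pair k) ^ 2) ∂P := by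
      rw [← hL]
      refine lintegral_congr fun ω => ?_
      rw [RunInput.noiseCorr_succ]
      rfl
    have hE : ∫ ω, frob ((run ω).noiseCorr (k + 1)) ^ 2 ∂P =
        ∫ ω, (frob ((run ω).noiseCorr k) ^ 2 + n * euc ((run ω).pair k) ^ 2) ∂P := by
      rw [integral_eq_lintegral_of_nonneg_ae (Filter.Eventually.of_forall fun ω => sq_nonneg _)
        ((h.measurable_noiseCorr (k + 1)).frob.pow_const 2).aestronglyMeasurable, hL',
        ← integral_eq_lintegral_of_nonneg_ae
          (Filter.Eventually.of_forall fun ω => by positivity)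
          (hF.add hz).integrable.aestronglyMeasurable]
    rw [hE, integral_add hF.integrable hz.integrable, integral_const_mul]
    have := mul_le_mul_of_nonneg_left (h.integral_euc_pair_sq_le k) (Nat.cast_nonneg (α := ℝ) n)
    push_cast
    rw [add_mul, one_mul]
    exact add_le_add ih this

/-- The rate in `integral_frob_noiseCorr_sq_mul_le`. -/
noncomputable def mixedRate (n : ℕ) (ρ κ : ℝ) : ℝ :=
  (2 / (1 - ρ) * (n * corrRate n ρ κ) + (2 / (1 - ρ) * (1 + κ) * (fourthMomentBound n ρ * n)
    + 2 / (1 - ρ) ^ 2 * (1 + κ) * ((1 + fourthMomentBound n ρ) * (n ^ 2 * gaussFourth))))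
      / (1 - ρ) ^ 2

lemma mixedRate_nonneg (n : ℕ) (hρ : ρ < 1) (hκ : 0 ≤ κ) : 0 ≤ mixedRate n ρ κ := by
  have h1 := fourthMomentBound_nonneg n ρ
  have h2 := corrRate_nonneg n ρ hκ
  have h3 := gaussFourth_nonneg
  have h4 : 0 < 1 - ρ := by linarith
  unfold mixedRate
  positivity

/-- The correlation and the state depend on the same noise, so the expectation does not factor. The
recursion for the product contracts, and its forcing terms do factor; the largest one grows linearly
in `k`. -/
lemma integral_frob_noiseCorr_sq_mul_le (h : OnlineSetting Qc Rc MP ρ δ₂ r c C₁ C₂ κ d g P)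
    (k : ℕ) : ∫ ω, frob ((run ω).noiseCorr k) ^ 2 * euc ((run ω).state k).x ^ 2 ∂P ≤
      mixedRate n ρ κ * (k + 1) := by
  have hκ := h.kappa_nonneg
  have hρ := h.rho_nonneg
  have hs : 0 < 1 - ρ := by linarith [h.rho_lt]
  have hB := mixedRate_nonneg n h.rho_lt hκ
  have h40 := fourthMomentBound_nonneg n ρ
  have hg0 := gaussFourth_nonneg
  induction k with
  | zero => simpa [RunInput.noiseCorr, frob] using hB
  | succ k ih =>
    have hF := h.hasMoments_frob_noiseCorr_sq k
    have hX := (h.hasMoments_euc_state k).pow 2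
    have hW := (h.noise.hasMoments_euc_noiseW k).pow 2
    have hX4 := (h.hasMoments_euc_state k).pow 4
    have hW4 := (h.noise.hasMoments_euc_noiseW k).pow 4
    have i1 := (hF.mul hX).const_mul (1 - (1 - ρ) ^ 2)
    have i2 := (hF.mul hW).const_mul (2 / (1 - ρ))
    have i3 := (hX4.mul hW).const_mul (2 / (1 - ρ) * (1 + κ))
    have i4 := (hX.mul hW4).const_mul (2 / (1 - ρ) ^ 2 * (1 + κ))
    have hle : ∫ ω, frob ((run ω).noiseCorr (k + 1)) ^ 2 * euc ((run ω).state (k + 1)).x ^ 2 ∂P ≤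
        ∫ ω, ((1 - (1 - ρ) ^ 2) * (frob ((run ω).noiseCorr k) ^ 2 * euc ((run ω).state k).x ^ 2)
          + 2 / (1 - ρ) * (frob ((run ω).noiseCorr k) ^ 2 * euc (noiseW g k ω) ^ 2)
          + 2 / (1 - ρ) * (1 + κ) * (euc ((run ω).state k).x ^ 4 * euc (noiseW g k ω) ^ 2)
          + 2 / (1 - ρ) ^ 2 * (1 + κ) *
            (euc ((run ω).state k).x ^ 2 * euc (noiseW g k ω) ^ 4)) ∂P := by
      refine integral_mono_ae ((h.hasMoments_frob_noiseCorr_sq (k + 1)).mul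
        ((h.hasMoments_euc_state (k + 1)).pow 2)).integrable
        (((i1.add i2).add i3).add i4).integrable ?_
      filter_upwards [h.ae_euc_state_succ_le k, h.ae_frob_noiseCorr_succ_le hs k] with ω h1 h2
      have h3 := (pow_le_pow_left₀ (euc_nonneg _) h1 2).trans
        (sq_contraction_add_le h.rho_nonneg h.rho_lt)
      exact (mul_le_mul h2 h3 (sq_nonneg _) ((sq_nonneg _).trans h2)).trans
        (mixed_step_le h.rho_nonneg h.rho_lt hκ (sq_nonneg _))
    have e2 : ∫ ω, frob ((run ω).noiseCorr k) ^ 2 * euc (noiseW g k ω) ^ 2 ∂P ≤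
        k * corrRate n ρ κ * n := by
      rw [h.integral_mul_noiseW k (φ := fun p => frob p.2.2 ^ 2) (ψ := fun w => euc w ^ 2)
        (measurable_snd.snd.frob.pow_const 2) (measurable_id.euc.pow_const 2),
        h.noise.integral_euc_noiseW_sq]
      exact mul_le_mul_of_nonneg_right (h.integral_frob_noiseCorr_sq_le k) (Nat.cast_nonneg n)
    have e3 : ∫ ω, euc ((run ω).state k).x ^ 4 * euc (noiseW g k ω) ^ 2 ∂P ≤
        fourthMomentBound n ρ * n := by
      rw [h.integral_mul_noiseW k (φ := fun p => euc p.1 ^ 4) (ψ := fun w => euc w ^ 2)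
        (measurable_fst.euc.pow_const 4) (measurable_id.euc.pow_const 2),
        h.noise.integral_euc_noiseW_sq]
      exact mul_le_mul_of_nonneg_right (h.integral_euc_state_pow_four_le k) (Nat.cast_nonneg n)
    have e4 : ∫ ω, euc ((run ω).state k).x ^ 2 * euc (noiseW g k ω) ^ 4 ∂P ≤
        (1 + fourthMomentBound n ρ) * (n ^ 2 * gaussFourth) := by
      rw [h.integral_mul_noiseW k (φ := fun p => euc p.1 ^ 2) (ψ := fun w => euc w ^ 4)
        (measurable_fst.euc.pow_const 2) (measurable_id.euc.pow_const 4)]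
      exact mul_le_mul (h.integral_euc_state_sq_le k) (h.noise.integral_euc_noiseW_pow_four_le k)
        (integral_nonneg fun ω => by positivity) (by positivity)
    rw [integral_add ((i1.add i2).add i3).integrable i4.integrable,
      integral_add (i1.add i2).integrable i3.integrable, integral_add i1.integrable i2.integrable,
      integral_const_mul, integral_const_mul, integral_const_mul, integral_const_mul] at hle
    refine hle.trans ?_
    have hρ1 : 0 ≤ 1 - (1 - ρ) ^ 2 := by nlinarith
    have f1 := mul_le_mul_of_nonneg_left ih hρ1
    have f2 := mul_le_mul_of_nonneg_left e2 (by positivity : 0 ≤ 2 / (1 - ρ))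
    have f3 := mul_le_mul_of_nonneg_left e3 (by positivity : 0 ≤ 2 / (1 - ρ) * (1 + κ))
    have f4 := mul_le_mul_of_nonneg_left e4 (by positivity : 0 ≤ 2 / (1 - ρ) ^ 2 * (1 + κ))
    -- `mixedRate` is the sum of the forcing coefficients divided by the contraction deficit `(1 -
    -- ρ)²`, so that the linear bound reproduces itself.
    have hkey : (1 - ρ) ^ 2 * mixedRate n ρ κ = 2 / (1 - ρ) * (n * corrRate n ρ κ)
        + (2 / (1 - ρ) * (1 + κ) * (fourthMomentBound n ρ * n)
          + 2 / (1 - ρ) ^ 2 * (1 + κ) *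
            ((1 + fourthMomentBound n ρ) * (n ^ 2 * gaussFourth))) := by
      rw [mixedRate]
      field_simp
    set a := 2 / (1 - ρ) * (n * corrRate n ρ κ) with ha
    set b := 2 / (1 - ρ) * (1 + κ) * (fourthMomentBound n ρ * n)
    set e := 2 / (1 - ρ) ^ 2 * (1 + κ) * ((1 + fourthMomentBound n ρ) * (n ^ 2 * gaussFourth))
    have ha0 : 0 ≤ a := by have := corrRate_nonneg n ρ hκ; positivity
    have hb0 : 0 ≤ b := by positivity
    have he0 : 0 ≤ e := by positivity
    have f2' : 2 / (1 - ρ) * (k * corrRate n ρ κ * n) = a * k := by rw [ha]; ring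
    rw [f2'] at f2
    have hk : (0 : ℝ) ≤ k := Nat.cast_nonneg k
    have hkb := mul_nonneg hk hb0
    have hke := mul_nonneg hk he0
    push_cast
    nlinarith

end OnlineSetting

end Moments

/-! ### Expected regret for fixed offline data -/

section FixedDataRegret

open scoped ENNReal

namespace OnlineSetting

variable {n m : ℕ} {Ω : Type*} {g : NoiseIndex n m → Ω → ℝ} {Qc : Matrix (Fin n) (Fin n) ℝ}
  {Rc : Matrix (Fin m) (Fin m) ℝ} {MP ρ δ₂ : ℝ} {d : OfflineData n m} {r c C₁ C₂ κ : ℝ}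

local notation "run" => noisyRun Qc Rc MP ρ δ₂ d g

/-- The suboptimality of the control at step `k`. -/
noncomputable def _root_.RunInput.gap (I : RunInput n m) (k : ℕ) : ℝ :=
  gainGap I.Qc I.Rc I.θstar (I.sample k (I.state k)) (I.state k).x

/-- The error of the offline estimate in the norm given by `U`. -/
noncomputable def _root_.offlineError (d : OfflineData n m) : ℝ :=
  frob (CFC.sqrt d.2.1 * (d.2.2.1 - d.1)) ^ 2

/-- The cost of the step `k`. -/
noncomputable def _root_.RunInput.cost (I : RunInput n m) (k : ℕ) : ℝ :=
  stageCost I.Qc I.Rc (I.state k).x (I.control k (I.state k))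

lemma excessCost_eq (T : ℕ) (ω : Ω) : (run ω).excessCost T =
    ∑ k ∈ Finset.range T, ((run ω).cost k - optCost Qc Rc d.1) := rfl

variable [mΩ : MeasurableSpace Ω] {P : Measure Ω}

lemma isRiccatiSolution (h : OnlineSetting Qc Rc MP ρ δ₂ r c C₁ C₂ κ d g P) :
    IsRiccatiSolution Qc Rc d.1 (riccati Qc Rc d.1) := admissible.isRiccatiSolution h.star_mem

lemma gap_nonneg (h : OnlineSetting Qc Rc MP ρ δ₂ r c C₁ C₂ κ d g P) (k : ℕ) (ω : Ω) :
    0 ≤ (run ω).gap k := gainGap_nonneg h.hR h.star_mem.1 _ _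

lemma measurable_gap (h : OnlineSetting Qc Rc MP ρ δ₂ r c C₁ C₂ κ d g P) (k : ℕ) :
    Measurable fun ω => (run ω).gap k := by
  have h1 : Measurable fun ω => (run ω).control k ((run ω).state k) -
      optGain Qc Rc d.1 *ᵥ ((run ω).state k).x :=
    (h.measurable_control k).sub (measurable_const.matrix_mulVec (h.measurable_x k))
  have h2 : Measurable fun ω => inputWeight Rc d.1 (riccati Qc Rc d.1) *ᵥ
      ((run ω).control k ((run ω).state k) - optGain Qc Rc d.1 *ᵥ ((run ω).state k).x) :=
    measurable_const.matrix_mulVec h1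
  exact h1.dotProduct h2

lemma measurable_quad (h : OnlineSetting Qc Rc MP ρ δ₂ r c C₁ C₂ κ d g P)
    (M : Matrix (Fin n) (Fin n) ℝ) (k : ℕ) :
    Measurable fun ω => ((run ω).state k).x ⬝ᵥ (M *ᵥ ((run ω).state k).x) :=
  (h.measurable_x k).dotProduct (measurable_const.matrix_mulVec (h.measurable_x k))

lemma cost_nonneg (h : OnlineSetting Qc Rc MP ρ δ₂ r c C₁ C₂ κ d g P) (k : ℕ) (ω : Ω) :
    0 ≤ (run ω).cost k :=
  add_nonneg (h.hQ.posSemidef.quad_nonneg _) (h.hR.posSemidef.quad_nonneg _)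

lemma optCost_nonneg (h : OnlineSetting Qc Rc MP ρ δ₂ r c C₁ C₂ κ d g P) :
    0 ≤ optCost Qc Rc d.1 := h.isRiccatiSolution.1.posSemidef.trace_nonneg

variable [IsProbabilityMeasure P]

lemma ae_gap_le (h : OnlineSetting Qc Rc MP ρ δ₂ r c C₁ C₂ κ d g P) (k : ℕ) :
    ∀ᵐ ω ∂P, (run ω).gap k ≤ C₁ * euc ((run ω).state k).x ^ 2 := by
  filter_upwards [h.ae_sample_mem k] with ω hω
  exact (h.gain _ _ h.star_mem hω _).1

lemma hasMoments_gap (h : OnlineSetting Qc Rc MP ρ δ₂ r c C₁ C₂ κ d g P) (k : ℕ) :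
    HasMoments (fun ω => (run ω).gap k) P :=
  (((h.hasMoments_euc_state k).pow 2).const_mul C₁).of_le (h.measurable_gap k) (h.gap_nonneg k)
    (h.ae_gap_le k)

lemma integral_gap_le (h : OnlineSetting Qc Rc MP ρ δ₂ r c C₁ C₂ κ d g P) (k : ℕ) :
    ∫ ω, (run ω).gap k ∂P ≤ C₁ * (1 + fourthMomentBound n ρ) := by
  refine (integral_mono_ae (h.hasMoments_gap k).integrable
    (((h.hasMoments_euc_state k).pow 2).const_mul C₁).integrable (h.ae_gap_le k)).trans ?_
  rw [integral_const_mul]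
  exact mul_le_mul_of_nonneg_left (h.integral_euc_state_sq_le k) h.C₁_nonneg

lemma hasMoments_pair_sq_mul (h : OnlineSetting Qc Rc MP ρ δ₂ r c C₁ C₂ κ d g P) (i k : ℕ) :
    HasMoments (fun ω => euc ((run ω).pair i) ^ 2 * euc ((run ω).state k).x ^ 2) P :=
  (h.hasMoments_euc_pair_sq i).mul ((h.hasMoments_euc_state k).pow 2)

/-- The two factors are dependent; the inequality of arithmetic and geometric means reduces the
product to fourth moments. -/
lemma integral_pair_sq_mul_le (h : OnlineSetting Qc Rc MP ρ δ₂ r c C₁ C₂ κ d g P) (i k : ℕ) :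
    ∫ ω, euc ((run ω).pair i) ^ 2 * euc ((run ω).state k).x ^ 2 ∂P ≤
      (1 + κ) * fourthMomentBound n ρ := by
  have hκ := h.kappa_nonneg
  have h1 := (h.hasMoments_euc_state i).pow 4
  have h2 := (h.hasMoments_euc_state k).pow 4
  have hle : ∫ ω, euc ((run ω).pair i) ^ 2 * euc ((run ω).state k).x ^ 2 ∂P ≤
      ∫ ω, ((1 + κ) / 2) * (euc ((run ω).state i).x ^ 4 + euc ((run ω).state k).x ^ 4) ∂P := by
    refine integral_mono_ae (h.hasMoments_pair_sq_mul i k).integrable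
      ((h1.add h2).const_mul _).integrable ?_
    filter_upwards [h.ae_euc_pair_sq_le i] with ω hω
    refine (mul_le_mul_of_nonneg_right hω (sq_nonneg _)).trans ?_
    have : euc ((run ω).state i).x ^ 2 * euc ((run ω).state k).x ^ 2 ≤
        (euc ((run ω).state i).x ^ 4 + euc ((run ω).state k).x ^ 4) / 2 := by
      nlinarith [sq_nonneg (euc ((run ω).state i).x ^ 2 - euc ((run ω).state k).x ^ 2)]
    have := mul_le_mul_of_nonneg_left this (by linarith : 0 ≤ 1 + κ)
    linarith
  rw [integral_const_mul, integral_add h1.integrable h2.integrable] at hle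
  have := add_le_add (h.integral_euc_state_pow_four_le i) (h.integral_euc_state_pow_four_le k)
  have := mul_le_mul_of_nonneg_left this (by linarith : 0 ≤ (1 + κ) / 2)
  linarith

/-- The factor in the bound for the expected suboptimality of a single step. -/
noncomputable def stepRate (n m : ℕ) (ρ r C₁ C₂ κ : ℝ) : ℝ :=
  (2 * C₂ + 2 * C₁ / r ^ 2) * (4 * (1 + fourthMomentBound n ρ) + 160 * mixedRate n ρ κ
    + 2 * ((n + m) * n) * (80 * n ^ 2 * ((1 + κ) * fourthMomentBound n ρ)
      + (4 * n ^ 2 + 2) * (1 + fourthMomentBound n ρ)))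

lemma stepRate_nonneg (n m : ℕ) {ρ r C₁ C₂ κ : ℝ} (hρ : ρ < 1) (hC₁ : 0 ≤ C₁) (hC₂ : 0 ≤ C₂)
    (hκ : 0 ≤ κ) : 0 ≤ stepRate n m ρ r C₁ C₂ κ := by
  have h1 := fourthMomentBound_nonneg n ρ
  have h2 := mixedRate_nonneg n hρ hκ
  unfold stepRate
  positivity

/-- Bookkeeping: `ℓ` is `log (1 / δ₂)`, `A` the squared confidence radius and `a` the offline error;
they are collected in one common factor. -/
lemma step_bound_le {a ℓ A X N M E q : ℝ} (hℓ : 0 ≤ ℓ) (hA : 0 ≤ A) (ha : 0 ≤ a) (hX : 0 ≤ X)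
    (hN : 0 ≤ N) (hM : 0 ≤ M) (hE : 0 ≤ E) (hq : 0 ≤ q) :
    (4 * a + 2 * N * (4 * q * ℓ + 2 * A)) * X + 160 * M + 2 * N * E ≤
      (4 * X + 160 * M + 2 * N * (E + (4 * q + 2) * X)) * (1 + ℓ + A + a) := by
  rw [← sub_nonneg]
  have : 0 ≤ 4 * X * (1 + ℓ + A) + (160 * M + 2 * N * E) * (ℓ + A + a)
      + 2 * N * X * (4 * q * (1 + A + a) + 2 * (1 + ℓ + a)) := by positivity
  refine this.trans_eq ?_
  ring

/-- The heart of the rate: every contribution to the expected gap is `O(c⁻¹)`. The condition on `k`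
becomes `k + 1 ≤ S` for `c = S / 40`. -/
lemma integral_gap_le_of_le (h : OnlineSetting Qc Rc MP ρ δ₂ r c C₁ C₂ κ d g P) {k : ℕ}
    (hk : (k : ℝ) + 1 ≤ 40 * c) :
    ∫ ω, (run ω).gap k ∂P ≤ stepRate n m ρ r C₁ C₂ κ * (c⁻¹ *
      (1 + Real.log (1 / δ₂) + d.2.2.2 ^ 2 + offlineError d)) := by
  have hκ := h.kappa_nonneg
  have hc := h.c_pos
  have hC₁ := h.C₁_nonneg
  have hC₂ := h.C₂_nonneg
  have hr := h.r_pos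
  have h40 := fourthMomentBound_nonneg n ρ
  have hB := mixedRate_nonneg n h.rho_lt hκ
  have hℓ : 0 ≤ Real.log (1 / δ₂) := Real.log_nonneg (by
    rw [le_div_iff₀ h.delta_pos]; linarith [h.delta_lt])
  have ha0 : 0 ≤ offlineError d := sq_nonneg _
  set ℓ := Real.log (1 / δ₂) with hℓdef
  set a0 := offlineError d with ha0def
  set C₃ := 2 * C₂ + 2 * C₁ / r ^ 2 with hC₃
  have hC₃0 : 0 ≤ C₃ := by positivity
  set N : ℝ := (n + m) * n with hN
  have hN0 : 0 ≤ N := by positivity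
  have hF := h.hasMoments_frob_noiseCorr_sq k
  have hX := (h.hasMoments_euc_state k).pow 2
  have hZ : HasMoments (fun ω => ∑ i ∈ Finset.range k,
      euc ((run ω).pair i) ^ 2 * euc ((run ω).state k).x ^ 2) P :=
    HasMoments.sum _ fun i _ => h.hasMoments_pair_sq_mul i k
  have j1 := hX.const_mul (4 * c⁻¹ * a0 + 2 * c⁻¹ * N * (4 * n ^ 2 * ℓ + 2 * d.2.2.2 ^ 2))
  have j2 := (hF.mul hX).const_mul (4 * c⁻¹ * c⁻¹)
  have j3 := hZ.const_mul (4 * c⁻¹ * c⁻¹ * N * n ^ 2)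
  have hD := ((j1.add j2).add j3).const_mul C₃
  -- Estimate error and width are replaced pointwise by their bounds; every term keeps the weight
  -- `|x_k|²`.
  have hpt : ∀ ω, C₃ * (euc ((run ω).state k).x ^ 2 *
        (2 * frob (RunInput.estimate ((run ω).state k) - d.1) ^ 2
          + 2 * (run ω).width k ^ 2 * (c⁻¹ * N))) ≤
      C₃ * ((4 * c⁻¹ * a0 + 2 * c⁻¹ * N * (4 * n ^ 2 * ℓ + 2 * d.2.2.2 ^ 2)) *
          euc ((run ω).state k).x ^ 2
        + 4 * c⁻¹ * c⁻¹ * (frob ((run ω).noiseCorr k) ^ 2 * euc ((run ω).state k).x ^ 2)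
        + 4 * c⁻¹ * c⁻¹ * N * n ^ 2 * ∑ i ∈ Finset.range k,
            euc ((run ω).pair i) ^ 2 * euc ((run ω).state k).x ^ 2) := fun ω => by
    have e1 : frob (RunInput.estimate ((run ω).state k) - d.1) ^ 2 ≤
        2 * (c⁻¹ * a0) + 2 * ((c⁻¹) ^ 2 * frob ((run ω).noiseCorr k) ^ 2) :=
      RunInput.frob_estimate_sub_sq_le (I := run ω) hc h.U_posDef h.U_ge k
    have e2 : (run ω).width k ^ 2 ≤ 2 * n ^ 2 * (c⁻¹ * ∑ i ∈ Finset.range k,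
        euc ((run ω).pair i) ^ 2) + 4 * n ^ 2 * ℓ + 2 * d.2.2.2 ^ 2 :=
      (RunInput.betaWidth_state (I := run ω) hc h.U_posDef h.U_ge h.alpha_nonneg h.delta_pos
        h.delta_lt rfl k).2
    refine mul_le_mul_of_nonneg_left ?_ hC₃0
    rw [← Finset.sum_mul]
    set X := euc ((run ω).state k).x ^ 2 with hXdef
    have hX0 : 0 ≤ X := sq_nonneg _
    have e3 := mul_le_mul_of_nonneg_left e1 (by positivity : 0 ≤ 2 * X)
    have e4 := mul_le_mul_of_nonneg_left e2 (by positivity : 0 ≤ 2 * X * (c⁻¹ * N))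
    set F := frob ((run ω).noiseCorr k) ^ 2
    set Z := ∑ i ∈ Finset.range k, euc ((run ω).pair i) ^ 2
    calc _ = 2 * X * frob (RunInput.estimate ((run ω).state k) - d.1) ^ 2
          + 2 * X * (c⁻¹ * N) * (run ω).width k ^ 2 := by ring
      _ ≤ _ := add_le_add e3 e4
      _ = _ := by ring
  have hD0 : ∀ ω, 0 ≤ C₃ * ((4 * c⁻¹ * a0 + 2 * c⁻¹ * N * (4 * n ^ 2 * ℓ + 2 * d.2.2.2 ^ 2)) *
          euc ((run ω).state k).x ^ 2
        + 4 * c⁻¹ * c⁻¹ * (frob ((run ω).noiseCorr k) ^ 2 * euc ((run ω).state k).x ^ 2)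
        + 4 * c⁻¹ * c⁻¹ * N * n ^ 2 * ∑ i ∈ Finset.range k,
            euc ((run ω).pair i) ^ 2 * euc ((run ω).state k).x ^ 2) := fun ω => by positivity
  have hle := calc
    ∫⁻ ω, ENNReal.ofReal ((run ω).gap k) ∂P ≤
        ∫⁻ ω, ENNReal.ofReal (euc ((run ω).state k).x ^ 2 * min C₁ (C₂ *
          frob ((run ω).sample k ((run ω).state k) - d.1) ^ 2)) ∂P := by
        refine lintegral_mono_ae ?_
        filter_upwards [h.ae_sample_mem k] with ω hω
        refine ENNReal.ofReal_le_ofReal ?_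
        obtain ⟨g1, g2, -⟩ := h.gain _ _ h.star_mem hω ((run ω).state k).x
        rw [mul_comm, min_mul_of_nonneg _ _ (sq_nonneg _)]
        exact le_min g1 g2
    _ ≤ _ := h.lintegral_sample_le k
    _ ≤ _ := lintegral_mono fun ω => ENNReal.ofReal_le_ofReal (hpt ω)
  rw [← ofReal_integral_eq_lintegral_ofReal (h.hasMoments_gap k).integrable
    (Filter.Eventually.of_forall (h.gap_nonneg k)),
    ← ofReal_integral_eq_lintegral_ofReal hD.integrable (Filter.Eventually.of_forall hD0),
    ENNReal.ofReal_le_ofReal_iff (integral_nonneg hD0), integral_const_mul,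
    integral_add (j1.add j2).integrable j3.integrable, integral_add j1.integrable j2.integrable,
    integral_const_mul, integral_const_mul, integral_const_mul,
    integral_finsetSum _ fun i _ => (h.hasMoments_pair_sq_mul i k).integrable] at hle
  refine hle.trans ?_
  rw [stepRate, ← hC₃, ← hN, mul_assoc C₃]
  refine mul_le_mul_of_nonneg_left ?_ hC₃0
  -- Turns the linear growth in `k` of the terms with `c⁻²` into a constant times `c⁻¹`; the numbers
  -- `160` and `80` in `stepRate` come from here.
  have hck : c⁻¹ * ((k : ℝ) + 1) ≤ 40 := by
    rw [inv_mul_le_iff₀ hc]; linarith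
  have b1 := h.integral_euc_state_sq_le k
  have b2 := h.integral_frob_noiseCorr_sq_mul_le k
  have b3 : ∑ i ∈ Finset.range k,
      ∫ ω, euc ((run ω).pair i) ^ 2 * euc ((run ω).state k).x ^ 2 ∂P ≤
        k * ((1 + κ) * fourthMomentBound n ρ) := by
    refine (Finset.sum_le_sum fun i _ => h.integral_pair_sq_mul_le i k).trans ?_
    simp
  have c1 := mul_le_mul_of_nonneg_left b1 (by positivity :
    0 ≤ 4 * c⁻¹ * a0 + 2 * c⁻¹ * N * (4 * n ^ 2 * ℓ + 2 * d.2.2.2 ^ 2))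
  have c2 := mul_le_mul_of_nonneg_left b2 (by positivity : 0 ≤ 4 * c⁻¹ * c⁻¹)
  have c3 := mul_le_mul_of_nonneg_left b3 (by positivity : 0 ≤ 4 * c⁻¹ * c⁻¹ * N * n ^ 2)
  have d2 : 4 * c⁻¹ * c⁻¹ * (mixedRate n ρ κ * (k + 1)) ≤ c⁻¹ * (160 * mixedRate n ρ κ) := by
    have := mul_le_mul_of_nonneg_left hck (by positivity : 0 ≤ 4 * c⁻¹ * mixedRate n ρ κ)
    linarith
  have d3 : 4 * c⁻¹ * c⁻¹ * N * n ^ 2 * (k * ((1 + κ) * fourthMomentBound n ρ)) ≤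
      c⁻¹ * (2 * N * (80 * n ^ 2 * ((1 + κ) * fourthMomentBound n ρ))) := by
    have hck' : c⁻¹ * (k : ℝ) ≤ 40 := le_trans (by gcongr; linarith) hck
    have := mul_le_mul_of_nonneg_left hck' (by positivity :
      0 ≤ 4 * c⁻¹ * N * n ^ 2 * ((1 + κ) * fourthMomentBound n ρ))
    linarith
  refine (add_le_add (add_le_add c1 (c2.trans d2)) (c3.trans d3)).trans ?_
  set X2 := 1 + fourthMomentBound n ρ with hX2
  have hX20 : 0 ≤ X2 := by positivity
  set E := 2 * N * (80 * n ^ 2 * ((1 + κ) * fourthMomentBound n ρ)) with hE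
  have hE0 : 0 ≤ E := by positivity
  have hα0 : 0 ≤ d.2.2.2 ^ 2 := sq_nonneg _
  set A := d.2.2.2 ^ 2
  have hci : 0 ≤ c⁻¹ := by positivity
  have key : (4 * a0 + 2 * N * (4 * n ^ 2 * ℓ + 2 * A)) * X2 + 160 * mixedRate n ρ κ + E ≤
      (4 * X2 + 160 * mixedRate n ρ κ + 2 * N * (80 * n ^ 2 * ((1 + κ) * fourthMomentBound n ρ)
        + (4 * n ^ 2 + 2) * X2)) * (1 + ℓ + A + a0) := by
    rw [hE]
    exact step_bound_le hℓ hα0 ha0 hX20 hN0 (by positivity) (by positivity) (by positivity)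
  have := mul_le_mul_of_nonneg_left key hci
  linarith

lemma hasMoments_quad (h : OnlineSetting Qc Rc MP ρ δ₂ r c C₁ C₂ κ d g P)
    {M : Matrix (Fin n) (Fin n) ℝ} (hM : M.PosSemidef) (k : ℕ) :
    HasMoments (fun ω => ((run ω).state k).x ⬝ᵥ (M *ᵥ ((run ω).state k).x)) P :=
  (((h.hasMoments_euc_state k).pow 2).const_mul M.trace).of_le (h.measurable_quad M k)
    (fun _ => hM.quad_nonneg _) (Filter.Eventually.of_forall fun _ => hM.quad_le _)

lemma ae_cost_le (h : OnlineSetting Qc Rc MP ρ δ₂ r c C₁ C₂ κ d g P) (k : ℕ) :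
    ∀ᵐ ω ∂P, (run ω).cost k ≤ (Qc.trace + Rc.trace * κ) * euc ((run ω).state k).x ^ 2 := by
  filter_upwards [h.ae_euc_control_sq_le k] with ω hω
  have h1 := h.hQ.posSemidef.quad_le ((run ω).state k).x
  have h2 := (h.hR.posSemidef.quad_le ((run ω).control k ((run ω).state k))).trans
    (mul_le_mul_of_nonneg_left hω h.hR.posSemidef.trace_nonneg)
  rw [add_mul, mul_assoc]
  exact add_le_add h1 h2

lemma hasMoments_cost (h : OnlineSetting Qc Rc MP ρ δ₂ r c C₁ C₂ κ d g P) (k : ℕ) :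
    HasMoments (fun ω => (run ω).cost k) P :=
  (((h.hasMoments_euc_state k).pow 2).const_mul (Qc.trace + Rc.trace * κ)).of_le
    (Measurable.stageCost (h.measurable_x k) (h.measurable_control k)) (h.cost_nonneg k)
    (h.ae_cost_le k)

/-- The expected cost of a single step, by the Bellman equation. -/
lemma integral_cost (h : OnlineSetting Qc Rc MP ρ δ₂ r c C₁ C₂ κ d g P) (k : ℕ) :
    ∫ ω, (run ω).cost k ∂P - optCost Qc Rc d.1 = ∫ ω, (run ω).gap k ∂P
      + (∫ ω, ((run ω).state k).x ⬝ᵥ (riccati Qc Rc d.1 *ᵥ ((run ω).state k).x) ∂P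
        - ∫ ω, ((run ω).state (k + 1)).x ⬝ᵥ
            (riccati Qc Rc d.1 *ᵥ ((run ω).state (k + 1)).x) ∂P) := by
  set S := riccati Qc Rc d.1 with hS
  have hSp : S.PosSemidef := h.isRiccatiSolution.1.posSemidef
  have hφ : Measurable fun p : ((Fin n → ℝ) × (Fin m → ℝ) × Param n m) × (Fin n → ℝ) =>
      ENNReal.ofReal ((d.1ᵀ *ᵥ Sum.elim p.1.1 p.1.2.1 + p.2) ⬝ᵥ
        (S *ᵥ (d.1ᵀ *ᵥ Sum.elim p.1.1 p.1.2.1 + p.2))) := by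
    have h1 : Measurable fun p : ((Fin n → ℝ) × (Fin m → ℝ) × Param n m) × (Fin n → ℝ) =>
        d.1ᵀ *ᵥ Sum.elim p.1.1 p.1.2.1 + p.2 :=
      (measurable_const.matrix_mulVec (measurable_fst.fst.vec_sumElim
        measurable_fst.snd.fst)).add measurable_snd
    exact (h1.dotProduct (measurable_const.matrix_mulVec h1)).ennreal_ofReal
  have hL := lintegral_comp_prod_of_indepFun ((h.measurable_x k).prodMk
    ((h.measurable_control k).prodMk (h.measurable_noiseCorr k)))
    (h.noise.measurable_noiseW k) (h.indepFun_noiseW k) hφ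
  have hbell : ∀ ω, (d.1ᵀ *ᵥ (run ω).pair k) ⬝ᵥ (S *ᵥ (d.1ᵀ *ᵥ (run ω).pair k)) =
      ((run ω).state k).x ⬝ᵥ (S *ᵥ ((run ω).state k).x) + (run ω).gap k - (run ω).cost k :=
    fun ω => by
      have := h.isRiccatiSolution.bellman h.hR ((run ω).state k).x
        ((run ω).control k ((run ω).state k))
      rw [Param.A_mulVec_add_B_mulVec] at this
      exact eq_sub_of_add_eq' this
  -- Averaging over the independent noise of the step adds the trace, which is `J(θ_*)`.
  have hinner : ∀ ω, ∫⁻ ω', ENNReal.ofReal ((d.1ᵀ *ᵥ Sum.elim ((run ω).state k).x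
      ((run ω).control k ((run ω).state k)) + noiseW g k ω') ⬝ᵥ (S *ᵥ (d.1ᵀ *ᵥ
        Sum.elim ((run ω).state k).x ((run ω).control k ((run ω).state k)) + noiseW g k ω'))) ∂P =
      ENNReal.ofReal (((run ω).state k).x ⬝ᵥ (S *ᵥ ((run ω).state k).x) + (run ω).gap k
        - (run ω).cost k + S.trace) := fun ω => by
    rw [← hbell]
    exact h.noise.lintegral_quad_add_noiseW k hSp _
  simp only [hinner] at hL
  have i0 := (h.hasMoments_quad hSp k).integrable
  have i1 := (h.hasMoments_gap k).integrable
  have i2 := (h.hasMoments_cost k).integrable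
  have hE : ∫ ω, ((run ω).state (k + 1)).x ⬝ᵥ (S *ᵥ ((run ω).state (k + 1)).x) ∂P =
      ∫ ω, (((run ω).state k).x ⬝ᵥ (S *ᵥ ((run ω).state k).x) + (run ω).gap k
        - (run ω).cost k + S.trace) ∂P := by
    rw [integral_eq_lintegral_of_nonneg_ae (Filter.Eventually.of_forall fun ω =>
        hSp.quad_nonneg _) (h.measurable_quad S (k + 1)).aestronglyMeasurable,
      integral_eq_lintegral_of_nonneg_ae]
    · exact congrArg ENNReal.toReal hL
    · refine Filter.Eventually.of_forall fun ω => ?_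
      have := hSp.quad_nonneg (d.1ᵀ *ᵥ (run ω).pair k)
      rw [hbell] at this
      exact add_nonneg this hSp.trace_nonneg
    · exact (((i0.add i1).sub i2).add (integrable_const _)).aestronglyMeasurable
  have i01 : Integrable (fun ω => ((run ω).state k).x ⬝ᵥ (S *ᵥ ((run ω).state k).x)
      + (run ω).gap k) P := i0.add i1
  have i012 : Integrable (fun ω => ((run ω).state k).x ⬝ᵥ (S *ᵥ ((run ω).state k).x)
      + (run ω).gap k - (run ω).cost k) P := i01.sub i2
  rw [integral_add i012 (integrable_const _), integral_sub i01 i2, integral_add i0 i1] at hE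
  simp only [integral_const, probReal_univ, one_smul] at hE
  have : optCost Qc Rc d.1 = S.trace := rfl
  rw [this]
  linarith

lemma integrable_excessCost (h : OnlineSetting Qc Rc MP ρ δ₂ r c C₁ C₂ κ d g P) (T : ℕ) :
    Integrable (fun ω => (run ω).excessCost T) P := by
  simp only [excessCost_eq]
  exact integrable_finsetSum _ fun k _ =>
    (h.hasMoments_cost k).integrable.sub (integrable_const _)

/-- The differences of `xᵀ P(θ_*) x` telescope. The initial value is `0`, and the final one has the
favourable sign. -/
lemma integral_excessCost_le (h : OnlineSetting Qc Rc MP ρ δ₂ r c C₁ C₂ κ d g P) (T : ℕ) :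
    ∫ ω, (run ω).excessCost T ∂P ≤ ∑ k ∈ Finset.range T, ∫ ω, (run ω).gap k ∂P := by
  simp only [excessCost_eq]
  have hi : ∀ k, Integrable (fun ω => (run ω).cost k - optCost Qc Rc d.1) P := fun k =>
    (h.hasMoments_cost k).integrable.sub (integrable_const _)
  rw [integral_finsetSum _ fun k _ => hi k]
  have : ∀ k, ∫ ω, ((run ω).cost k - optCost Qc Rc d.1) ∂P =
      ∫ ω, (run ω).cost k ∂P - optCost Qc Rc d.1 := fun k => by
    rw [integral_sub (h.hasMoments_cost k).integrable (integrable_const _)]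
    simp
  simp only [this, h.integral_cost, Finset.sum_add_distrib]
  rw [Finset.sum_range_sub']
  have h0 : ∀ ω, ((run ω).state 0).x ⬝ᵥ (riccati Qc Rc d.1 *ᵥ ((run ω).state 0).x) = 0 :=
    fun ω => by
      have : ((run ω).state 0).x = 0 := rfl
      simp [this]
  have h1 : 0 ≤ ∫ ω, ((run ω).state T).x ⬝ᵥ (riccati Qc Rc d.1 *ᵥ ((run ω).state T).x) ∂P :=
    integral_nonneg fun ω => h.isRiccatiSolution.1.posSemidef.quad_nonneg _
  simp only [h0, integral_zero]
  linarith

/-- A bound for the expected cost of a step, plus the optimal cost. -/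
noncomputable def costRate (Qc : Matrix (Fin n) (Fin n) ℝ) (Rc : Matrix (Fin m) (Fin m) ℝ)
    (MP ρ κ : ℝ) : ℝ := (Qc.trace + Rc.trace * κ) * (1 + fourthMomentBound n ρ) + MP

/-- The bound is uniform in the offline data, which yields integrability on the good event. -/
lemma integral_abs_excessCost_le (h : OnlineSetting Qc Rc MP ρ δ₂ r c C₁ C₂ κ d g P) (T : ℕ) :
    ∫ ω, |(run ω).excessCost T| ∂P ≤ T * costRate Qc Rc MP ρ κ := by
  have hJ := h.optCost_nonneg
  have hi : ∀ k, Integrable (fun ω => (run ω).cost k + optCost Qc Rc d.1) P := fun k =>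
    (h.hasMoments_cost k).integrable.add (integrable_const _)
  have h1 : ∫ ω, |(run ω).excessCost T| ∂P ≤
      ∫ ω, ∑ k ∈ Finset.range T, ((run ω).cost k + optCost Qc Rc d.1) ∂P := by
    refine integral_mono (h.integrable_excessCost T).abs
      (integrable_finsetSum _ fun k _ => hi k) fun ω => ?_
    rw [excessCost_eq]
    refine (Finset.abs_sum_le_sum_abs _ _).trans (Finset.sum_le_sum fun k _ => ?_)
    have := h.cost_nonneg k ω
    rw [abs_le]
    constructor <;> linarith
  refine h1.trans ?_
  rw [integral_finsetSum _ fun k _ => hi k]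
  refine (Finset.sum_le_card_nsmul _ _ (costRate Qc Rc MP ρ κ) fun k _ => ?_).trans_eq (by simp)
  rw [integral_add (h.hasMoments_cost k).integrable (integrable_const _)]
  have hQR : 0 ≤ Qc.trace + Rc.trace * κ := add_nonneg h.hQ.posSemidef.trace_nonneg
    (mul_nonneg h.hR.posSemidef.trace_nonneg h.kappa_nonneg)
  have h2 := integral_mono_ae (h.hasMoments_cost k).integrable
    (((h.hasMoments_euc_state k).pow 2).const_mul (Qc.trace + Rc.trace * κ)).integrable
    (h.ae_cost_le k)
  rw [integral_const_mul] at h2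
  have h3 := mul_le_mul_of_nonneg_left (h.integral_euc_state_sq_le k) hQR
  have h4 : optCost Qc Rc d.1 ≤ MP := h.star_mem.2.1
  simp only [integral_const, probReal_univ, one_smul, costRate]
  linarith

end OnlineSetting

end FixedDataRegret

/-! ### Conditioning on the offline data -/

section Conditioning

open scoped ENNReal

lemma Matrix.IsHermitian.posSemidef_sub_of_le_lamMin {ι : Type*} [Fintype ι] [DecidableEq ι]
    {M : Matrix ι ι ℝ} (hM : M.IsHermitian) {c : ℝ} (h : c ≤ lamMin M) :
    (M - c • (1 : Matrix ι ι ℝ)).PosSemidef := by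
  have hH : (M - c • (1 : Matrix ι ι ℝ)).IsHermitian :=
    hM.sub (by simp [Matrix.IsHermitian])
  rw [← Matrix.nonneg_iff_posSemidef,
    StarOrderedRing.nonneg_iff_spectrum_nonneg (R := ℝ) _ hH.isSelfAdjoint]
  intro x hx
  have h1 : x + c ∈ spectrum ℝ M := by
    rw [← Algebra.algebraMap_eq_smul_one, spectrum.mem_iff] at hx
    rw [spectrum.mem_iff]
    convert hx using 2
    rw [map_add]
    abel
  have h2 := csInf_le (Matrix.finite_spectrum M).bddBelow h1
  have : lamMin M ≤ x + c := h2
  linarith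

lemma mul_euc_sq_le_of_posSemidef_sub {ι : Type*} [Fintype ι] [DecidableEq ι]
    {M : Matrix ι ι ℝ} {c : ℝ} (h : (M - c • (1 : Matrix ι ι ℝ)).PosSemidef) (x : ι → ℝ) :
    c * euc x ^ 2 ≤ x ⬝ᵥ (M *ᵥ x) := by
  have := h.quad_nonneg x
  rw [Matrix.sub_mulVec, dotProduct_sub, Matrix.smul_mulVec, Matrix.one_mulVec, dotProduct_smul,
    smul_eq_mul, ← euc_sq] at this
  linarith

lemma posDef_of_posSemidef_sub {ι : Type*} [Fintype ι] [DecidableEq ι]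
    {M : Matrix ι ι ℝ} {c : ℝ} (hc : 0 < c) (h : (M - c • (1 : Matrix ι ι ℝ)).PosSemidef) :
    M.PosDef := by
  have h1 : (c • (1 : Matrix ι ι ℝ)).PosDef := Matrix.PosDef.one.smul hc
  simpa using h1.add_posSemidef h

lemma integral_comp_prod_of_indepFun {Ω α β : Type*} [MeasurableSpace Ω] [MeasurableSpace α]
    [MeasurableSpace β] {P : Measure Ω} [IsProbabilityMeasure P] {f : Ω → α} {h : Ω → β}
    (hf : Measurable f) (hh : Measurable h) (hind : IndepFun f h P) {φ : α × β → ℝ}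
    (hφ : Measurable φ) (hint : Integrable (fun ω => φ (f ω, h ω)) P) :
    ∫ ω, φ (f ω, h ω) ∂P = ∫ ω, ∫ ω', φ (f ω, h ω') ∂P ∂P := by
  have h1 := (indepFun_iff_map_prod_eq_prod_map_map hf.aemeasurable hh.aemeasurable).1 hind
  have : IsProbabilityMeasure (P.map h) := Measure.isProbabilityMeasure_map hh.aemeasurable
  have : IsProbabilityMeasure (P.map f) := Measure.isProbabilityMeasure_map hf.aemeasurable
  have hint' : Integrable φ ((P.map f).prod (P.map h)) := by
    rw [← h1]
    exact (integrable_map_measure hφ.aestronglyMeasurable (hf.prodMk hh).aemeasurable).2 hint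
  rw [← integral_map (hf.prodMk hh).aemeasurable hφ.aestronglyMeasurable, h1, integral_prod _ hint',
    integral_map hf.aemeasurable hφ.stronglyMeasurable.integral_prod_right'.aestronglyMeasurable]
  refine integral_congr_ae (Filter.Eventually.of_forall fun ω => ?_)
  exact integral_map (f := fun y => φ (f ω, y)) hh.aemeasurable
    (hφ.comp measurable_prodMk_left).aestronglyMeasurable

/-- A conditional expectation is bounded on a set if the integrals over its subsets are. -/
lemma condExp_le_of_forall_setIntegral_le {Ω : Type*} {m₀ mΩ : MeasurableSpace Ω} {P : Measure Ω}
    [IsProbabilityMeasure P] (hm : m₀ ≤ mΩ) {G : Set Ω} (hG : MeasurableSet[m₀] G) {Y : Ω → ℝ}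
    (hY : Integrable Y P) {B : ℝ}
    (h : ∀ A, MeasurableSet[m₀] A → A ⊆ G → ∫ ω in A, Y ω ∂P ≤ B * P.real A) :
    ∀ᵐ ω ∂P, ω ∈ G → (P[Y | m₀]) ω ≤ B := by
  -- The part of `G` where the bound fails is itself a test set; the hypothesis forces it to be
  -- null.
  set A := G ∩ {ω | B < (P[Y | m₀]) ω} with hA
  have hAm : MeasurableSet[m₀] A :=
    hG.inter (stronglyMeasurable_condExp.measurable measurableSet_Ioi)
  have h1 := h A hAm Set.inter_subset_left
  rw [← setIntegral_condExp hm hY hAm] at h1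
  have hi : IntegrableOn (fun ω => (P[Y | m₀]) ω - B) A P :=
    (integrable_condExp.sub (integrable_const B)).integrableOn
  have h2 : ∫ ω in A, ((P[Y | m₀]) ω - B) ∂P ≤ 0 := by
    rw [integral_sub integrable_condExp.integrableOn (integrable_const B).integrableOn]
    simp only [setIntegral_const, smul_eq_mul]
    linarith
  have h3 : P A = 0 := by
    by_contra hne
    have hpos : 0 < ∫ ω in A, ((P[Y | m₀]) ω - B) ∂P := by
      rw [setIntegral_pos_iff_support_of_nonneg_ae]
      · refine (pos_iff_ne_zero.2 hne).trans_le (measure_mono fun ω hω => ⟨?_, hω⟩)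
        exact (sub_pos.2 hω.2).ne'
      · exact (ae_restrict_mem (hm _ hAm)).mono fun ω hω => (sub_pos.2 hω.2).le
      · exact hi
    linarith
  filter_upwards [measure_eq_zero_iff_ae_notMem.1 h3] with ω hω hωG
  exact not_lt.1 fun hlt => hω ⟨hωG, hlt⟩

end Conditioning

namespace Experiment

variable {n m : ℕ} {Ω : Type*} [mΩ : MeasurableSpace Ω] (X : Experiment n m Ω)

/-- The data of the online run that are fixed before it starts. -/
def offlineData (S : ℕ) (ω : Ω) : OfflineData n m := (X.θstar ω, X.U S ω, X.θhat ω, X.α ω)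

/-- All the noise of the online run. -/
def noise (ω : Ω) : NoiseIndex n m → ℝ := fun c => X.gaussians c ω

variable {X} {S : ℕ} {P : Measure Ω}

lemma OnlineModel.isStdNoise (h : X.OnlineModel S P) : IsStdNoise X.gaussians P :=
  ⟨h.gauss_meas, h.gauss_law, h.gauss_indep⟩

lemma OfflineModel.measurable_U (h : X.OfflineModel S P) : Measurable[X.𝓖 S] (X.U S) := by
  refine (@measurable_matrix_iff _ (X.𝓖 S) _ _ _).2 fun a b => ?_
  simp only [U, Matrix.sum_apply, Matrix.vecMulVec_apply]
  refine @Finset.measurable_sum _ _ _ _ _ _ (X.𝓖 S) _ _ fun k hk => ?_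
  have hy : ∀ a, Measurable[X.𝓖 S] fun ω => X.y k ω a := fun a => by
    have hle := X.𝓖.mono (Finset.mem_Icc.1 hk).2
    cases a with
    | inl i => exact (h.ξ_meas k hk i).mono hle le_rfl
    | inr i => exact (h.v_meas k hk i).mono hle le_rfl
  exact (hy a).mul (hy b)

lemma posSemidef_U (ω : Ω) : (X.U S ω).PosSemidef :=
  Matrix.posSemidef_sum _ fun k _ => by
    simpa using Matrix.posSemidef_vecMulVec_self_star (X.y k ω)

lemma measurable_offlineData (h : X.OfflineModel S P) :
    Measurable[X.𝓖 S ⊔ X.sigmaθ] (X.offlineData S) := by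
  have hθ : Measurable[X.𝓖 S ⊔ X.sigmaθ] X.θstar :=
    (@measurable_matrix_iff _ (X.𝓖 S ⊔ X.sigmaθ) _ _ _).2 fun a i =>
      (comap_measurable fun ω => X.θstar ω a i).mono
        (le_trans (le_iSup₂ (f := fun a i => MeasurableSpace.comap
          (fun ω => X.θstar ω a i) inferInstance) a i) le_sup_right) le_rfl
  have hU : Measurable[X.𝓖 S ⊔ X.sigmaθ] (X.U S) := h.measurable_U.mono le_sup_left le_rfl
  have hh : Measurable[X.𝓖 S ⊔ X.sigmaθ] X.θhat :=
    (@measurable_matrix_iff _ (X.𝓖 S ⊔ X.sigmaθ) _ _ _).2 fun a i =>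
      (h.θhat_meas a i).mono le_sup_left le_rfl
  have hα : Measurable[X.𝓖 S ⊔ X.sigmaθ] X.α := h.α_meas.mono le_sup_left le_rfl
  exact hθ.prodMk (hU.prodMk (hh.prodMk hα))

lemma sigma_le (h : X.OnlineModel S P) : X.𝓖 S ⊔ X.sigmaθ ≤ mΩ :=
  sup_le (X.𝓖.le S) (iSup₂_le fun a i => (h.θstar_meas a i).comap_le)

lemma indepFun_noise (h : X.OnlineModel S P) {β : Type*} [MeasurableSpace β] {f : Ω → β}
    (hf : Measurable[X.𝓖 S ⊔ X.sigmaθ] f) : IndepFun f X.noise P := by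
  rw [IndepFun_iff_Indep]
  refine indep_of_indep_of_le_left (indep_of_indep_of_le_right h.indep.symm ?_) hf.comap_le
  refine Measurable.comap_le ?_
  exact @measurable_pi_lambda _ _ _ (_) _ _ fun c =>
    (comap_measurable (X.gaussians c)).mono (le_iSup
      (fun c => MeasurableSpace.comap (X.gaussians c) inferInstance) c) le_rfl

lemma measurable_noise (h : X.OnlineModel S P) : Measurable X.noise :=
  measurable_pi_lambda _ h.gauss_meas

end Experiment

/-! ### The regret given the offline data -/

section Regret

open scoped ENNReal

variable {n m : ℕ} {Qc : Matrix (Fin n) (Fin n) ℝ} {Rc : Matrix (Fin m) (Fin m) ℝ}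
  {MP ρ δ₂ r c C₁ C₂ κ : ℝ}

namespace OnlineSetting

variable {Ω : Type*} [MeasurableSpace Ω] {P : Measure Ω} [IsProbabilityMeasure P]
  {g : NoiseIndex n m → Ω → ℝ} {d : OfflineData n m}

/-- The crude bound needs no control of the offline error; it serves where the confidence set misses
`θ_*`. -/
lemma integral_excessCost_le_mul (h : OnlineSetting Qc Rc MP ρ δ₂ r c C₁ C₂ κ d g P) (T : ℕ) :
    ∫ ω, (noisyRun Qc Rc MP ρ δ₂ d g ω).excessCost T ∂P ≤
      T * (C₁ * (1 + fourthMomentBound n ρ)) :=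
  (h.integral_excessCost_le T).trans
    ((Finset.sum_le_card_nsmul _ _ _ fun k _ => h.integral_gap_le k).trans_eq (by simp))

lemma integral_excessCost_le_of_le (h : OnlineSetting Qc Rc MP ρ δ₂ r c C₁ C₂ κ d g P) {T : ℕ}
    (hT : (T : ℝ) ≤ 40 * c) :
    ∫ ω, (noisyRun Qc Rc MP ρ δ₂ d g ω).excessCost T ∂P ≤
      T * (stepRate n m ρ r C₁ C₂ κ * (c⁻¹ *
        (1 + Real.log (1 / δ₂) + d.2.2.2 ^ 2 + offlineError d))) := by
  refine (h.integral_excessCost_le T).trans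
    ((Finset.sum_le_card_nsmul _ _ _ fun k hk => h.integral_gap_le_of_le ?_).trans_eq (by simp))
  refine le_trans ?_ hT
  exact_mod_cast Finset.mem_range.1 hk

end OnlineSetting

namespace Experiment

variable {Ω : Type*} [mΩ : MeasurableSpace Ω] {X : Experiment n m Ω} {S : ℕ} {P : Measure Ω}

/-- The weighted excess cost as a function of the offline data and the noise. -/
noncomputable def weightedExcess (Qc : Matrix (Fin n) (Fin n) ℝ) (Rc : Matrix (Fin m) (Fin m) ℝ)
    (MP ρ δ₂ : ℝ) (T : ℕ) (p : (ℝ × OfflineData n m) × (NoiseIndex n m → ℝ)) : ℝ :=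
  p.1.1 * (noisyRun Qc Rc MP ρ δ₂ p.1.2 (fun c f => f c) p.2).excessCost T

lemma measurable_weightedExcess (hQ : Qc.PosDef) (hR : Rc.PosDef) (T : ℕ) :
    Measurable (weightedExcess Qc Rc MP ρ δ₂ T) := by
  refine measurable_fst.fst.mul ?_
  exact measurable_excessCost
    (d := fun p : (ℝ × OfflineData n m) × (NoiseIndex n m → ℝ) => p.1.2)
    (w := fun k p i => p.2 (.inl (k, i)))
    (η := fun k j p a i => p.2 (.inr (k, j, a, i))) hQ hR measurable_fst.snd T
    (fun k => measurable_pi_lambda _ fun i => (measurable_pi_apply _).comp measurable_snd)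
    (fun k j => measurable_matrix_iff.2 fun a i => (measurable_pi_apply _).comp measurable_snd)

variable (Qc Rc MP ρ δ₂) in
-- The indicator of an offline event becomes part of the frozen data, so the freezing lemmas apply
-- to localized expectations.
lemma indicator_excessCost (A : Set Ω) (T : ℕ) (ω : Ω) :
    A.indicator (fun ω => (X.run Qc Rc MP ρ S δ₂ 0 ω).excessCost T) ω =
      weightedExcess Qc Rc MP ρ δ₂ T ((A.indicator 1 ω, X.offlineData S ω), X.noise ω) := by
  by_cases hω : ω ∈ A
  · simp only [Set.indicator_of_mem hω, weightedExcess, Pi.one_apply, one_mul]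
    rfl
  · simp [Set.indicator_of_notMem hω, weightedExcess]

lemma measurable_indicator_offlineData (hoff : X.OfflineModel S P) {A : Set Ω}
    (hA : MeasurableSet[X.𝓖 S] A) : Measurable[X.𝓖 S ⊔ X.sigmaθ]
      fun ω => ((A.indicator 1 ω : ℝ), X.offlineData S ω) := by
  have h1 : MeasurableSet[X.𝓖 S ⊔ X.sigmaθ] A := le_sup_left (a := X.𝓖 S) (b := X.sigmaθ) _ hA
  have h2 : Measurable[X.𝓖 S ⊔ X.sigmaθ] (A.indicator (1 : Ω → ℝ)) :=
    Measurable.indicator (measurable_const (a := (1 : ℝ))) h1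
  exact h2.prodMk (measurable_offlineData hoff)

variable [IsProbabilityMeasure P]

lemma integrableOn_excessCost (hQ : Qc.PosDef) (hR : Rc.PosDef) (hoff : X.OfflineModel S P)
    (hon : X.OnlineModel S P) {A : Set Ω} (hA : MeasurableSet[X.𝓖 S] A)
    (hset : ∀ᵐ ω ∂P, ω ∈ A → OnlineSetting Qc Rc MP ρ δ₂ r c C₁ C₂ κ (X.offlineData S ω)
      X.gaussians P) (T : ℕ) :
    IntegrableOn (fun ω => (X.run Qc Rc MP ρ S δ₂ 0 ω).excessCost T) A P := by
  rw [← integrable_indicator_iff (X.𝓖.le S _ hA)]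
  have hf := measurable_indicator_offlineData hoff hA
  have hf' := hf.mono (sigma_le hon) le_rfl
  have hφ := measurable_weightedExcess (MP := MP) (ρ := ρ) (δ₂ := δ₂) hQ hR T
  have heq : A.indicator (fun ω => (X.run Qc Rc MP ρ S δ₂ 0 ω).excessCost T) = fun ω =>
      weightedExcess Qc Rc MP ρ δ₂ T ((A.indicator 1 ω, X.offlineData S ω), X.noise ω) :=
    funext fun ω => indicator_excessCost Qc Rc MP ρ δ₂ A T ω
  rw [heq]
  refine ⟨(hφ.comp (hf'.prodMk (measurable_noise hon))).aestronglyMeasurable, ?_⟩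
  rw [HasFiniteIntegral, lintegral_comp_prod_of_indepFun hf' (measurable_noise hon)
    (indepFun_noise hon hf) (φ := fun p => ‖weightedExcess Qc Rc MP ρ δ₂ T p‖ₑ) hφ.enorm]
  have hbound : ∀ᵐ ω ∂P, ∫⁻ ω', ‖weightedExcess Qc Rc MP ρ δ₂ T
      ((A.indicator 1 ω, X.offlineData S ω), X.noise ω')‖ₑ ∂P ≤
        ENNReal.ofReal (T * OnlineSetting.costRate Qc Rc MP ρ κ) := by
    filter_upwards [hset] with ω hω
    by_cases hωA : ω ∈ A
    · have h1 := hω hωA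
      have h2 := ofReal_integral_norm_eq_lintegral_enorm (h1.integrable_excessCost T)
      simp only [weightedExcess, Set.indicator_of_mem hωA, Pi.one_apply, one_mul]
      refine (le_of_eq h2.symm).trans (ENNReal.ofReal_le_ofReal ?_)
      exact h1.integral_abs_excessCost_le T
    · simp [weightedExcess, Set.indicator_of_notMem hωA]
  refine (lintegral_mono_ae hbound).trans_lt ?_
  rw [lintegral_const, measure_univ, mul_one]
  exact ENNReal.ofReal_lt_top

lemma setIntegral_excessCost_le (hQ : Qc.PosDef) (hR : Rc.PosDef) (hoff : X.OfflineModel S P)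
    (hon : X.OnlineModel S P) {A : Set Ω} (hA : MeasurableSet[X.𝓖 S] A)
    (hset : ∀ᵐ ω ∂P, ω ∈ A → OnlineSetting Qc Rc MP ρ δ₂ r c C₁ C₂ κ (X.offlineData S ω)
      X.gaussians P) {T : ℕ} {b : Ω → ℝ} (hb : Integrable b P) (hb0 : ∀ ω ∈ A, 0 ≤ b ω)
    (hle : ∀ᵐ ω ∂P, ω ∈ A →
      ∫ ω', (noisyRun Qc Rc MP ρ δ₂ (X.offlineData S ω) X.gaussians ω').excessCost T ∂P ≤ b ω) :
    ∫ ω in A, (X.run Qc Rc MP ρ S δ₂ 0 ω).excessCost T ∂P ≤ ∫ ω in A, b ω ∂P := by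
  have hAm := X.𝓖.le S _ hA
  have hint := integrableOn_excessCost (T := T) hQ hR hoff hon hA hset
  have hf := measurable_indicator_offlineData hoff hA
  have hf' := hf.mono (sigma_le hon) le_rfl
  have hφ := measurable_weightedExcess (MP := MP) (ρ := ρ) (δ₂ := δ₂) hQ hR T
  rw [← integrable_indicator_iff hAm] at hint
  rw [← integral_indicator hAm, ← integral_indicator hAm]
  have heq : A.indicator (fun ω => (X.run Qc Rc MP ρ S δ₂ 0 ω).excessCost T) = fun ω =>
      weightedExcess Qc Rc MP ρ δ₂ T ((A.indicator 1 ω, X.offlineData S ω), X.noise ω) :=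
    funext fun ω => indicator_excessCost Qc Rc MP ρ δ₂ A T ω
  rw [heq] at hint ⊢
  rw [integral_comp_prod_of_indepFun hf' (measurable_noise hon) (indepFun_noise hon hf) hφ hint]
  have hpt : ∀ᵐ ω ∂P, ∫ ω', weightedExcess Qc Rc MP ρ δ₂ T
      ((A.indicator 1 ω, X.offlineData S ω), X.noise ω') ∂P ≤ A.indicator b ω := by
    filter_upwards [hle] with ω hω
    by_cases hωA : ω ∈ A
    · simp only [weightedExcess, Set.indicator_of_mem hωA, Pi.one_apply, one_mul]
      exact hω hωA
    · simp [weightedExcess, Set.indicator_of_notMem hωA]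
  -- If the inner integral were not integrable, its integral would be `0` by convention, and `b` is
  -- nonnegative on `A`.
  by_cases hi : Integrable (fun ω => ∫ ω', weightedExcess Qc Rc MP ρ δ₂ T
      ((A.indicator 1 ω, X.offlineData S ω), X.noise ω') ∂P) P
  · exact integral_mono_ae hi (hb.indicator hAm) hpt
  · rw [integral_undef hi]
    exact integral_nonneg fun ω => Set.indicator_nonneg hb0 ω

end Experiment

end Regret

/-! ### The good event and the assembly of the bound. -/

section Main

namespace Experiment

variable {n m : ℕ} {Ω : Type*} [mΩ : MeasurableSpace Ω] {X : Experiment n m Ω} {S : ℕ}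
  {P : Measure Ω}

/-- The event that the offline confidence set misses the true parameter. -/
def missed (X : Experiment n m Ω) (S : ℕ) : Set Ω :=
  {ω | X.α ω ^ 2 < offlineError (X.offlineData S ω)}

lemma measurableSet_missed (hoff : X.OfflineModel S P) (hon : X.OnlineModel S P) :
    MeasurableSet (X.missed S) := by
  have hd := (measurable_offlineData hoff).mono (sigma_le hon) le_rfl
  have h1 : Measurable fun ω => offlineError (X.offlineData S ω) :=
    (((measurable_cfcSqrt.comp hd.snd.fst).matrix_mul
      (hd.snd.snd.fst.matrix_sub hd.fst)).frob).pow_const 2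
  exact measurableSet_lt ((hoff.α_meas.mono (X.𝓖.le S) le_rfl).pow_const 2) h1

/-- With high probability the offline data are informative, the confidence radius is small, and
the true parameter is unlikely to be missed given the offline data. -/
lemma exists_good_event [IsProbabilityMeasure P] {δ δ₁ b : ℝ} (hδ : 0 < δ) (hS : 0 < S)
    (hδ₁ : δ₁ = δ / (16 * S)) (hlen : 200 * ((n : ℝ) + m) * Real.log (12 / δ₁) ≤ S)
    (hoff : X.OfflineModel S P) (hon : X.OnlineModel S P) (hguar : X.OfflineGuarantee S δ₁ P)
    (hα : 1 - δ₁ ≤ P.real {ω | X.α ω ≤ b}) (hθ : ∀ᵐ ω ∂P, X.θstar ω = X.θsim ω) :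
    ∃ G : Set Ω, MeasurableSet[X.𝓖 S] G ∧ 1 - δ ≤ P.real G ∧ ∀ ω ∈ G,
      (X.U S ω - ((S : ℝ) / 40) • (1 : Matrix (Fin n ⊕ Fin m) (Fin n ⊕ Fin m) ℝ)).PosSemidef ∧
      X.α ω ≤ b ∧ (P[(X.missed S).indicator (fun _ => (1 : ℝ)) | X.𝓖 S]) ω ≤ 1 / S := by
  have hS' : (0 : ℝ) < S := by exact_mod_cast hS
  have hmiss := measurableSet_missed hoff hon
  set G₁ := {ω | (X.U S ω - ((S : ℝ) / 40) •
    (1 : Matrix (Fin n ⊕ Fin m) (Fin n ⊕ Fin m) ℝ)).PosSemidef} with hG₁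
  set G₂ := {ω | X.α ω ≤ b} with hG₂
  set f := P[(X.missed S).indicator (fun _ => (1 : ℝ)) | X.𝓖 S] with hf
  set G₃ := {ω | f ω ≤ 1 / S} with hG₃
  have m1 : MeasurableSet[X.𝓖 S] G₁ := by
    have h1 : Measurable fun M : Matrix (Fin n ⊕ Fin m) (Fin n ⊕ Fin m) ℝ =>
        M - ((S : ℝ) / 40) • (1 : Matrix (Fin n ⊕ Fin m) (Fin n ⊕ Fin m) ℝ) :=
      measurable_id.matrix_sub measurable_const
    exact (h1.comp hoff.measurable_U) measurableSet_posSemidef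
  have m2 : MeasurableSet[X.𝓖 S] G₂ := hoff.α_meas measurableSet_Iic
  have m3 : MeasurableSet[X.𝓖 S] G₃ := by
    have h1 : Measurable[X.𝓖 S] f := stronglyMeasurable_condExp.measurable
    exact h1 measurableSet_Iic
  have n1 := X.𝓖.le S _ m1
  have n2 := X.𝓖.le S _ m2
  have n3 := X.𝓖.le S _ m3
  have p1 : P.real G₁ᶜ ≤ δ₁ := by
    have : 1 - δ₁ ≤ P.real G₁ := hguar.trans (measureReal_mono fun ω hω =>
      (posSemidef_U ω).isHermitian.posSemidef_sub_of_le_lamMin (hω.2 hlen))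
    rw [probReal_compl_eq_one_sub n1]
    linarith
  have p2 : P.real G₂ᶜ ≤ δ₁ := by
    rw [probReal_compl_eq_one_sub n2]
    linarith
  have pm : P.real (X.missed S) ≤ δ₁ := by
    -- The offline guarantee concerns the simulated system; it transfers because the two parameters
    -- agree almost surely.
    have h1 : {ω | frob (CFC.sqrt (X.U S ω) * (X.θhat ω - X.θsim ω)) ≤ X.α ω ∧
        (200 * ((n : ℝ) + m) * Real.log (12 / δ₁) ≤ S → (S : ℝ) / 40 ≤ lamMin (X.U S ω))}
          ≤ᵐ[P] ((X.missed S)ᶜ : Set Ω) := by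
      filter_upwards [hθ] with ω hω hωE
      have h2 : frob (CFC.sqrt (X.U S ω) * (X.θhat ω - X.θstar ω)) ≤ X.α ω := by
        rw [hω]; exact hωE.1
      exact not_lt.2 (pow_le_pow_left₀ (frob_nonneg _) h2 2)
    have h3 : 1 - δ₁ ≤ P.real (X.missed S)ᶜ :=
      hguar.trans (ENNReal.toReal_mono (measure_ne_top _ _) (measure_mono_ae h1))
    rw [probReal_compl_eq_one_sub hmiss] at h3
    linarith
  -- Markov for the conditional probability of a miss, whose mean is at most `δ₁ = δ / (16 S)`. The
  -- factor `1 / S` in `δ₁` pays for the threshold `1 / S`.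
  have p3 : P.real G₃ᶜ ≤ δ / 16 := by
    have h0 : 0 ≤ᵐ[P] f := condExp_nonneg (Filter.Eventually.of_forall fun ω =>
      Set.indicator_nonneg (fun _ _ => zero_le_one) ω)
    have h1 := mul_meas_ge_le_integral_of_nonneg h0 integrable_condExp (1 / (S : ℝ))
    rw [integral_condExp (X.𝓖.le S), integral_indicator hmiss] at h1
    simp only [integral_const, measureReal_restrict_apply_univ, smul_eq_mul, mul_one] at h1
    have h2 : P.real G₃ᶜ ≤ P.real {ω | 1 / (S : ℝ) ≤ f ω} :=
      measureReal_mono fun ω hω => (not_le.1 (show ¬f ω ≤ 1 / S from hω)).le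
    have h3 := h1.trans pm
    rw [hδ₁] at h3
    have h4 : P.real {ω | 1 / (S : ℝ) ≤ f ω} ≤ S * (δ / (16 * S)) := by
      rwa [div_mul_eq_mul_div, one_mul, div_le_iff₀' hS'] at h3
    refine (h2.trans h4).trans_eq ?_
    field_simp
  refine ⟨G₁ ∩ (G₂ ∩ G₃), m1.inter (m2.inter m3), ?_, fun ω hω => ⟨hω.1, hω.2.1, hω.2.2⟩⟩
  have hc : P.real (G₁ ∩ (G₂ ∩ G₃))ᶜ ≤ δ₁ + (δ₁ + δ / 16) := by
    rw [Set.compl_inter, Set.compl_inter]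
    exact (measureReal_union_le _ _).trans (add_le_add p1
      ((measureReal_union_le _ _).trans (add_le_add p2 p3)))
  rw [probReal_compl_eq_one_sub (n1.inter (n2.inter n3))] at hc
  have hS1 : (1 : ℝ) ≤ S := by exact_mod_cast hS
  have : δ₁ ≤ δ / 16 := by
    rw [hδ₁]
    exact div_le_div_of_nonneg_left hδ.le (by norm_num) (by linarith)
  linarith

end Experiment

/-- All logarithms are compared with `log (S / δ)`: here `S / δ₁ = 16 S² / δ` and `1 / δ₂ = 16 T /
δ`, with `log 16 ≤ 3`. -/
lemma log_sample_size_le {S T : ℕ} {δ : ℝ} (hδ0 : 0 < δ) (hδ1 : δ < 1) (hT : 1 ≤ T)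
    (hTS : T ≤ S) (hL : 1 ≤ Real.log (S / δ)) :
    0 ≤ Real.log (S / (δ / (16 * S))) ∧
      Real.log (S / (δ / (16 * S))) ≤ 5 * Real.log (S / δ) ∧
      Real.log (1 / (δ / (16 * T))) ≤ 4 * Real.log (S / δ) := by
  have hT' : (1 : ℝ) ≤ T := by exact_mod_cast hT
  have hTS' : (T : ℝ) ≤ S := by exact_mod_cast hTS
  have hS : (0 : ℝ) < S := by linarith
  have h16 : Real.log 16 ≤ 3 := by
    have : Real.log 16 = 4 * Real.log 2 := by
      rw [show (16 : ℝ) = 2 ^ 4 by norm_num, Real.log_pow]; norm_num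
    linarith [Real.log_two_lt_d9]
  have e1 : (S : ℝ) / (δ / (16 * S)) = 16 * (S * (S / δ)) := by field_simp
  have e2 : 1 / (δ / (16 * T)) = 16 * (T / δ) := by field_simp
  have h1 : Real.log (S : ℝ) ≤ Real.log (S / δ) :=
    Real.log_le_log hS (by rw [le_div_iff₀ hδ0]; nlinarith)
  have h2 : Real.log (T / δ) ≤ Real.log (S / δ) :=
    Real.log_le_log (by positivity) (by gcongr)
  have h3 : 0 ≤ Real.log (S : ℝ) := Real.log_nonneg (by linarith)
  have h4 : 0 ≤ Real.log 16 := Real.log_nonneg (by norm_num)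
  rw [e1, e2, Real.log_mul (by norm_num) (by positivity), Real.log_mul hS.ne' (by positivity),
    Real.log_mul (by norm_num) (by positivity)]
  refine ⟨by linarith, by linarith, by linarith⟩

/-- Without a state all costs vanish. The case is separate because the positivity of `β_t` needs `0
< n`. -/
lemma excessCost_eq_zero_of_isEmpty {m : ℕ} (I : RunInput 0 m) (T : ℕ) : I.excessCost T = 0 := by
  refine Finset.sum_eq_zero fun k _ => ?_
  have h1 : I.control k (I.state k) = 0 := by
    ext i
    simp [RunInput.control, Matrix.mulVec, dotProduct]
  rw [h1]
  simp [stageCost, optCost, Matrix.trace]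

/-- The regret bound for a nontrivial state space, in terms of the constants that control the
suboptimality of the admissible gains. -/
lemma regret_bound_of_pos {n m : ℕ} (hn : 0 < n) {Qc : Matrix (Fin n) (Fin n) ℝ}
    (hQ : Qc.PosDef) {Rc : Matrix (Fin m) (Fin m) ℝ} (hR : Rc.PosDef) {MP ρ r C₁ C₂ κ : ℝ}
    (hρ : ρ < 1) (hr : 0 < r) (hC₁ : 0 ≤ C₁) (hC₂ : 0 ≤ C₂) (hκ : 0 ≤ κ)
    (hgain : ∀ θstar θ : Param n m,
      θstar ∈ admissible Qc Rc MP ρ θstar → θ ∈ admissible Qc Rc MP ρ θstar →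
      ∀ x : Fin n → ℝ, gainGap Qc Rc θstar θ x ≤ C₁ * euc x ^ 2 ∧
        gainGap Qc Rc θstar θ x ≤ C₂ * frob (θ - θstar) ^ 2 * euc x ^ 2 ∧
        euc (optGain Qc Rc θ *ᵥ x) ^ 2 ≤ κ * euc x ^ 2)
    (cα : ℝ) (kα : ℕ) {S T : ℕ} {δ δ₁ δ₂ : ℝ} (hT : 1 ≤ T) (hδ0 : 0 < δ) (hδ1 : δ < 1)
    (hδ₁ : δ₁ = δ / (16 * S)) (hδ₂ : δ₂ = δ / (16 * T)) (hTS : (T : ℝ) ≤ S)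
    (hlen : 200 * ((n : ℝ) + m) * Real.log (12 / δ₁) ≤ S)
    {Ω : Type*} [MeasurableSpace Ω] {P : Measure Ω} [IsProbabilityMeasure P]
    {X : Experiment n m Ω} (hoff : X.OfflineModel S P) (hon : X.OnlineModel S P)
    (hguar : X.OfflineGuarantee S δ₁ P)
    (hα : 1 - δ₁ ≤ P.real {ω | X.α ω ≤ cα * Real.log (S / δ₁) ^ kα})
    (hball : ∀ᵐ ω ∂P, ∀ θ : Param n m, frob (θ - X.θstar ω) < r →
      θ ∈ admissible Qc Rc MP ρ (X.θstar ω))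
    (hθ : ∀ᵐ ω ∂P, X.θstar ω = X.θsim ω) :
    1 ≤ Real.log (S / δ) ∧ ∃ G : Set Ω, MeasurableSet[X.𝓖 S] G ∧ 1 - δ ≤ P.real G ∧
      IntegrableOn (fun ω => (X.run Qc Rc MP ρ S δ₂ 0 ω).excessCost T) G P ∧
      ∀ᵐ ω ∂P, ω ∈ G → X.regretOn Qc Rc MP ρ S T δ₂ 0 P G ω ≤
        (T : ℝ) / S * ((40 * OnlineSetting.stepRate n m ρ r C₁ C₂ κ * (5 + 2 * (cα ^ 2 * 25 ^ kα))
          + C₁ * (1 + OnlineSetting.fourthMomentBound n ρ))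
            * Real.log (S / δ) ^ (2 * kα + 1)) := by
  have hT' : (1 : ℝ) ≤ T := by exact_mod_cast hT
  have hS0 : (0 : ℝ) < S := by linarith
  have hS : 0 < S := by exact_mod_cast hS0
  have hn' : (1 : ℝ) ≤ n := by exact_mod_cast hn
  -- The length condition forces `S ≥ 200`, so that powers of the logarithm increase with the
  -- exponent.
  have hL : 1 ≤ Real.log (S / δ) := by
    have h1 : (1 : ℝ) ≤ Real.log (12 / δ₁) := by
      rw [Real.le_log_iff_exp_le (by rw [hδ₁]; positivity)]
      refine (Real.exp_one_lt_d9.le.trans (by norm_num : (2.7182818286 : ℝ) ≤ 12)).trans ?_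
      rw [le_div_iff₀ (by rw [hδ₁]; positivity), hδ₁]
      have : δ / (16 * S) ≤ 1 := by
        rw [div_le_one (by positivity)]; linarith
      linarith
    have h2 : (200 : ℝ) ≤ S := by
      refine le_trans ?_ hlen
      have : (1 : ℝ) ≤ (n : ℝ) + m := by
        have : (0 : ℝ) ≤ m := Nat.cast_nonneg m
        linarith
      nlinarith
    rw [Real.le_log_iff_exp_le (by positivity)]
    refine (Real.exp_one_lt_d9.le.trans (by norm_num : (2.7182818286 : ℝ) ≤ 200)).trans ?_
    rw [le_div_iff₀ hδ0]
    nlinarith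
  refine ⟨hL, ?_⟩
  obtain ⟨hlog0, hlog1, hlog2⟩ := log_sample_size_le hδ0 hδ1 hT (by exact_mod_cast hTS) hL
  rw [← hδ₁] at hlog0 hlog1
  rw [← hδ₂] at hlog2
  obtain ⟨G, hGm, hGP, hG⟩ := Experiment.exists_good_event hδ0 hS hδ₁ hlen hoff hon hguar hα hθ
  have hδ₂0 : 0 < δ₂ := by rw [hδ₂]; positivity
  have hδ₂1 : δ₂ < 1 := by
    rw [hδ₂, div_lt_one (by positivity)]; linarith
  have hc : (0 : ℝ) < S / 40 := by positivity
  have hset : ∀ᵐ ω ∂P, ω ∈ G → OnlineSetting Qc Rc MP ρ δ₂ r (S / 40) C₁ C₂ κ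
      (X.offlineData S ω) X.gaussians P := by
    filter_upwards [hball] with ω hω hωG
    exact
      { hQ := hQ, hR := hR, rho_lt := hρ, r_pos := hr, c_pos := hc, delta_pos := hδ₂0
        delta_lt := hδ₂1, n_pos := hn, C₁_nonneg := hC₁, C₂_nonneg := hC₂, kappa_nonneg := hκ
        gain := hgain, U_posDef := posDef_of_posSemidef_sub hc (hG ω hωG).1
        U_ge := mul_euc_sq_le_of_posSemidef_sub (hG ω hωG).1, alpha_nonneg := hoff.α_nonneg ω
        ball := hω, noise := hon.isStdNoise }
  have hint := Experiment.integrableOn_excessCost (T := T) hQ hR hoff hon hGm hset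
  refine ⟨G, hGm, hGP, hint, ?_⟩
  set L := Real.log (S / δ) with hLdef
  -- The exponent `2 * kα` serves `α_S²`, and the `+ 1` serves `log (1 / δ₂)`.
  set k := 2 * kα + 1 with hk
  set R := OnlineSetting.stepRate n m ρ r C₁ C₂ κ with hRdef
  have hR0 : 0 ≤ R := OnlineSetting.stepRate_nonneg n m hρ hC₁ hC₂ hκ
  set D := C₁ * (1 + OnlineSetting.fourthMomentBound n ρ) with hD
  have hD0 : 0 ≤ D := by
    have := OnlineSetting.fourthMomentBound_nonneg n ρ
    positivity
  -- The factor `25 ^ kα` is the square of `5 ^ kα` from `log (S / δ₁) ≤ 5 log (S / δ)`.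
  set a := cα ^ 2 * 25 ^ kα with ha
  have ha0 : 0 ≤ a := by positivity
  have hLk : 1 ≤ L ^ k := one_le_pow₀ hL
  have hLk' : L ≤ L ^ k := le_self_pow₀ hL (by omega)
  set b₀ := (T : ℝ) / S * (40 * R * (5 + 2 * a) * L ^ k) with hb₀
  have hb₀0 : 0 ≤ b₀ := by positivity
  have hmiss := Experiment.measurableSet_missed hoff hon
  have hαsq : ∀ ω ∈ G, X.α ω ^ 2 ≤ a * L ^ k := fun ω hω => by
    have h1 : X.α ω ≤ |cα| * (5 * L) ^ kα := (hG ω hω).2.1.trans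
      ((mul_le_mul_of_nonneg_right (le_abs_self cα) (pow_nonneg hlog0 kα)).trans
        (mul_le_mul_of_nonneg_left (pow_le_pow_left₀ hlog0 hlog1 kα) (abs_nonneg _)))
    have h2 := pow_le_pow_left₀ (hoff.α_nonneg ω) h1 2
    have h3 : (|cα| * (5 * L) ^ kα) ^ 2 = a * L ^ (2 * kα) := by
      rw [ha, mul_pow, sq_abs, ← pow_mul, mul_pow, mul_comm kα 2, pow_mul 5 2 kα]
      norm_num
      ring
    rw [h3] at h2
    exact h2.trans (mul_le_mul_of_nonneg_left (pow_le_pow_right₀ hL (by omega)) ha0)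
  -- For frozen offline data: the fast rate if the confidence set contains `θ_*`, the crude bound
  -- otherwise. Whether it does depends on `θ_*`, so the indicator is kept until conditioning on the
  -- offline data.
  have hfix : ∀ᵐ ω ∂P, ω ∈ G →
      ∫ ω', (noisyRun Qc Rc MP ρ δ₂ (X.offlineData S ω) X.gaussians ω').excessCost T ∂P ≤
        b₀ + T * D * (X.missed S).indicator (fun _ => (1 : ℝ)) ω := by
    filter_upwards [hset] with ω hω hωG
    by_cases hm : ω ∈ X.missed S
    · rw [Set.indicator_of_mem hm, mul_one]
      have := (hω hωG).integral_excessCost_le_mul T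
      linarith
    · rw [Set.indicator_of_notMem hm, mul_zero, add_zero]
      refine ((hω hωG).integral_excessCost_le_of_le (by linarith)).trans ?_
      have h1 : offlineError (X.offlineData S ω) ≤ X.α ω ^ 2 := not_lt.1 hm
      have h2 := hαsq ω hωG
      have h3 : 1 + Real.log (1 / δ₂) + (X.offlineData S ω).2.2.2 ^ 2
          + offlineError (X.offlineData S ω) ≤ (5 + 2 * a) * L ^ k := by
        have : (X.offlineData S ω).2.2.2 = X.α ω := rfl
        rw [this]
        linarith
      have h4 : ((S : ℝ) / 40)⁻¹ = 40 / S := inv_div _ _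
      rw [h4]
      calc (T : ℝ) * (R * (40 / S * _)) ≤ T * (R * (40 / S * ((5 + 2 * a) * L ^ k))) := by
            gcongr
        _ = b₀ := by rw [hb₀]; ring
  have hbi : Integrable (fun ω => b₀ + T * D * (X.missed S).indicator (fun _ => (1 : ℝ)) ω) P :=
    (integrable_const _).add (((integrable_const _).indicator hmiss).const_mul _)
  have hbn : ∀ ω, 0 ≤ b₀ + T * D * (X.missed S).indicator (fun _ => (1 : ℝ)) ω := fun ω =>
    add_nonneg hb₀0 (mul_nonneg (by positivity) (Set.indicator_nonneg (fun _ _ => zero_le_one) ω))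
  refine condExp_le_of_forall_setIntegral_le (X.𝓖.le S) hGm
    ((integrable_indicator_iff (X.𝓖.le S _ hGm)).2 hint) fun A hA hAG => ?_
  have hAm := X.𝓖.le S _ hA
  have e1 : ∫ ω in A, G.indicator (fun ω => (X.run Qc Rc MP ρ S δ₂ 0 ω).excessCost T) ω ∂P =
      ∫ ω in A, (X.run Qc Rc MP ρ S δ₂ 0 ω).excessCost T ∂P :=
    setIntegral_congr_fun hAm fun ω hω => Set.indicator_of_mem (hAG hω) _
  rw [e1]
  refine (Experiment.setIntegral_excessCost_le hQ hR hoff hon hA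
    (hset.mono fun ω h hω => h (hAG hω)) hbi (fun ω _ => hbn ω)
    (hfix.mono fun ω h hω => h (hAG hω))).trans ?_
  have hind : Integrable ((X.missed S).indicator fun _ => (1 : ℝ)) P :=
    (integrable_const _).indicator hmiss
  rw [integral_add (integrable_const _) (hind.const_mul _).integrableOn,
    integral_const_mul (T * D), ← setIntegral_condExp (X.𝓖.le S) hind hA]
  -- On `G` a miss has conditional probability at most `1 / S`, so the crude cost `T * D` enters
  -- only as `D * T / S`.
  have h5 : ∫ ω in A, (P[(X.missed S).indicator (fun _ => (1 : ℝ)) | X.𝓖 S]) ω ∂P ≤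
      ∫ _ in A, (1 / (S : ℝ)) ∂P :=
    setIntegral_mono_on integrable_condExp.integrableOn (integrable_const _) hAm
      fun ω hω => (hG ω (hAG hω)).2.2
  simp only [setIntegral_const, smul_eq_mul] at h5 ⊢
  have h6 := mul_le_mul_of_nonneg_left h5 (by positivity : 0 ≤ T * D)
  have h7 : T * D * (P.real A * (1 / S)) ≤ P.real A * ((T : ℝ) / S * (D * L ^ k)) := by
    have : D ≤ D * L ^ k := le_mul_of_one_le_right hD0 hLk
    calc T * D * (P.real A * (1 / S)) = P.real A * ((T : ℝ) / S * D) := by ring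
      _ ≤ _ := by gcongr
  calc _ ≤ P.real A * b₀ + P.real A * ((T : ℝ) / S * (D * L ^ k)) := by linarith
    _ = _ := by rw [hb₀]; ring

end Main

theorem corollary1 {n m : ℕ}
    (Qc : Matrix (Fin n) (Fin n) ℝ) (hQ : Qc.PosDef)
    (Rc : Matrix (Fin m) (Fin m) ℝ) (hR : Rc.PosDef)
    (MP ρ : ℝ) (hρ : ρ < 1)
    -- the margin by which the true parameter lies inside the admissible set
    (r : ℝ) (hr : 0 < r)
    -- the offline confidence radius is polylogarithmic, with these constants
    (cα : ℝ) (kα : ℕ) :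
    ∃ (C : ℝ) (k : ℕ), ∀ (S T : ℕ) (δ δ₁ δ₂ : ℝ), 1 ≤ T → 0 < δ → δ < 1 →
      δ₁ = δ / (16 * S) → δ₂ = δ / (16 * T) →
      max (T : ℝ) (200 * ((n : ℝ) + m) * Real.log (12 / δ₁)) ≤ S →
      ∀ (Ω : Type u) [MeasurableSpace Ω] (P : Measure Ω) [IsProbabilityMeasure P]
        (X : Experiment n m Ω),
        X.OfflineModel S P → X.OnlineModel S P →
        X.OfflineGuarantee S δ₁ P →
        1 - δ₁ ≤ P.real {ω | X.α ω ≤ cα * Real.log (S / δ₁) ^ kα} →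
        (∀ᵐ ω ∂P, ∀ θ : Param n m, frob (θ - X.θstar ω) < r →
          θ ∈ admissible Qc Rc MP ρ (X.θstar ω)) →
        (∀ᵐ ω ∂P, X.θstar ω = X.θsim ω) →
        ∃ G : Set Ω, MeasurableSet[X.𝓖 S] G ∧ 1 - δ ≤ P.real G ∧
          IntegrableOn (fun ω => (X.run Qc Rc MP ρ S δ₂ 0 ω).excessCost T) G P ∧
          ∀ᵐ ω ∂P, ω ∈ G →
            X.regretOn Qc Rc MP ρ S T δ₂ 0 P G ω
                ≤ C * Real.log (S / δ) ^ k * Real.sqrt ((T : ℝ) / S) ∧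
            X.regretOn Qc Rc MP ρ S T δ₂ 0 P G ω ≤ C * Real.log (S / δ) ^ k := by
  obtain ⟨C₁, C₂, κ, hC₁, hC₂, hκ, hgain⟩ := exists_gain_bounds hQ hR MP hρ
  refine ⟨40 * OnlineSetting.stepRate n m ρ r C₁ C₂ κ * (5 + 2 * (cα ^ 2 * 25 ^ kα))
    + C₁ * (1 + OnlineSetting.fourthMomentBound n ρ), 2 * kα + 1, ?_⟩
  have hR0 := OnlineSetting.stepRate_nonneg (r := r) n m hρ hC₁ hC₂ hκ
  have h40 := OnlineSetting.fourthMomentBound_nonneg n ρ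
  set C := 40 * OnlineSetting.stepRate n m ρ r C₁ C₂ κ * (5 + 2 * (cα ^ 2 * 25 ^ kα))
    + C₁ * (1 + OnlineSetting.fourthMomentBound n ρ) with hC
  have hC0 : 0 ≤ C := by positivity
  intro S T δ δ₁ δ₂ hT hδ0 hδ1 hδ₁ hδ₂ hmax Ω _ P _ X hoff hon hguar hα hball hθ
  have hTS := (le_max_left _ _).trans hmax
  have hlen := (le_max_right _ _).trans hmax
  have hT' : (1 : ℝ) ≤ T := by exact_mod_cast hT
  have hS0 : (0 : ℝ) < S := by linarith
  rcases Nat.eq_zero_or_pos n with rfl | hn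
  · have hzero : (fun ω => (X.run Qc Rc MP ρ S δ₂ 0 ω).excessCost T) = fun _ => 0 :=
      funext fun ω => excessCost_eq_zero_of_isEmpty _ T
    have hL : 0 ≤ Real.log (S / δ) := Real.log_nonneg (by rw [le_div_iff₀ hδ0]; linarith)
    refine ⟨Set.univ, MeasurableSet.univ, by simpa using hδ0.le, ?_, ?_⟩
    · rw [hzero]; exact integrable_zero _ _ _
    · have hreg : X.regretOn Qc Rc MP ρ S T δ₂ 0 P Set.univ = 0 := by
        rw [Experiment.regretOn, hzero, Set.indicator_univ]
        exact condExp_zero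
      rw [hreg]
      exact Filter.Eventually.of_forall fun ω _ => ⟨by simp only [Pi.zero_apply]; positivity,
        by simp only [Pi.zero_apply]; positivity⟩
  · obtain ⟨hL, G, hGm, hGP, hint, hreg⟩ := regret_bound_of_pos hn hQ hR hρ hr hC₁ hC₂ hκ hgain cα
      kα hT hδ0 hδ1 hδ₁ hδ₂ hTS hlen hoff hon hguar hα hball hθ
    refine ⟨G, hGm, hGP, hint, ?_⟩
    have hq0 : 0 ≤ (T : ℝ) / S := by positivity
    have hq1 : (T : ℝ) / S ≤ 1 := (div_le_one hS0).2 hTS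
    -- Since `T / S ≤ 1`, the rate `T / S` implies the square root rate.
    have hq : (T : ℝ) / S ≤ Real.sqrt ((T : ℝ) / S) := by
      refine Real.le_sqrt_of_sq_le ?_
      nlinarith
    have hB : 0 ≤ C * Real.log (S / δ) ^ (2 * kα + 1) := by positivity
    filter_upwards [hreg] with ω hω hωG
    refine ⟨(hω hωG).trans ?_, (hω hωG).trans (mul_le_of_le_one_left hB hq1)⟩
    rw [mul_comm]
    exact mul_le_mul_of_nonneg_left hq hB
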